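/- Let $\Omega$ be either $\mathbb{R}$ or a bounded open interval $(a,b)$ with homogeneous Dirichlet or periodic boundary conditions, and write $H^1(\Omega)$ for the corresponding Sobolev space ($H^1_0(a,b)$ in the Dirichlet case, periodic $H^1$ in the periodic case). For an integer $n\ge 2$ and $0<\varepsilon<1$ let $$f_n^\varepsilon(\rho)=\begin{cases}\ln\rho, & \rho\ge\varepsilon^2,\\[2pt] \ln(\varepsilon^2)-\frac{n+1}{n}\left(1-\frac{\rho}{\varepsilon^2}\right)^n-\sum_{k=1}^{n-1}\frac1k\left(1-\frac{\rho}{\varepsilon^2}\right)^k, & 0\le\rho<\varepsilon^2,\end{cases}$$ and consider the energy-regularized logarithmic Schrödinger equation $$i\partial_t u^\varepsilon=-\partial_{xx}u^\varepsilon+u^\varepsilon f_n^\varepsilon(|u^\varepsilon|^2)\quad\text{in }\Omega,\qquad u^\varepsilon(\cdot,0)=u_0 .$$ Let $\Phi_A^t(v)=e^{it\Delta}v$, where $\Delta=\partial_{xx}$ carries the given boundary conditions, let $\Phi_B^t(v)=v\,e^{-itf_n^\varepsilon(|v|^2)}$, and for a time step $\tau>0$ define the Lie–Trotter splitting approximations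 by $u^{\varepsilon,0}=u_0$, $u^{\varepsilon,k+1}=\Phi_A^\tau(\Phi_B^\tau(u^{\varepsilon,k}))$, $k\ge 0$. Fix $\Omega$ with its boundary condition, $n\ge2$, $\tau_0>0$ and $M\ge 0$. Then there is $\varepsilon_0\in(0,1)$, depending only on these data, and for every $T>0$ there is a constant $C=C(n,\tau_0,T,M)>0$ (for the fixed $\Omega$), such that the following holds. If $0<\varepsilon\le\varepsilon_0$, if $u^\varepsilon\in L^\infty([0,T];H^1(\Omega))$ is a weak solution of the equation on $[0,T]$ with initial value $u_0$ and $\|u^\varepsilon\|_{L^\infty([0,T];H^1(\Omega))}\le M$, and if $0<\tau\le\tau_0$, then for all integers $k\ge0$ with $t_k:=k\tau\le T$ $$\|u^{\varepsilon,k}-u^\varepsilon(t_k)\|_{L^2(\Omega)}\le C\,\ln(\varepsilon^{-1})\,\tau^{1/2}.$$ -/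

import Mathlib

open MeasureTheory Set
open scoped ENNReal ContDiff FourierTransform ComplexConjugate

noncomputable section

namespace ERLogSE

/-- The regularized logarithm `f_n^ε`, the derivative of the regularized energy density `F_n^ε`:
it equals `log ρ` for `ρ ≥ ε²` and a polynomial of degree `n` in `ρ` for `ρ < ε²`. -/
def regLog (n : ℕ) (ε ρ : ℝ) : ℝ :=
  if ε ^ 2 ≤ ρ then Real.log ρ
  else Real.log (ε ^ 2) - ((n : ℝ) + 1) / n * (1 - ρ / ε ^ 2) ^ n
    - ∑ k ∈ Finset.Icc 1 (n - 1), 1 / (k : ℝ) * (1 - ρ / ε ^ 2) ^ k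

/-- A one-dimensional spatial domain `Ω` together with its boundary condition: the whole line, or
a bounded interval `(a, b)` with homogeneous Dirichlet or with periodic boundary condition. -/
inductive Domain1D : Type
  | line : Domain1D
  | dirichlet (a b : ℝ) (hab : a < b) : Domain1D
  | periodic (a b : ℝ) (hab : a < b) : Domain1D

/-- Lebesgue measure on `Ω`. -/
def Domain1D.vol : Domain1D → Measure ℝ
  | .line => volume
  | .dirichlet a b _ => volume.restrict (Ioo a b)
  | .periodic a b _ => volume.restrict (Ioo a b)

/-- The complex Hilbert space `L²(Ω)`. -/
abbrev Domain1D.L2 (S : Domain1D) : Type := Lp ℂ 2 S.vol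

/-- Smooth test functions: compactly supported in `Ω`, or, in the periodic case, `(b - a)`-periodic
on the line (that is, smooth functions on the torus). -/
def Domain1D.IsTest (S : Domain1D) (φ : ℝ → ℂ) : Prop :=
  ContDiff ℝ ∞ φ ∧
    match S with
    | .line => HasCompactSupport φ
    | .dirichlet a b _ => HasCompactSupport φ ∧ tsupport φ ⊆ Ioo a b
    | .periodic a b _ => Function.Periodic φ (b - a)

/-- `w` is the weak derivative of `v`. -/
def Domain1D.HasWeakDeriv (S : Domain1D) (v w : S.L2) : Prop :=
  ∀ φ : ℝ → ℂ, S.IsTest φ → ∫ x, v x * deriv φ x ∂S.vol = - ∫ x, w x * φ x ∂S.vol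

/-- The pair `(v, w)` is an `H¹`-limit of test functions. -/
def Domain1D.IsLimitOfTests (S : Domain1D) (v w : S.L2) : Prop :=
  ∀ δ : ℝ, 0 < δ → ∃ φ : ℝ → ℂ, S.IsTest φ ∧
    eLpNorm (fun x => v x - φ x) 2 S.vol ≤ ENNReal.ofReal δ ∧
    eLpNorm (fun x => w x - deriv φ x) 2 S.vol ≤ ENNReal.ofReal δ

/-- `v` lies in the Sobolev space of order one that belongs to `S`, with derivative `w`.  The space
is `H¹(ℝ)`, or `H¹₀(a, b)` (the `H¹`-closure of the test functions), or the periodic `H¹`. -/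
def Domain1D.IsH1 (S : Domain1D) (v w : S.L2) : Prop :=
  S.HasWeakDeriv v w ∧
    match S with
    | .line => True
    | .dirichlet a b hab => (Domain1D.dirichlet a b hab).IsLimitOfTests v w
    | .periodic _ _ _ => True

/-- Membership in `H¹(ℝ)`, `H¹₀(a, b)`, or the periodic `H¹(a, b)`. -/
def Domain1D.MemH1 (S : Domain1D) (v : S.L2) : Prop := ∃ w : S.L2, S.IsH1 v w

open Classical in
/-- The (unique) weak derivative of an element of `H¹`; zero outside `H¹`. -/
def Domain1D.weakDeriv (S : Domain1D) (v : S.L2) : S.L2 :=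
  if h : S.MemH1 v then Classical.choose h else 0

/-- The `H¹` norm of an element of `H¹`. -/
def Domain1D.h1Norm (S : Domain1D) (v : S.L2) : ℝ :=
  √(‖v‖ ^ 2 + ‖S.weakDeriv v‖ ^ 2)

/-- The norm of `L^∞([0, T]; H¹)`. -/
def Domain1D.linftyH1Norm (S : Domain1D) (T : ℝ) (u : ℝ → S.L2) : ℝ≥0∞ :=
  eLpNorm (fun t => S.h1Norm (u t)) ⊤ (volume.restrict (Icc 0 T))

/-- `u ∈ L^∞([0, T]; H¹)`. -/
def Domain1D.MemLinftyH1 (S : Domain1D) (T : ℝ) (u : ℝ → S.L2) : Prop :=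
  AEStronglyMeasurable u (volume.restrict (Icc 0 T)) ∧
    (∀ᵐ t ∂(volume.restrict (Icc 0 T)), S.MemH1 (u t)) ∧
    S.linftyH1Norm T u < ⊤

/-- `u ∈ L^∞([0, T]; H¹)` is a weak solution on `[0, T]` of
`i ∂ₜ u = -∂ₓₓ u + u f_n^ε(|u|²)`, `u(0) = u₀`: the equation holds in the dual space of `H¹`
(of `H¹₀` for Dirichlet conditions), integrated in time from `0` to any `t ∈ [0, T]`.  This fixes
`u(t) ∈ L²` for every `t ∈ [0, T]`. -/
structure IsWeakSolution (S : Domain1D) (n : ℕ) (ε T : ℝ) (u₀ : S.L2) (u : ℝ → S.L2) : Prop where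
  memLinftyH1 : S.MemLinftyH1 T u
  init : u 0 = u₀
  weak_eq : ∀ φ : S.L2, S.MemH1 φ → ∀ t ∈ Icc 0 T,
    Complex.I * (inner ℂ φ (u t) - inner ℂ φ u₀) =
      ∫ s in (0 : ℝ)..t, (inner ℂ (S.weakDeriv φ) (S.weakDeriv (u s))
        + ∫ x, conj (φ x) * (u s x * (regLog n ε (‖u s x‖ ^ 2) : ℂ)) ∂S.vol)

theorem memLp_phase_mul {μ : Measure ℝ} {θ : ℝ → ℝ} (hθ : AEStronglyMeasurable θ μ)
    (v : Lp ℂ 2 μ) : MemLp (fun x => Complex.exp (Complex.I * (θ x : ℂ)) * v x) 2 μ := by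
  refine (Lp.memLp v).of_le ?_ (Filter.Eventually.of_forall fun x => ?_)
  · refine AEStronglyMeasurable.mul ?_ (Lp.aestronglyMeasurable v)
    exact (by fun_prop : Continuous fun y : ℝ => Complex.exp (Complex.I * (y : ℂ))
      ).comp_aestronglyMeasurable hθ
  · rw [norm_mul, mul_comm Complex.I, Complex.norm_exp_ofReal_mul_I, one_mul]

/-- Multiplication of an `L²` function by the phase `exp(iθ)`. -/
def phaseMul {μ : Measure ℝ} (θ : ℝ → ℝ) (hθ : AEStronglyMeasurable θ μ) (v : Lp ℂ 2 μ) :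
    Lp ℂ 2 μ :=
  (memLp_phase_mul hθ v).toLp _

theorem measurable_regLog (n : ℕ) (ε : ℝ) : Measurable (regLog n ε) := by
  unfold regLog
  refine Measurable.ite measurableSet_Ici Real.measurable_log ?_
  exact Continuous.measurable (by fun_prop)

theorem aestronglyMeasurable_regLog {μ : Measure ℝ} (n : ℕ) (ε t : ℝ) (v : Lp ℂ 2 μ) :
    AEStronglyMeasurable (fun x => -t * regLog n ε (‖v x‖ ^ 2)) μ :=
  (((measurable_regLog n ε).comp_aemeasurable
    ((Lp.aestronglyMeasurable v).norm.aemeasurable.pow_const 2)).const_mul (-t)).aestronglyMeasurable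

/-- The flow `Φ_B^t(w) = w exp(-i t f_n^ε(|w|²))` of the nonlinear subproblem. -/
def flowB (S : Domain1D) (n : ℕ) (ε t : ℝ) (w : S.L2) : S.L2 :=
  phaseMul (fun x => -t * regLog n ε (‖w x‖ ^ 2)) (aestronglyMeasurable_regLog n ε t w) w

theorem memLp_sine (a b : ℝ) (k : ℕ) :
    MemLp (fun x : ℝ => ((√(2 / (b - a)) * Real.sin ((k + 1) * Real.pi * (x - a) / (b - a)) : ℝ) : ℂ))
      2 (volume.restrict (Ioo a b)) := by
  refine MemLp.of_bound (Continuous.aestronglyMeasurable (by fun_prop)) (√(2 / (b - a)))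
    (Filter.Eventually.of_forall fun x => ?_)
  rw [Complex.norm_real, Real.norm_eq_abs, abs_mul, abs_of_nonneg (Real.sqrt_nonneg _)]
  exact mul_le_of_le_one_right (Real.sqrt_nonneg _) (Real.abs_sin_le_one _)

/-- The normalized Dirichlet eigenfunction `√(2/(b-a)) sin((k+1)π(x-a)/(b-a))` of `-Δ`. -/
def sineMode (a b : ℝ) (k : ℕ) : Lp ℂ 2 (volume.restrict (Ioo a b)) :=
  (memLp_sine a b k).toLp _

theorem memLp_expMode (a b : ℝ) (k : ℤ) :
    MemLp (fun x : ℝ => ((√(b - a))⁻¹ : ℂ) *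
      Complex.exp (Complex.I * ((2 * Real.pi * k * (x - a) / (b - a) : ℝ) : ℂ)))
      2 (volume.restrict (Ioo a b)) := by
  refine MemLp.of_bound (Continuous.aestronglyMeasurable (by fun_prop)) ‖((√(b - a))⁻¹ : ℂ)‖
    (Filter.Eventually.of_forall fun x => ?_)
  rw [norm_mul, mul_comm Complex.I, Complex.norm_exp_ofReal_mul_I, mul_one]

/-- The normalized periodic eigenfunction `(b-a)^{-1/2} exp(2πik(x-a)/(b-a))` of `-Δ`. -/
def expMode (a b : ℝ) (k : ℤ) : Lp ℂ 2 (volume.restrict (Ioo a b)) :=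
  (memLp_expMode a b k).toLp _

/-- `e^{itΔ}` on `L²(ℝ)`: the Fourier multiplier `exp(-4π²itξ²)`. -/
def lineFlow (t : ℝ) (v : Lp ℂ 2 (volume : Measure ℝ)) : Lp ℂ 2 (volume : Measure ℝ) :=
  𝓕⁻ (phaseMul (fun ξ => -t * (2 * Real.pi * ξ) ^ 2)
    (Continuous.aestronglyMeasurable (by fun_prop)) (𝓕 v))

/-- `e^{itΔ}` on `L²(a, b)` for the Dirichlet Laplacian, by expansion in its eigenfunctions. -/
def dirichletFlow (a b t : ℝ) (v : Lp ℂ 2 (volume.restrict (Ioo a b))) :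
    Lp ℂ 2 (volume.restrict (Ioo a b)) :=
  ∑' k : ℕ, Complex.exp (Complex.I * ((-t * ((k + 1) * Real.pi / (b - a)) ^ 2 : ℝ) : ℂ)) •
    ((inner ℂ (sineMode a b k) v : ℂ) • sineMode a b k)

/-- `e^{itΔ}` on `L²(a, b)` for the periodic Laplacian, by expansion in its eigenfunctions. -/
def periodicFlow (a b t : ℝ) (v : Lp ℂ 2 (volume.restrict (Ioo a b))) :
    Lp ℂ 2 (volume.restrict (Ioo a b)) :=
  ∑' k : ℤ, Complex.exp (Complex.I * ((-t * (2 * Real.pi * k / (b - a)) ^ 2 : ℝ) : ℂ)) •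
    ((inner ℂ (expMode a b k) v : ℂ) • expMode a b k)

/-- The flow `Φ_A^t = e^{itΔ}` of the linear subproblem on `L²(Ω)`. -/
def flowA : (S : Domain1D) → ℝ → S.L2 → S.L2
  | .line, t, v => lineFlow t v
  | .dirichlet a b _, t, v => dirichletFlow a b t v
  | .periodic a b _, t, v => periodicFlow a b t v

/-- The Lie–Trotter splitting `u^{k+1} = Φ_A^τ(Φ_B^τ(u^k))`, `u^0 = u₀`. -/
def lieTrotter (S : Domain1D) (n : ℕ) (ε τ : ℝ) (u₀ : S.L2) : ℕ → S.L2
  | 0 => u₀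
  | k + 1 => flowA S τ (flowB S n ε τ (lieTrotter S n ε τ u₀ k))

end ERLogSE

end

/-
In each of the three cases `-∂ₓₓ` is unitarily equivalent to multiplication by a nonnegative symbol
(Fourier transform on the line, sine basis, exponential basis), and `Φ_A^t` is the group it
generates.  As `H¹ ⊂ L^∞` in one dimension, the nonlinearity may be cut off where `|z|` exceeds a
constant depending only on `Ω` and `M`.  The cut-off `F` is Lipschitz with constant
`K = O(log ε⁻¹)`, so it is `K`-Lipschitz on `L²` and multiplies the norm of the derivative by at
most `K`.

Testing the equation against spectral truncations yields Duhamel's formula.  Since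
`‖e^{isΔ} v - v‖ ≤ √(2|s|) ‖∂ₓ v‖`, one splitting step started from the exact solution has error
`O((τ K² + √τ K) τ)`, which is `O(K τ^{3/2})` if `K √τ ≤ 1`; if `K √τ > 1`, the theorem is trivial,
as both flows preserve the `L²` norm.  The logarithm does not enter the stability of the scheme:
`Φ_B^τ` is Lipschitz on `L²` with constant `1 + 4 n τ` independently of `ε`, so the local errors
accumulate only by a factor `e^{4 n T}`.
-/

open Filter Topology
open scoped NNReal

noncomputable section

namespace ERLogSE

section RegularizedLogarithm

/-- The polynomial `y ^ n + ∑ k ∈ {1, …, n}, y ^ k / k`, which `log (ε ^ 2) - f_n^ε` equals on the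
inner branch `ρ < ε ^ 2`, as a function of `y = 1 - ρ / ε ^ 2`. -/
def regPoly (n : ℕ) (y : ℝ) : ℝ := y ^ n + ∑ k ∈ Finset.Icc 1 n, 1 / (k : ℝ) * y ^ k

theorem regPoly_zero {n : ℕ} (hn : 1 ≤ n) : regPoly n 0 = 0 := by
  rw [regPoly, zero_pow (by lia), zero_add]
  refine Finset.sum_eq_zero fun k hk => ?_
  rw [zero_pow (by grind), mul_zero]

theorem abs_pow_sub_pow_le_of_mem_Icc {x y : ℝ} (hx : x ∈ Icc 0 1) (hy : y ∈ Icc 0 1) (k : ℕ) :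
    |x ^ k - y ^ k| ≤ k * |x - y| := by
  have hmax : max |x| |y| ≤ 1 := by
    rw [abs_of_nonneg hx.1, abs_of_nonneg hy.1]; exact max_le hx.2 hy.2
  calc |x ^ k - y ^ k| ≤ |x - y| * k * max |x| |y| ^ (k - 1) := abs_pow_sub_pow_le x y k
    _ ≤ |x - y| * k * 1 := by gcongr; exact pow_le_one₀ (by positivity) hmax
    _ = k * |x - y| := by ring

theorem abs_regPoly_sub_le (n : ℕ) {x y : ℝ} (hx : x ∈ Icc 0 1) (hy : y ∈ Icc 0 1) :
    |regPoly n x - regPoly n y| ≤ 2 * n * |x - y| := by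
  have hterm : ∀ k ∈ Finset.Icc 1 n, |1 / (k : ℝ) * x ^ k - 1 / (k : ℝ) * y ^ k| ≤ |x - y| := by
    intro k hk
    have hk0 : (0 : ℝ) < k := by exact_mod_cast (Finset.mem_Icc.1 hk).1
    rw [← mul_sub, abs_mul, abs_of_nonneg (by positivity)]
    calc 1 / (k : ℝ) * |x ^ k - y ^ k| ≤ 1 / (k : ℝ) * (k * |x - y|) := by
          gcongr; exact abs_pow_sub_pow_le_of_mem_Icc hx hy k
      _ = |x - y| := by field_simp
  have hsum : |∑ k ∈ Finset.Icc 1 n, (1 / (k : ℝ) * x ^ k - 1 / (k : ℝ) * y ^ k)| ≤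
      n * |x - y| := by
    refine ((Finset.abs_sum_le_sum_abs _ _).trans
      (Finset.sum_le_card_nsmul _ _ _ hterm)).trans_eq ?_
    simp
  calc |regPoly n x - regPoly n y|
      = |(x ^ n - y ^ n) + ∑ k ∈ Finset.Icc 1 n, (1 / (k : ℝ) * x ^ k - 1 / (k : ℝ) * y ^ k)| := by
        rw [Finset.sum_sub_distrib, regPoly, regPoly]; ring_nf
    _ ≤ n * |x - y| + n * |x - y| :=
        (abs_add_le _ _).trans (add_le_add (abs_pow_sub_pow_le_of_mem_Icc hx hy n) hsum)
    _ = 2 * n * |x - y| := by ring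

variable {n : ℕ} {ε r s B : ℝ}

theorem regLog_sq_of_le (hε : 0 < ε) (h : ε ≤ r) : regLog n ε (r ^ 2) = 2 * Real.log r := by
  rw [regLog, if_pos (by gcongr), Real.log_pow]; norm_num

theorem regLog_sq_of_ge (hn : 1 ≤ n) (hε : 0 < ε) (hr : 0 ≤ r) (h : r ≤ ε) :
    regLog n ε (r ^ 2) = 2 * Real.log ε - regPoly n (1 - r ^ 2 / ε ^ 2) := by
  rcases h.lt_or_eq with h | rfl
  · obtain ⟨m, rfl⟩ := Nat.exists_eq_add_of_le' hn
    rw [regLog, if_neg (not_le.2 (by gcongr)), regPoly, Real.log_pow, Nat.add_sub_cancel,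
      Finset.sum_Icc_succ_top (by lia)]
    push_cast
    field_simp
    ring
  · rw [regLog_sq_of_le hε le_rfl, div_self (by positivity), sub_self, regPoly_zero hn, sub_zero]

theorem one_sub_sq_div_sq_mem_Icc (hε : 0 < ε) (hr : 0 ≤ r) (h : r ≤ ε) :
    1 - r ^ 2 / ε ^ 2 ∈ Icc (0 : ℝ) 1 :=
  ⟨sub_nonneg.2 ((div_le_one (by positivity)).2 (by gcongr)), sub_le_self _ (by positivity)⟩

theorem mul_abs_regLog_sub_le_of_le_left (hn : 1 ≤ n) (hε : 0 < ε) (hr : ε ≤ r) (hrs : r ≤ s) :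
    r * |regLog n ε (r ^ 2) - regLog n ε (s ^ 2)| ≤ 4 * n * (s - r) := by
  have hr0 := hε.trans_le hr
  have hs0 := hr0.trans_le hrs
  have hlog : 0 ≤ Real.log (s / r) := Real.log_nonneg ((one_le_div hr0).2 hrs)
  have hn' : (1 : ℝ) ≤ n := by exact_mod_cast hn
  calc r * |regLog n ε (r ^ 2) - regLog n ε (s ^ 2)| = r * (2 * Real.log (s / r)) := by
        rw [regLog_sq_of_le hε hr, regLog_sq_of_le hε (hr.trans hrs), abs_sub_comm, ← mul_sub,
          ← Real.log_div hs0.ne' hr0.ne', abs_of_nonneg (by positivity)]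
    _ ≤ r * (2 * (s / r - 1)) := by
        gcongr; exact Real.log_le_sub_one_of_pos (div_pos hs0 hr0)
    _ = 2 * (s - r) := by field_simp
    _ ≤ 4 * n * (s - r) := by
        have := sub_nonneg.2 hrs
        gcongr
        linarith

theorem mul_abs_regLog_sub_le_of_right_le (hn : 1 ≤ n) (hε : 0 < ε) (hr : 0 ≤ r) (hrs : r ≤ s)
    (hs : s ≤ ε) : r * |regLog n ε (r ^ 2) - regLog n ε (s ^ 2)| ≤ 4 * n * (s - r) := by
  have hs0 := hr.trans hrs
  have hpoly := abs_regPoly_sub_le n (one_sub_sq_div_sq_mem_Icc hε hs0 hs)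
    (one_sub_sq_div_sq_mem_Icc hε hr (hrs.trans hs))
  have harg : |1 - s ^ 2 / ε ^ 2 - (1 - r ^ 2 / ε ^ 2)| = (s - r) * (s + r) / ε ^ 2 := by
    rw [abs_sub_comm, sub_sub_sub_cancel_left, abs_of_nonneg (by rw [sub_nonneg]; gcongr)]
    ring
  have hprod : r * (s + r) ≤ ε * (ε + ε) := by gcongr <;> linarith
  rw [regLog_sq_of_ge hn hε hr (hrs.trans hs), regLog_sq_of_ge hn hε hs0 hs,
    sub_sub_sub_cancel_left]
  calc r * |regPoly n (1 - s ^ 2 / ε ^ 2) - regPoly n (1 - r ^ 2 / ε ^ 2)|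
      ≤ r * (2 * n * ((s - r) * (s + r) / ε ^ 2)) := by rw [← harg]; gcongr
    _ = 2 * n * (s - r) * (r * (s + r)) / ε ^ 2 := by ring
    _ ≤ 2 * n * (s - r) * (ε * (ε + ε)) / ε ^ 2 := by
        have := sub_nonneg.2 hrs
        gcongr
    _ = 4 * n * (s - r) := by field_simp; ring

theorem mul_abs_regLog_sub_le (hn : 1 ≤ n) (hε : 0 < ε) (hr : 0 ≤ r) (hrs : r ≤ s) :
    r * |regLog n ε (r ^ 2) - regLog n ε (s ^ 2)| ≤ 4 * n * (s - r) := by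
  rcases le_total ε r with h | h
  · exact mul_abs_regLog_sub_le_of_le_left hn hε h hrs
  rcases le_total s ε with h' | h'
  · exact mul_abs_regLog_sub_le_of_right_le hn hε hr hrs h'
  calc r * |regLog n ε (r ^ 2) - regLog n ε (s ^ 2)|
      ≤ r * (|regLog n ε (r ^ 2) - regLog n ε (ε ^ 2)|
          + |regLog n ε (ε ^ 2) - regLog n ε (s ^ 2)|) := by gcongr; exact abs_sub_le _ _ _
    _ ≤ r * |regLog n ε (r ^ 2) - regLog n ε (ε ^ 2)|
          + ε * |regLog n ε (ε ^ 2) - regLog n ε (s ^ 2)| := by rw [mul_add]; gcongr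
    _ ≤ 4 * n * (ε - r) + 4 * n * (s - ε) :=
        add_le_add (mul_abs_regLog_sub_le_of_right_le hn hε hr h le_rfl)
          (mul_abs_regLog_sub_le_of_le_left hn hε le_rfl h')
    _ = 4 * n * (s - r) := by ring

theorem abs_regLog_sq_le (hn : 1 ≤ n) (hε : 0 < ε) (hε1 : ε ≤ 1) (hB : 1 ≤ B) (hr : 0 ≤ r)
    (hrB : r ≤ B) : |regLog n ε (r ^ 2)| ≤ 2 * Real.log ε⁻¹ + 2 * n + 2 * Real.log B := by
  have hB' := Real.log_nonneg hB
  have hε' := Real.log_nonpos hε.le hε1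
  rw [Real.log_inv]
  rcases le_total ε r with h | h
  · have hlower := Real.log_le_log hε h
    have hupper := Real.log_le_log (hε.trans_le h) hrB
    rw [regLog_sq_of_le hε h, abs_le]
    constructor <;> linarith [n.cast_nonneg (α := ℝ)]
  · have hy := one_sub_sq_div_sq_mem_Icc hε hr h
    have hpoly : |regPoly n (1 - r ^ 2 / ε ^ 2)| ≤ 2 * n := by
      have := abs_regPoly_sub_le n hy (y := 0) (by simp)
      rw [regPoly_zero hn, sub_zero, sub_zero, abs_of_nonneg hy.1] at this
      exact this.trans (mul_le_of_le_one_right (by positivity) hy.2)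
    rw [regLog_sq_of_ge hn hε hr h]
    refine (abs_sub _ _).trans ?_
    rw [abs_of_nonpos (by linarith)]
    linarith

end RegularizedLogarithm

section PointwiseNonlinearity

theorem lipschitzWith_smul_self {𝕜 E : Type*} [NormedField 𝕜] [SeminormedAddCommGroup E]
    [NormedSpace 𝕜 E] {p : E → 𝕜} {b c : ℝ≥0} (hb : ∀ z, ‖p z‖ ≤ b)
    (hc : ∀ z w, ‖w‖ ≤ ‖z‖ → ‖w‖ * ‖p z - p w‖ ≤ c * ‖z - w‖) :
    LipschitzWith (b + c) fun z => p z • z := by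
  refine LipschitzWith.of_dist_le_mul fun z w => ?_
  rw [dist_eq_norm, dist_eq_norm]
  wlog h : ‖w‖ ≤ ‖z‖ generalizing z w
  · rw [norm_sub_rev, norm_sub_rev z]; exact this w z (le_of_not_ge h)
  calc ‖p z • z - p w • w‖ = ‖p z • (z - w) + (p z - p w) • w‖ := by
        rw [smul_sub, sub_smul, sub_add_sub_cancel]
    _ ≤ ‖p z‖ * ‖z - w‖ + ‖w‖ * ‖p z - p w‖ := by
        rw [mul_comm ‖w‖, ← norm_smul, ← norm_smul]; exact norm_add_le _ _
    _ ≤ b * ‖z - w‖ + c * ‖z - w‖ :=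
        add_le_add (mul_le_mul_of_nonneg_right (hb z) (norm_nonneg _)) (hc z w h)
    _ = ↑(b + c) * ‖z - w‖ := by push_cast; ring

variable {n : ℕ} {ε B : ℝ}

/-- The nonlinearity `z f_n^ε(|z|²)` with the argument of `f_n^ε` cut off at `|z| = B`; the cut-off
makes it globally Lipschitz without changing it on functions bounded by `B`. -/
def cutNonlin (n : ℕ) (ε B : ℝ) (z : ℂ) : ℂ := (regLog n ε (min ‖z‖ B ^ 2) : ℂ) • z

/-- A Lipschitz constant of `cutNonlin n ε B`. -/
def nonlinLip (n : ℕ) (ε B : ℝ) : ℝ≥0 :=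
  (2 * Real.log ε⁻¹ + 2 * n + 2 * Real.log B).toNNReal + 4 * n

/-- The map `z ↦ z exp (-i t f_n^ε(|z|²))` that `Φ_B^t` applies pointwise. -/
def phaseMap (n : ℕ) (ε t : ℝ) (z : ℂ) : ℂ :=
  Complex.exp (Complex.I * ((-t * regLog n ε (‖z‖ ^ 2) : ℝ) : ℂ)) • z

theorem cutNonlin_zero (n : ℕ) (ε B : ℝ) : cutNonlin n ε B 0 = 0 := smul_zero _

theorem cutNonlin_of_norm_le {z : ℂ} (h : ‖z‖ ≤ B) :
    cutNonlin n ε B z = z * (regLog n ε (‖z‖ ^ 2) : ℂ) := by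
  rw [cutNonlin, min_eq_left h, smul_eq_mul, mul_comm]

theorem abs_regLog_sq_le_nonlinLip (hn : 1 ≤ n) (hε : 0 < ε) (hε1 : ε ≤ 1) (hB : 1 ≤ B) {r : ℝ}
    (hr : 0 ≤ r) (hrB : r ≤ B) : |regLog n ε (r ^ 2)| ≤ nonlinLip n ε B := by
  refine (abs_regLog_sq_le hn hε hε1 hB hr hrB).trans ((Real.le_coe_toNNReal _).trans ?_)
  rw [nonlinLip]
  exact_mod_cast le_self_add

theorem lipschitzWith_cutNonlin (hn : 1 ≤ n) (hε : 0 < ε) (hε1 : ε ≤ 1) (hB : 1 ≤ B) :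
    LipschitzWith (nonlinLip n ε B) (cutNonlin n ε B) := by
  refine lipschitzWith_smul_self (fun z => ?_) fun z w h => ?_
  · rw [Complex.norm_real, Real.norm_eq_abs]
    exact (abs_regLog_sq_le hn hε hε1 hB (by positivity) (min_le_right _ _)).trans
      (Real.le_coe_toNNReal _)
  rw [← Complex.ofReal_sub, Complex.norm_real, Real.norm_eq_abs]
  push_cast
  rcases le_total B ‖w‖ with hw | hw
  · rw [min_eq_right hw, min_eq_right (hw.trans h), sub_self, abs_zero, mul_zero]
    positivity
  · rw [min_eq_left hw, abs_sub_comm]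
    refine (mul_abs_regLog_sub_le hn hε (norm_nonneg w) (le_min h hw)).trans ?_
    gcongr
    linarith [norm_sub_norm_le z w, min_le_left ‖z‖ B]

theorem norm_exp_I_mul_sub_exp_I_mul_le (a b : ℝ) :
    ‖Complex.exp (Complex.I * a) - Complex.exp (Complex.I * b)‖ ≤ |a - b| := by
  have h : Complex.exp (Complex.I * a) - Complex.exp (Complex.I * b) =
      Complex.exp (Complex.I * b) * (Complex.exp (Complex.I * (a - b : ℝ)) - 1) := by
    rw [mul_sub, ← Complex.exp_add]; push_cast; ring_nf
  rw [h, norm_mul, Complex.norm_exp_I_mul_ofReal, one_mul]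
  exact Real.norm_exp_I_mul_ofReal_sub_one_le

theorem norm_exp_I_mul_sub_one_sub_le (y : ℝ) :
    ‖Complex.exp (Complex.I * y) - 1 - Complex.I * y‖ ≤ 2 * y ^ 2 := by
  have hnorm : ‖Complex.I * (y : ℂ)‖ = |y| := by simp
  rcases le_total |y| 1 with h | h
  · have := Complex.norm_exp_sub_one_sub_id_le (x := Complex.I * y) (hnorm.trans_le h)
    rw [hnorm, sq_abs] at this
    linarith [sq_nonneg y]
  · have := Real.norm_exp_I_mul_ofReal_sub_one_le (x := y)
    calc ‖Complex.exp (Complex.I * y) - 1 - Complex.I * y‖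
        ≤ ‖Complex.exp (Complex.I * y) - 1‖ + ‖Complex.I * (y : ℂ)‖ := norm_sub_le _ _
      _ ≤ |y| + |y| := add_le_add this hnorm.le
      _ ≤ 2 * y ^ 2 := by rw [← sq_abs]; nlinarith

theorem lipschitzWith_phaseMap (hn : 1 ≤ n) (hε : 0 < ε) (t : ℝ) :
    LipschitzWith (1 + 4 * n * ‖t‖₊) (phaseMap n ε t) := by
  refine lipschitzWith_smul_self (fun z => (Complex.norm_exp_I_mul_ofReal _).le) fun z w h => ?_
  calc ‖w‖ * ‖Complex.exp (Complex.I * ((-t * regLog n ε (‖z‖ ^ 2) : ℝ) : ℂ)) -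
        Complex.exp (Complex.I * ((-t * regLog n ε (‖w‖ ^ 2) : ℝ) : ℂ))‖
      ≤ ‖w‖ * |-t * regLog n ε (‖z‖ ^ 2) - -t * regLog n ε (‖w‖ ^ 2)| := by
        gcongr; exact norm_exp_I_mul_sub_exp_I_mul_le _ _
    _ = |t| * (‖w‖ * |regLog n ε (‖w‖ ^ 2) - regLog n ε (‖z‖ ^ 2)|) := by
        rw [← mul_sub, abs_mul, abs_neg, abs_sub_comm]; ring
    _ ≤ |t| * (4 * n * (‖z‖ - ‖w‖)) :=
        mul_le_mul_of_nonneg_left (mul_abs_regLog_sub_le hn hε (norm_nonneg w) h) (abs_nonneg t)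
    _ ≤ |t| * (4 * n * ‖z - w‖) := by gcongr; exact norm_sub_norm_le z w
    _ = ↑(4 * n * ‖t‖₊) * ‖z - w‖ := by push_cast; rw [Real.norm_eq_abs]; ring

theorem norm_phaseMap_sub_add_le (hn : 1 ≤ n) (hε : 0 < ε) (hε1 : ε ≤ 1) (hB : 1 ≤ B) (t : ℝ)
    {z : ℂ} (hz : ‖z‖ ≤ B) :
    ‖phaseMap n ε t z - z + Complex.I * t * cutNonlin n ε B z‖ ≤
      2 * (t * nonlinLip n ε B) ^ 2 * ‖z‖ := by
  set g := regLog n ε (‖z‖ ^ 2) with hg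
  have hg_le : (-t * g) ^ 2 ≤ (t * nonlinLip n ε B) ^ 2 := by
    rw [mul_pow, mul_pow, neg_sq, ← sq_abs g]
    gcongr
    exact abs_regLog_sq_le_nonlinLip hn hε hε1 hB (norm_nonneg _) hz
  calc ‖phaseMap n ε t z - z + Complex.I * t * cutNonlin n ε B z‖
      = ‖(Complex.exp (Complex.I * (-t * g : ℝ)) - 1 - Complex.I * (-t * g : ℝ)) * z‖ := by
        rw [cutNonlin_of_norm_le hz, phaseMap, ← hg, smul_eq_mul]
        push_cast
        ring_nf
    _ ≤ 2 * (-t * g) ^ 2 * ‖z‖ := by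
        rw [norm_mul]; gcongr; exact norm_exp_I_mul_sub_one_sub_le _
    _ ≤ 2 * (t * nonlinLip n ε B) ^ 2 * ‖z‖ := by gcongr

end PointwiseNonlinearity

section PhaseFlow

theorem coeFn_phaseMul {μ : Measure ℝ} (θ : ℝ → ℝ) (hθ : AEStronglyMeasurable θ μ)
    (v : Lp ℂ 2 μ) :
    phaseMul θ hθ v =ᵐ[μ] fun x => Complex.exp (Complex.I * (θ x : ℂ)) * v x :=
  (memLp_phase_mul hθ v).coeFn_toLp

variable (S : Domain1D) {n : ℕ} {ε B : ℝ}

theorem coeFn_flowB (n : ℕ) (ε t : ℝ) (v : S.L2) :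
    flowB S n ε t v =ᵐ[S.vol] fun x => phaseMap n ε t (v x) :=
  coeFn_phaseMul _ _ v

theorem norm_flowB (n : ℕ) (ε t : ℝ) (v : S.L2) : ‖flowB S n ε t v‖ = ‖v‖ := by
  refine congrArg ENNReal.toReal (eLpNorm_congr_norm_ae ?_)
  filter_upwards [coeFn_flowB S n ε t v] with x hx
  rw [hx, phaseMap, norm_smul, Complex.norm_exp_I_mul_ofReal, one_mul]

theorem lipschitzWith_flowB (hn : 1 ≤ n) (hε : 0 < ε) (t : ℝ) :
    LipschitzWith (1 + 4 * n * ‖t‖₊) (flowB S n ε t) := by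
  have hL := lipschitzWith_phaseMap hn hε t
  have h0 : phaseMap n ε t 0 = 0 := smul_zero _
  have heq : flowB S n ε t = hL.compLp (p := 2) (μ := S.vol) h0 := funext fun v =>
    Lp.ext ((coeFn_flowB S n ε t v).trans (hL.coeFn_compLp h0 v).symm)
  rw [heq]
  exact hL.lipschitzWith_compLp h0

theorem norm_flowB_sub_add_le (hn : 1 ≤ n) (hε : 0 < ε) (hε1 : ε ≤ 1) (hB : 1 ≤ B) (t : ℝ)
    {v : S.L2} (hv : ∀ᵐ x ∂S.vol, ‖v x‖ ≤ B) :
    ‖flowB S n ε t v - v + (Complex.I * t) •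
        (lipschitzWith_cutNonlin hn hε hε1 hB).compLp (cutNonlin_zero n ε B) v‖ ≤
      2 * (t * nonlinLip n ε B) ^ 2 * ‖v‖ := by
  set F := (lipschitzWith_cutNonlin hn hε hε1 hB).compLp (cutNonlin_zero n ε B) v
  refine Lp.norm_le_mul_norm_of_ae_le_mul ?_
  filter_upwards [coeFn_flowB S n ε t v, Lp.coeFn_add (flowB S n ε t v - v) ((Complex.I * t) • F),
    Lp.coeFn_sub (flowB S n ε t v) v, Lp.coeFn_smul (Complex.I * t) F,
    (lipschitzWith_cutNonlin hn hε hε1 hB).coeFn_compLp (cutNonlin_zero n ε B) v, hv]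
    with x hflow hadd hsub hsmul hF hx
  rw [hadd, Pi.add_apply, hsub, Pi.sub_apply, hsmul, Pi.smul_apply, hF, hflow]
  exact norm_phaseMap_sub_add_le hn hε hε1 hB t hx

end PhaseFlow

section Primitives

theorem absolutelyContinuousOnInterval_of_dist_le {X Y : Type*} [PseudoMetricSpace X]
    [PseudoMetricSpace Y] {f : ℝ → X} {h : ℝ → Y} {a b K : ℝ}
    (hh : AbsolutelyContinuousOnInterval h a b)
    (hfh : ∀ x y, dist (f x) (f y) ≤ K * dist (h x) (h y)) :
    AbsolutelyContinuousOnInterval f a b := by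
  have hlim : Tendsto (fun E : ℕ × (ℕ → ℝ × ℝ) =>
      K * ∑ i ∈ Finset.range E.1, dist (h (E.2 i).1) (h (E.2 i).2))
      (AbsolutelyContinuousOnInterval.totalLengthFilter ⊓
        𝓟 (AbsolutelyContinuousOnInterval.disjWithin a b)) (𝓝 (K * 0)) := Tendsto.const_mul K hh
  rw [mul_zero] at hlim
  refine squeeze_zero (fun E => Finset.sum_nonneg fun _ _ => dist_nonneg) (fun E => ?_) hlim
  rw [Finset.mul_sum]
  exact Finset.sum_le_sum fun i _ => hfh _ _

/-- `V` is an absolutely continuous primitive of the locally integrable function `w`. -/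
structure IsPrimitive {E : Type*} [NormedAddCommGroup E] [NormedSpace ℝ E] (V w : ℝ → E) :
    Prop where
  locallyIntegrable : LocallyIntegrable w volume
  sub_eq : ∀ x y, V y - V x = ∫ t in x..y, w t

namespace IsPrimitive

variable {E : Type*} [NormedAddCommGroup E] [NormedSpace ℝ E] {V w : ℝ → E}

theorem intervalIntegrable (h : IsPrimitive V w) (a b : ℝ) : IntervalIntegrable w volume a b :=
  (h.locallyIntegrable.integrableOn_isCompact isCompact_uIcc).intervalIntegrable

theorem integral (hw : LocallyIntegrable w volume) (c : E) (x₀ : ℝ) :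
    IsPrimitive (fun x => c + ∫ t in x₀..x, w t) w := by
  refine ⟨hw, fun x y => ?_⟩
  rw [add_sub_add_left_eq_sub, intervalIntegral.integral_interval_sub_left]
  all_goals exact (hw.integrableOn_isCompact isCompact_uIcc).intervalIntegrable

theorem congr_ae {w' : ℝ → E} (h : IsPrimitive V w) (hw : w =ᵐ[volume] w') : IsPrimitive V w' where
  locallyIntegrable := h.locallyIntegrable.congr hw
  sub_eq x y := by
    rw [h.sub_eq]
    exact intervalIntegral.integral_congr_ae (hw.mono fun t ht _ => ht)

theorem eq_add (h : IsPrimitive V w) (x₀ : ℝ) : V = fun x => V x₀ + ∫ t in x₀..x, w t :=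
  funext fun x => by rw [← h.sub_eq, add_sub_cancel]

theorem dist_le (h : IsPrimitive V w) (a x y : ℝ) :
    dist (V x) (V y) ≤ dist (∫ t in a..x, ‖w t‖) (∫ t in a..y, ‖w t‖) := by
  rw [dist_comm, dist_eq_norm, h.sub_eq, dist_comm, Real.dist_eq,
    intervalIntegral.integral_interval_sub_left (h.intervalIntegrable _ _).norm
      (h.intervalIntegrable _ _).norm]
  exact intervalIntegral.norm_integral_le_abs_integral_norm

theorem absolutelyContinuousOnInterval (h : IsPrimitive V w) (a b : ℝ) :
    AbsolutelyContinuousOnInterval V a b :=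
  absolutelyContinuousOnInterval_of_dist_le (K := 1)
    ((h.intervalIntegrable a b).norm.absolutelyContinuousOnInterval_intervalIntegral left_mem_uIcc)
    fun x y => (h.dist_le a x y).trans_eq (one_mul _).symm

theorem continuous (h : IsPrimitive V w) : Continuous V := by
  rw [h.eq_add 0]
  exact continuous_const.add
    (intervalIntegral.continuous_primitive (fun a b => h.intervalIntegrable a b) 0)

theorem ae_hasDerivAt [CompleteSpace E] (h : IsPrimitive V w) : ∀ᵐ x, HasDerivAt V (w x) x := by
  filter_upwards [LocallyIntegrable.ae_hasDerivAt_integral h.locallyIntegrable] with x hx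
  rw [h.eq_add 0]
  exact (hx 0).const_add _

theorem of_absolutelyContinuous [CompleteSpace E] (hV : ∀ a b, AbsolutelyContinuousOnInterval V a b)
    (hw : LocallyIntegrable w volume) (hd : ∀ᵐ x, HasDerivAt V (w x) x) : IsPrimitive V w := by
  refine ⟨hw, fun a b => ?_⟩
  have hprim := integral hw 0 a
  have hdiff : AbsolutelyContinuousOnInterval (fun x => V x - (0 + ∫ t in a..x, w t)) a b :=
    (hV a b).sub (hprim.absolutelyContinuousOnInterval a b)
  obtain ⟨c, hc⟩ := hdiff.const_of_ae_hasDerivAt_zero (by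
    filter_upwards [hd, hprim.ae_hasDerivAt] with x hVx hpx _
    convert! hVx.sub hpx
    rw [sub_self])
  have ha : V a = c := by simpa using hc a left_mem_uIcc
  have hb : V b - ∫ t in a..b, w t = c := by simpa using hc b right_mem_uIcc
  rw [ha, ← hb, sub_sub_cancel]

theorem of_hasDerivAt [CompleteSpace E] (hd : ∀ x, HasDerivAt V (w x) x) (hw : Continuous w) :
    IsPrimitive V w :=
  ⟨hw.locallyIntegrable, fun _ _ => (intervalIntegral.integral_eq_sub_of_hasDerivAt
    (fun t _ => hd t) (hw.intervalIntegrable _ _)).symm⟩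

section Mul

variable {A : Type*} [NormedRing A] [NormMulClass A] [NormedAlgebra ℝ A] [CompleteSpace A]
  {V w V' w' : ℝ → A}

theorem mul (h : IsPrimitive V w) (h' : IsPrimitive V' w') :
    IsPrimitive (fun x => V x * V' x) (fun x => w x * V' x + V x * w' x) := by
  refine of_absolutelyContinuous (fun a b => ?_)
    ((h.locallyIntegrable.mul_continuous h'.continuous).add
      (h'.locallyIntegrable.continuous_mul h.continuous)) ?_
  · exact (h.absolutelyContinuousOnInterval a b).smul (h'.absolutelyContinuousOnInterval a b)
  · filter_upwards [h.ae_hasDerivAt, h'.ae_hasDerivAt] with x hx hx'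
    exact hx.mul hx'

end Mul

section Lipschitz

variable {G : Type*} [NormedAddCommGroup G] {F : E → G} {K : ℝ≥0}

theorem absolutelyContinuousOnInterval_comp (h : IsPrimitive V w) (hF : LipschitzWith K F)
    (a b : ℝ) : AbsolutelyContinuousOnInterval (F ∘ V) a b :=
  absolutelyContinuousOnInterval_of_dist_le (h.absolutelyContinuousOnInterval a b)
    fun _ _ => hF.dist_le_mul _ _

variable [NormedSpace ℝ G]

theorem norm_deriv_comp_le {L : E} {V : ℝ → E} {x : ℝ} (hV : HasDerivAt V L x)
    (hF : LipschitzWith K F) : ‖deriv (F ∘ V) x‖ ≤ K * ‖L‖ := by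
  by_cases hd : DifferentiableAt ℝ (F ∘ V) x
  · refine le_of_tendsto_of_tendsto' (hasDerivAt_iff_tendsto_slope.1 hd.hasDerivAt).norm
      ((hasDerivAt_iff_tendsto_slope.1 hV).norm.const_mul (K : ℝ)) fun y => ?_
    rw [slope_def_module, slope_def_module, norm_smul, norm_smul, mul_left_comm]
    gcongr
    exact hF.norm_sub_le (V y) (V x)
  · rw [deriv_zero_of_not_differentiableAt hd, norm_zero]
    positivity

theorem ae_differentiableAt_comp [FiniteDimensional ℝ G] (h : IsPrimitive V w)
    (hF : LipschitzWith K F) : ∀ᵐ x, DifferentiableAt ℝ (F ∘ V) x := by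
  have hae : ∀ᵐ x, ∀ N : ℕ, x ∈ uIcc (-(N : ℝ)) N → DifferentiableAt ℝ (F ∘ V) x :=
    ae_all_iff.2 fun N => (h.absolutelyContinuousOnInterval_comp hF _ _).boundedVariationOn
      |>.ae_differentiableAt_of_mem_uIcc
  filter_upwards [hae] with x hx
  obtain ⟨N, hN⟩ := exists_nat_ge |x|
  exact hx N (by rw [uIcc_of_le (by linarith [abs_nonneg x])]; exact abs_le.1 hN)

theorem comp_lipschitz [FiniteDimensional ℝ G] [CompleteSpace E] (h : IsPrimitive V w)
    (hF : LipschitzWith K F) :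
    IsPrimitive (F ∘ V) (deriv (F ∘ V)) ∧ ∀ᵐ x, ‖deriv (F ∘ V) x‖ ≤ K * ‖w x‖ := by
  have : CompleteSpace G := FiniteDimensional.complete ℝ G
  have hle : ∀ᵐ x, ‖deriv (F ∘ V) x‖ ≤ K * ‖w x‖ :=
    h.ae_hasDerivAt.mono fun x hx => norm_deriv_comp_le hx hF
  refine ⟨of_absolutelyContinuous (h.absolutelyContinuousOnInterval_comp hF) ?_
    ((h.ae_differentiableAt_comp hF).mono fun x hx => hx.hasDerivAt), hle⟩
  refine LocallyIntegrable.mono (h.locallyIntegrable.smul (K : ℝ))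
    (stronglyMeasurable_deriv _).aestronglyMeasurable ?_
  filter_upwards [hle] with x hx
  simpa [norm_smul] using hx

end Lipschitz

theorem norm_le_add_setIntegral (h : IsPrimitive V w) {c d x y : ℝ} (hx : x ∈ Icc c d)
    (hy : y ∈ Icc c d) : ‖V x‖ ≤ ‖V y‖ + ∫ t in Ioc c d, ‖w t‖ := by
  have hcd : c ≤ d := hx.1.trans hx.2
  have hw : IntegrableOn w (Ioc c d) :=
    (intervalIntegrable_iff_integrableOn_Ioc_of_le hcd).1 (h.intervalIntegrable c d)
  have hsub : uIoc y x ⊆ Ioc c d := fun t ht => by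
    rcases mem_uIoc.1 ht with ht | ht
    exacts [⟨hy.1.trans_lt ht.1, ht.2.trans hx.2⟩, ⟨hx.1.trans_lt ht.1, ht.2.trans hy.2⟩]
  calc ‖V x‖ ≤ ‖V y‖ + ‖V x - V y‖ := norm_le_norm_add_norm_sub' _ _
    _ ≤ ‖V y‖ + ∫ t in uIoc y x, ‖w t‖ := by
        rw [h.sub_eq]; gcongr; exact intervalIntegral.norm_integral_le_integral_norm_uIoc
    _ ≤ ‖V y‖ + ∫ t in Ioc c d, ‖w t‖ := by
        grw [setIntegral_mono_set hw.norm (ae_of_all _ fun t => norm_nonneg _) hsub.eventuallyLE]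

theorem mul_norm_le (h : IsPrimitive V w) {c d x : ℝ} (hx : x ∈ Icc c d) :
    (d - c) * ‖V x‖ ≤ (∫ t in Ioc c d, ‖V t‖) + (d - c) * ∫ t in Ioc c d, ‖w t‖ := by
  have hcd : c ≤ d := hx.1.trans hx.2
  have hconst : ∀ r : ℝ, IntegrableOn (fun _ => r) (Ioc c d) := fun r =>
    integrableOn_const (by simp)
  have hV : IntegrableOn (fun t => ‖V t‖) (Ioc c d) :=
    (intervalIntegrable_iff_integrableOn_Ioc_of_le hcd).1 (h.continuous.norm.intervalIntegrable _ _)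
  have hmono : ∫ _t in Ioc c d, ‖V x‖ ≤ ∫ t in Ioc c d, (‖V t‖ + ∫ s in Ioc c d, ‖w s‖) :=
    setIntegral_mono_on (hconst _) (hV.add (hconst _)) measurableSet_Ioc fun t ht =>
      h.norm_le_add_setIntegral hx (Ioc_subset_Icc_self ht)
  rw [integral_add hV (hconst _)] at hmono
  simpa [hcd] using hmono

end IsPrimitive

end Primitives

section SobolevSpaces

theorem setIntegral_norm_le_sqrt_mul_norm {α E : Type*} [MeasurableSpace α] {μ : Measure α}
    [NormedAddCommGroup E] (v : Lp E 2 μ) {s : Set α} (hs : μ s ≠ ⊤) :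
    ∫ x in s, ‖v x‖ ∂μ ≤ √(μ.real s) * ‖v‖ := by
  have hv := (Lp.aestronglyMeasurable v).mono_measure (Measure.restrict_le_self (s := s))
  have hholder : eLpNorm v 1 (μ.restrict s) ≤ eLpNorm v 2 μ * μ s ^ (1 / 2 : ℝ) := by
    refine (eLpNorm_le_eLpNorm_mul_rpow_measure_univ one_le_two hv).trans ?_
    rw [Measure.restrict_apply_univ]
    norm_num
    gcongr
    exact Measure.restrict_le_self
  rw [integral_norm_eq_lintegral_enorm hv, ← eLpNorm_one_eq_lintegral_enorm, Lp.norm_def,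
    Real.sqrt_eq_rpow, measureReal_def, ENNReal.toReal_rpow, mul_comm, ← ENNReal.toReal_mul]
  exact ENNReal.toReal_mono (ENNReal.mul_ne_top (Lp.eLpNorm_ne_top v) (by finiteness)) hholder

theorem L2_inner_eq_integral {α : Type*} [MeasurableSpace α] {μ : Measure α} (v w : Lp ℂ 2 μ) :
    inner ℂ v w = ∫ x, conj (v x) * w x ∂μ := by
  simp only [L2.inner_def, RCLike.inner_apply, mul_comm]

namespace Domain1D

/-- The open set underlying `S`. -/
def dom : Domain1D → Set ℝ
  | .line => univ
  | .dirichlet a b _ => Ioo a b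
  | .periodic a b _ => Ioo a b

theorem vol_eq (S : Domain1D) : S.vol = volume.restrict S.dom := by
  cases S <;> simp [vol, dom]

theorem measurableSet_dom (S : Domain1D) : MeasurableSet S.dom := by
  cases S <;> simp [dom]

theorem ae_vol_iff (S : Domain1D) {p : ℝ → Prop} :
    (∀ᵐ x ∂S.vol, p x) ↔ ∀ᵐ x, x ∈ S.dom → p x := by
  rw [S.vol_eq, ae_restrict_iff' S.measurableSet_dom]

theorem indicator_ae_eq {S : Domain1D} (w : S.L2) : S.dom.indicator w =ᵐ[S.vol] w :=
  S.ae_vol_iff.2 (ae_of_all _ fun _ hx => indicator_of_mem hx _)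

/-- The boundary condition of `S`, for continuous functions on the closure of the domain. -/
def BdryCond (S : Domain1D) (V : ℝ → ℂ) : Prop :=
  match S with
  | .line => True
  | .dirichlet a b _ => V a = 0 ∧ V b = 0
  | .periodic a b _ => V a = V b

theorem BdryCond.comp {S : Domain1D} {V : ℝ → ℂ} (h : S.BdryCond V) {F : ℂ → ℂ} (hF : F 0 = 0) :
    S.BdryCond (F ∘ V) := by
  cases S with
  | line => trivial
  | dirichlet a b hab => exact ⟨(congrArg F h.1).trans hF, (congrArg F h.2).trans hF⟩
  | periodic a b hab => exact congrArg F h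

/-- `v` has an absolutely continuous representative that satisfies the boundary condition of `S`
and has derivative `w` on the domain.  Since the representative is a function on the line, it is
continued by constants outside the domain. -/
def HasACRep (S : Domain1D) (v w : S.L2) : Prop :=
  ∃ V : ℝ → ℂ, IsPrimitive V (S.dom.indicator w) ∧ v =ᵐ[S.vol] V ∧ S.BdryCond V

theorem HasACRep.comp_lipschitz {S : Domain1D} {v w : S.L2} (h : S.HasACRep v w)
    {F : ℂ → ℂ} {K : ℝ≥0} (hF : LipschitzWith K F) (hF0 : F 0 = 0) :
    ∃ g : S.L2, S.HasACRep (hF.compLp hF0 v) g ∧ ‖g‖ ≤ K * ‖w‖ := by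
  obtain ⟨V, hV, hvV, hbdry⟩ := h
  obtain ⟨hFV, hbound⟩ := hV.comp_lipschitz hF
  have hle : ∀ᵐ x ∂S.vol, ‖deriv (F ∘ V) x‖ ≤ K * ‖w x‖ := by
    rw [S.ae_vol_iff]
    filter_upwards [hbound] with x hx hxS
    rwa [indicator_of_mem hxS] at hx
  have hmem : MemLp (deriv (F ∘ V)) 2 S.vol :=
    (Lp.memLp w).of_le_mul (measurable_deriv _).aestronglyMeasurable hle
  have hind : deriv (F ∘ V) =ᵐ[volume] S.dom.indicator (hmem.toLp _) := by
    filter_upwards [S.ae_vol_iff.1 hmem.coeFn_toLp, hbound] with x hx hx'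
    by_cases hxS : x ∈ S.dom
    · rw [indicator_of_mem hxS, hx hxS]
    · rw [indicator_of_notMem hxS] at hx' ⊢
      simpa using hx'
  refine ⟨hmem.toLp _, ⟨F ∘ V, hFV.congr_ae hind, ?_, hbdry.comp hF0⟩, ?_⟩
  · exact (hF.coeFn_compLp hF0 v).trans (hvV.fun_comp F)
  · refine Lp.norm_le_mul_norm_of_ae_le_mul ?_
    filter_upwards [hmem.coeFn_toLp, hle] with x hx hx'
    rwa [hx]

theorem exists_Icc_mem_Ioo_subset_dom (S : Domain1D) :
    ∃ l : ℝ, 0 < l ∧ ∀ x ∈ S.dom, ∃ c, x ∈ Icc c (c + l) ∧ Ioo c (c + l) ⊆ S.dom := by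
  cases S with
  | line => exact ⟨1, one_pos, fun x _ => ⟨x, by simp, subset_univ _⟩⟩
  | dirichlet a b hab | periodic a b hab =>
    refine ⟨b - a, sub_pos.2 hab, fun x hx => ⟨a, ?_⟩⟩
    rw [add_sub_cancel]
    exact ⟨Ioo_subset_Icc_self hx, subset_rfl⟩

theorem setIntegral_norm_le {S : Domain1D} (v : S.L2) {c d : ℝ} (hcd : c ≤ d)
    (hS : Ioo c d ⊆ S.dom) {V : ℝ → ℂ} (hV : v =ᵐ[S.vol] V) :
    ∫ t in Ioc c d, ‖V t‖ ≤ √(d - c) * ‖v‖ := by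
  have hvol : S.vol.restrict (Ioo c d) = volume.restrict (Ioo c d) := by
    rw [S.vol_eq, Measure.restrict_restrict measurableSet_Ioo, inter_eq_left.2 hS]
  have hreal : S.vol.real (Ioo c d) = d - c := by
    rw [← measureReal_restrict_apply_univ, hvol, measureReal_restrict_apply_univ,
      Real.volume_real_Ioo_of_le hcd]
  calc ∫ t in Ioc c d, ‖V t‖ = ∫ t in Ioo c d, ‖v t‖ ∂S.vol := by
        rw [integral_Ioc_eq_integral_Ioo, ← hvol]
        exact integral_congr_ae (ae_restrict_of_ae (hV.mono fun t ht => by simp only [ht]))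
    _ ≤ √(S.vol.real (Ioo c d)) * ‖v‖ := setIntegral_norm_le_sqrt_mul_norm v (by
        rw [← Measure.restrict_apply_univ, hvol, Measure.restrict_apply_univ]; simp)
    _ = √(d - c) * ‖v‖ := by rw [hreal]

theorem exists_forall_ae_norm_le (S : Domain1D) : ∃ C : ℝ, ∀ v w : S.L2,
    S.HasACRep v w → ∀ᵐ x ∂S.vol, ‖v x‖ ≤ C * (‖v‖ + ‖w‖) := by
  obtain ⟨l, hl, hcover⟩ := S.exists_Icc_mem_Ioo_subset_dom
  refine ⟨√l / l + √l, fun v w ⟨V, hV, hvV, _⟩ => ?_⟩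
  have hdom : ∀ᵐ x ∂S.vol, x ∈ S.dom := S.ae_vol_iff.2 (ae_of_all _ fun _ hx => hx)
  filter_upwards [hdom, hvV] with x hx hxV
  obtain ⟨c, hxc, hsub⟩ := hcover x hx
  have hc : c ≤ c + l := by linarith
  have hmean := hV.mul_norm_le hxc
  have hv := setIntegral_norm_le v hc hsub hvV
  have hw := setIntegral_norm_le w hc hsub (indicator_ae_eq w).symm
  rw [add_sub_cancel_left] at hmean hv hw
  have hsup : ‖V x‖ ≤ √l / l * ‖v‖ + √l * ‖w‖ := by
    refine le_of_mul_le_mul_left ?_ hl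
    calc l * ‖V x‖ ≤ √l * ‖v‖ + l * (√l * ‖w‖) := hmean.trans (by gcongr)
      _ = l * (√l / l * ‖v‖ + √l * ‖w‖) := by field_simp
  rw [hxV]
  have hcross : 0 ≤ √l / l * ‖w‖ + √l * ‖v‖ := by positivity
  linarith

end Domain1D

end SobolevSpaces

theorem IsPrimitive.integral_eq_zero {F f : ℝ → ℂ} (h : IsPrimitive F f) (hF : Integrable F)
    (hf : Integrable f) : ∫ x, f x = 0 := by
  have hlim : Tendsto (fun R : ℝ => F R - F (-R)) atTop (𝓝 (∫ x, f x)) := by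
    simp only [h.sub_eq]
    exact intervalIntegral_tendsto_integral hf tendsto_neg_atTop_atBot tendsto_id
  refine IntegrableAtFilter.eq_zero_of_tendsto (μ := volume)
    ((hF.sub hF.comp_neg).integrableAtFilter _) (fun s hs => ?_) hlim
  obtain ⟨c, hc⟩ := mem_atTop_sets.1 hs
  exact top_le_iff.1 (Real.volume_Ici (a := c) ▸ measure_mono hc)

theorem IsPrimitive.clm_comp {E G : Type*} [NormedAddCommGroup E] [NormedSpace ℝ E]
    [CompleteSpace E] [NormedAddCommGroup G] [NormedSpace ℝ G] [CompleteSpace G] {V w : ℝ → E}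
    (h : IsPrimitive V w) (A : E →L[ℝ] G) :
    IsPrimitive (fun x => A (V x)) (fun x => A (w x)) where
  locallyIntegrable := fun x => by
    obtain ⟨s, hs, hint⟩ := h.locallyIntegrable x
    exact ⟨s, hs, A.integrable_comp hint⟩
  sub_eq x y := by
    rw [← map_sub, h.sub_eq, A.intervalIntegral_comp_comm (h.intervalIntegrable x y)]

namespace Domain1D

variable {S : Domain1D} {v w p q : S.L2} {V P ψ ψ' : ℝ → ℂ}

theorem isOpen_dom (S : Domain1D) : IsOpen S.dom := by
  cases S <;> simp [dom, isOpen_Ioo]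

theorem BdryCond.congr (h : S.BdryCond P) (hVP : EqOn V P (closure S.dom)) : S.BdryCond V := by
  cases S with
  | line => trivial
  | dirichlet a b hab | periodic a b hab =>
    have heq : EqOn V P (Icc a b) := by simpa only [dom, closure_Ioo hab.ne] using hVP
    simpa only [BdryCond, heq (left_mem_Icc.2 hab.le), heq (right_mem_Icc.2 hab.le)] using h

/-- The boundary condition dual to `S.BdryCond`: the boundary terms of an integration by parts
vanish when one factor satisfies either condition and the other its dual. -/
def DualBdryCond (S : Domain1D) (P : ℝ → ℂ) : Prop :=
  match S with
  | .line | .dirichlet _ _ _ => True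
  | .periodic a b _ => P a = P b

theorem BdryCond.dual (h : S.BdryCond V) : S.DualBdryCond V := by
  cases S with
  | line | dirichlet => trivial
  | periodic a b hab => exact h

theorem locallyIntegrable_indicator (w : S.L2) : LocallyIntegrable (S.dom.indicator w) := by
  refine MemLp.locallyIntegrable ?_ (one_le_two : (1 : ℝ≥0∞) ≤ 2)
  rw [memLp_indicator_iff_restrict S.measurableSet_dom, ← S.vol_eq]
  exact Lp.memLp w

theorem HasACRep.unique {w' : S.L2} (h : S.HasACRep v w) (h' : S.HasACRep v w') : w = w' := by
  obtain ⟨V, hV, hvV, -⟩ := h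
  obtain ⟨V', hV', hvV', -⟩ := h'
  have heq : EqOn V V' S.dom := by
    have hae := hvV.symm.trans hvV'
    rw [S.vol_eq] at hae
    exact Measure.eqOn_open_of_ae_eq hae S.isOpen_dom hV.continuous.continuousOn
      hV'.continuous.continuousOn
  refine Lp.ext (S.ae_vol_iff.2 ?_)
  filter_upwards [hV.ae_hasDerivAt, hV'.ae_hasDerivAt] with x hx hx' hxS
  rw [indicator_of_mem hxS] at hx hx'
  exact hx.unique (hx'.congr_of_eventuallyEq (heq.eventuallyEq_of_mem (S.isOpen_dom.mem_nhds hxS)))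

theorem integral_mul_add_integral_mul_eq_zero (hV : IsPrimitive V (S.dom.indicator w))
    (hvV : v =ᵐ[S.vol] V) (hVb : S.BdryCond V) (hP : IsPrimitive P (S.dom.indicator q))
    (hpP : p =ᵐ[S.vol] P) (hPb : S.DualBdryCond P) :
    (∫ x, w x * p x ∂S.vol) + ∫ x, v x * q x ∂S.vol = 0 := by
  have hwp : Integrable (fun x => w x * p x) S.vol := (Lp.memLp w).integrable_mul (Lp.memLp p)
  have hvq : Integrable (fun x => v x * q x) S.vol := (Lp.memLp v).integrable_mul (Lp.memLp q)
  have hvp : Integrable (fun x => v x * p x) S.vol := (Lp.memLp v).integrable_mul (Lp.memLp p)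
  have hderiv : (fun x => w x * p x + v x * q x) =ᵐ[S.vol]
      fun x => S.dom.indicator w x * P x + V x * S.dom.indicator q x := by
    filter_upwards [hvV, hpP, indicator_ae_eq w, indicator_ae_eq q] with x h₁ h₂ h₃ h₄
    rw [h₁, h₂, h₃, h₄]
  have hint := (hwp.add hvq).congr hderiv
  rw [← integral_add hwp hvq, integral_congr_ae hderiv]
  cases S with
  | line => exact (hV.mul hP).integral_eq_zero (hvp.congr (hvV.mul hpP)) hint
  | dirichlet a b hab =>
    change ∫ x in Ioo a b, _ = 0
    rw [← integral_Ioc_eq_integral_Ioo, ← intervalIntegral.integral_of_le hab.le,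
      ← (hV.mul hP).sub_eq, hVb.1, hVb.2, zero_mul, zero_mul, sub_zero]
  | periodic a b hab =>
    change ∫ x in Ioo a b, _ = 0
    rw [← integral_Ioc_eq_integral_Ioo, ← intervalIntegral.integral_of_le hab.le,
      ← (hV.mul hP).sub_eq, show V a = V b from hVb, show P a = P b from hPb, sub_self]

theorem DualBdryCond.congr (h : S.DualBdryCond P) (hVP : EqOn V P (closure S.dom)) :
    S.DualBdryCond V := by
  cases S with
  | line | dirichlet => trivial
  | periodic a b hab => exact BdryCond.congr (S := .periodic a b hab) h hVP

/-- `p` has an absolutely continuous representative with derivative `q` that satisfies the dual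
boundary condition: minus the adjoint of `HasACRep`. -/
def HasDualACRep (S : Domain1D) (p q : S.L2) : Prop :=
  ∃ P : ℝ → ℂ, IsPrimitive P (S.dom.indicator q) ∧ p =ᵐ[S.vol] P ∧ S.DualBdryCond P

theorem HasACRep.dual (h : S.HasACRep v w) : S.HasDualACRep v w :=
  let ⟨V, hV, hvV, hb⟩ := h
  ⟨V, hV, hvV, hb.dual⟩

theorem DualBdryCond.comp (h : S.DualBdryCond P) (F : ℂ → ℂ) : S.DualBdryCond (F ∘ P) := by
  cases S with
  | line | dirichlet => trivial
  | periodic a b hab => exact congrArg F h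

theorem HasDualACRep.star (h : S.HasDualACRep p q) : S.HasDualACRep (star p) (star q) := by
  obtain ⟨P, hP, hpP, hb⟩ := h
  refine ⟨fun x => conj (P x), ?_, ?_, hb.comp conj⟩
  · refine (hP.clm_comp (Complex.conjCLE : ℂ →L[ℝ] ℂ)).congr_ae ?_
    filter_upwards [S.ae_vol_iff.1 (Lp.coeFn_star q)] with x hx
    by_cases hxS : x ∈ S.dom
    · simpa [hxS] using (hx hxS).symm
    · simp [hxS]
  · filter_upwards [Lp.coeFn_star p, hpP] with x hx hx'
    rw [hx, Pi.star_apply, hx', RCLike.star_def]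

theorem HasACRep.inner_eq_neg_inner (h : S.HasACRep v w) (h' : S.HasDualACRep p q) :
    inner ℂ p w = -inner ℂ q v := by
  obtain ⟨V, hV, hvV, hVb⟩ := h
  obtain ⟨P, hP, hpP, hPb⟩ := h'.star
  have hinner (f g : S.L2) : inner ℂ f g = ∫ x, g x * (Star.star f : S.L2) x ∂S.vol := by
    rw [L2_inner_eq_integral]
    refine integral_congr_ae ?_
    filter_upwards [Lp.coeFn_star f] with x hx
    rw [hx, Pi.star_apply, RCLike.star_def, mul_comm]
  rw [hinner, hinner, eq_neg_iff_add_eq_zero]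
  exact integral_mul_add_integral_mul_eq_zero hV hvV hVb hP hpP hPb

theorem exists_isPrimitive_of_hasDerivAt (hd : ∀ x, HasDerivAt ψ (ψ' x) x) (hc : Continuous ψ')
    (hw : w =ᵐ[S.vol] ψ') :
    ∃ V, IsPrimitive V (S.dom.indicator w) ∧ EqOn V ψ (closure S.dom) := by
  have hψ := IsPrimitive.of_hasDerivAt hd hc
  rw [Filter.EventuallyEq, S.ae_vol_iff] at hw
  cases S with
  | line =>
    exact ⟨ψ, hψ.congr_ae (hw.mono fun x hx => by simp [dom, hx (mem_univ x)]), fun _ _ => rfl⟩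
  | dirichlet a b hab | periodic a b hab =>
    refine ⟨_, .integral (locallyIntegrable_indicator w) (ψ a) a, fun x hx => ?_⟩
    rw [dom, closure_Ioo hab.ne] at hx
    rw [congrFun (hψ.eq_add a) x, add_right_inj]
    refine intervalIntegral.integral_congr_ae ?_
    filter_upwards [hw, Measure.ae_ne volume b] with t ht htb htx
    rw [uIoc_of_le hx.1] at htx
    have htS : t ∈ Ioo a b := ⟨htx.1, (htx.2.trans hx.2).lt_of_ne htb⟩
    exact (indicator_of_mem (s := Ioo a b) htS _).trans (ht htS)

theorem ae_eq_of_eqOn (hVψ : EqOn V ψ (closure S.dom)) : V =ᵐ[S.vol] ψ :=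
  S.ae_vol_iff.2 (ae_of_all _ fun _ hx => hVψ (subset_closure hx))

theorem HasACRep.of_hasDerivAt (hd : ∀ x, HasDerivAt ψ (ψ' x) x) (hc : Continuous ψ')
    (hv : v =ᵐ[S.vol] ψ) (hw : w =ᵐ[S.vol] ψ') (hb : S.BdryCond ψ) : S.HasACRep v w :=
  let ⟨V, hV, hVψ⟩ := exists_isPrimitive_of_hasDerivAt hd hc hw
  ⟨V, hV, hv.trans (ae_eq_of_eqOn hVψ).symm, hb.congr hVψ⟩

theorem HasDualACRep.of_hasDerivAt (hd : ∀ x, HasDerivAt ψ (ψ' x) x) (hc : Continuous ψ')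
    (hp : p =ᵐ[S.vol] ψ) (hq : q =ᵐ[S.vol] ψ') (hb : S.DualBdryCond ψ) : S.HasDualACRep p q :=
  let ⟨P, hP, hPψ⟩ := exists_isPrimitive_of_hasDerivAt hd hc hq
  ⟨P, hP, hp.trans (ae_eq_of_eqOn hPψ).symm, hb.congr hPψ⟩

end Domain1D

theorem exists_contDiff_deriv_eq_of_integral_eq_zero {U : Set ℝ} (hU : U.OrdConnected) {g : ℝ → ℝ}
    (hg : ContDiff ℝ ∞ g) (hgc : HasCompactSupport g) (hgU : tsupport g ⊆ U)
    (hg0 : ∫ x, g x = 0) :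
    ∃ φ : ℝ → ℝ, ContDiff ℝ ∞ φ ∧ HasCompactSupport φ ∧ tsupport φ ⊆ U ∧ deriv φ = g := by
  rcases (tsupport g).eq_empty_or_nonempty with hempty | hne
  · rw [tsupport_eq_empty_iff] at hempty
    exact ⟨0, contDiff_const, .zero, by simp, by simp [hempty]⟩
  obtain ⟨c, hc⟩ := hgc.isCompact.exists_isLeast hne
  obtain ⟨d, hd⟩ := hgc.isCompact.exists_isGreatest hne
  have hzero : ∀ x ∉ Icc c d, g x = 0 := fun x hx =>
    image_eq_zero_of_notMem_tsupport fun hxg => hx ⟨hc.2 hxg, hd.2 hxg⟩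
  have hderiv : ∀ x, HasDerivAt (fun x => ∫ t in c..x, g t) (g x) x := fun x =>
    hg.continuous.integral_hasStrictDerivAt c x |>.hasDerivAt
  have hφ : ∀ x ∉ Icc c d, ∫ t in c..x, g t = 0 := fun x hx => by
    rcases lt_or_ge x c with hxc | hcx
    · rw [intervalIntegral.integral_symm, neg_eq_zero, intervalIntegral.integral_of_le hxc.le,
        integral_Ioc_eq_integral_Ioo]
      exact setIntegral_eq_zero_of_forall_eq_zero fun t ht => hzero t fun h => ht.2.not_ge h.1
    · have hdx : d < x := not_le.1 fun h => hx ⟨hcx, h⟩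
      have hcompl : ∀ t ∉ Icc c x, g t = 0 := fun t ht =>
        hzero t fun h => ht ⟨h.1, h.2.trans hdx.le⟩
      rw [intervalIntegral.integral_of_le hcx, ← integral_Icc_eq_integral_Ioc,
        setIntegral_eq_integral_of_forall_compl_eq_zero hcompl, hg0]
  have hsupp : tsupport (fun x => ∫ t in c..x, g t) ⊆ Icc c d :=
    closure_minimal (Function.support_subset_iff'.2 hφ) isClosed_Icc
  have hdiff : deriv (fun x => ∫ t in c..x, g t) = g := funext fun x => (hderiv x).deriv
  refine ⟨fun x => ∫ t in c..x, g t,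
    contDiff_infty_iff_deriv.2 ⟨fun x => (hderiv x).differentiableAt, by rwa [hdiff]⟩,
    isCompact_Icc.of_isClosed_subset (isClosed_tsupport _) hsupp,
    hsupp.trans (hU.out (hgU hc.1) (hgU hd.1)), hdiff⟩

-- The du Bois-Reymond lemma.
theorem exists_ae_eq_const_of_integral_deriv_smul_eq_zero {E : Type*} [NormedAddCommGroup E]
    [NormedSpace ℝ E] [CompleteSpace E] {U : Set ℝ} (hUo : IsOpen U) (hU : U.OrdConnected)
    {f : ℝ → E} (hf : LocallyIntegrable f)
    (h : ∀ φ : ℝ → ℝ, ContDiff ℝ ∞ φ → HasCompactSupport φ → tsupport φ ⊆ U →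
      ∫ x, deriv φ x • f x = 0) :
    ∃ c : E, ∀ᵐ x, x ∈ U → f x = c := by
  rcases U.eq_empty_or_nonempty with rfl | ⟨x₀, hx₀⟩
  · exact ⟨0, by simp⟩
  obtain ⟨r, hr, hrU⟩ := Metric.nhds_basis_closedBall.mem_iff.1 (hUo.mem_nhds hx₀)
  let η : ContDiffBump x₀ := ⟨r / 2, r, half_pos hr, half_lt_self hr⟩
  have hη : ContDiff ℝ ∞ (η.normed volume) := η.contDiff_normed
  have hηc : HasCompactSupport (η.normed volume) := η.hasCompactSupport_normed
  have hηU : tsupport (η.normed volume) ⊆ U := by rwa [η.tsupport_normed_eq]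
  have hint : ∀ g : ℝ → ℝ, ContDiff ℝ ∞ g → HasCompactSupport g →
      Integrable fun x => g x • f x := fun g hg hgc =>
    hf.integrable_smul_left_of_hasCompactSupport hg.continuous hgc
  refine ⟨∫ x, η.normed volume x • f x, ?_⟩
  have hzero := hUo.ae_eq_zero_of_integral_contDiff_smul_eq_zero
    (f := fun x => f x - ∫ x, η.normed volume x • f x)
    ((hf.sub (locallyIntegrable_const _)).locallyIntegrableOn U) fun g hg hgc hgU => ?_
  · exact hzero.mono fun x hx hxU => sub_eq_zero.1 (hx hxU)
  have hgi : Integrable g := hg.continuous.integrable_of_hasCompactSupport hgc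
  obtain ⟨φ, hφ, hφc, hφU, hφg⟩ := exists_contDiff_deriv_eq_of_integral_eq_zero hU
    (g := fun x => g x - (∫ x, g x) * η.normed volume x) (hg.sub (contDiff_const.mul hη))
    (hgc.sub hηc.mul_left) ((tsupport_sub _ _).trans (union_subset hgU
      ((tsupport_mul_subset_right ..).trans hηU))) (by
      rw [integral_sub hgi (η.integrable_normed.const_mul _), integral_const_mul,
        η.integral_normed, mul_one, sub_self])
  have hφ0 := h φ hφ hφc hφU
  simp only [hφg, sub_smul, mul_smul] at hφ0
  have hηi : Integrable fun x => (∫ x, g x) • η.normed volume x • f x := (hint _ hη hηc).smul _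
  rw [integral_sub (hint g hg hgc) hηi, integral_smul] at hφ0
  simp only [smul_sub]
  rw [integral_sub (hint g hg hgc) (hgi.smul_const _), integral_smul_const, hφ0]

namespace Domain1D

variable {S : Domain1D} {v w p q : S.L2} {φ : ℝ → ℂ}

theorem memLp_Ioo_of_continuous {E : Type*} [NormedAddCommGroup E] {a b : ℝ} {r : ℝ≥0∞}
    {f : ℝ → E} (hf : Continuous f) : MemLp f r (volume.restrict (Ioo a b)) := by
  obtain ⟨C, hC⟩ := isCompact_Icc.exists_bound_of_continuousOn (hf.continuousOn (s := Icc a b))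
  refine .of_bound hf.aestronglyMeasurable C ?_
  filter_upwards [ae_restrict_mem measurableSet_Ioo] with x hx
  exact hC x (Ioo_subset_Icc_self hx)

theorem isTest_ofReal_comp (hS : ∀ a b hab, S ≠ periodic a b hab) {φ : ℝ → ℝ}
    (hφ : ContDiff ℝ ∞ φ) (hφc : HasCompactSupport φ) (hφS : tsupport φ ⊆ S.dom) :
    S.IsTest fun x => (φ x : ℂ) := by
  refine ⟨Complex.ofRealCLM.contDiff.comp hφ, ?_⟩
  have hc : HasCompactSupport fun x => (φ x : ℂ) := hφc.comp_left Complex.ofReal_zero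
  cases S with
  | line => exact hc
  | dirichlet a b hab => exact ⟨hc, (tsupport_comp_subset Complex.ofReal_zero φ).trans hφS⟩
  | periodic a b hab => exact absurd rfl (hS a b hab)

theorem deriv_ofReal_comp {φ : ℝ → ℝ} (hφ : Differentiable ℝ φ) :
    deriv (fun x => (φ x : ℂ)) = fun x => ((deriv φ x : ℝ) : ℂ) :=
  funext fun x => (hφ x).hasDerivAt.ofReal_comp.deriv

namespace IsTest

theorem deriv (h : S.IsTest φ) : S.IsTest (deriv φ) := by
  refine ⟨(contDiff_infty_iff_deriv.1 h.1).2, ?_⟩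
  cases S with
  | line => exact HasCompactSupport.deriv (show HasCompactSupport φ from h.2)
  | dirichlet a b hab => exact ⟨h.2.1.deriv, (tsupport_deriv_subset ..).trans h.2.2⟩
  | periodic a b hab =>
    intro x
    rw [← deriv_comp_add_const]
    exact congrArg (_root_.deriv · x) (funext h.2)

theorem memLp (h : S.IsTest φ) : MemLp φ 2 S.vol := by
  cases S with
  | line => exact h.1.continuous.memLp_of_hasCompactSupport (μ := volume) h.2
  | dirichlet a b hab | periodic a b hab => exact memLp_Ioo_of_continuous h.1.continuous

theorem hasDerivAt (h : S.IsTest φ) (x : ℝ) : HasDerivAt φ (_root_.deriv φ x) x :=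
  ((contDiff_infty_iff_deriv.1 h.1).1 x).hasDerivAt

theorem bdryCond (h : S.IsTest φ) : S.BdryCond φ := by
  cases S with
  | line => trivial
  | dirichlet a b hab =>
    exact ⟨image_eq_zero_of_notMem_tsupport fun ha => left_notMem_Ioo (h.2.2 ha),
      image_eq_zero_of_notMem_tsupport fun hb => right_notMem_Ioo (h.2.2 hb)⟩
  | periodic a b hab => exact (by simpa using h.2 a : φ b = φ a).symm

theorem hasACRep (h : S.IsTest φ) : S.HasACRep (h.memLp.toLp φ) (h.deriv.memLp.toLp _) :=
  .of_hasDerivAt h.hasDerivAt h.deriv.1.continuous h.memLp.coeFn_toLp h.deriv.memLp.coeFn_toLp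
    h.bdryCond

end IsTest

theorem HasACRep.hasWeakDeriv (h : S.HasACRep v w) : S.HasWeakDeriv v w := by
  intro φ hφ
  obtain ⟨V, hV, hvV, hb⟩ := h
  obtain ⟨P, hP, hφP, hb'⟩ := hφ.hasACRep.dual
  have hgreen := integral_mul_add_integral_mul_eq_zero hV hvV hb hP hφP hb'
  rw [integral_congr_ae (hφ.memLp.coeFn_toLp.mono fun x hx => congrArg (w x * ·) hx),
    integral_congr_ae (hφ.deriv.memLp.coeFn_toLp.mono fun x hx => congrArg (v x * ·) hx)] at hgreen
  exact eq_neg_of_add_eq_zero_right hgreen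

theorem line_hasACRep_of_hasWeakDeriv {v w : line.L2} (h : line.HasWeakDeriv v w) :
    line.HasACRep v w := by
  have hprim := IsPrimitive.integral (locallyIntegrable_indicator w) 0 0
  set V := fun x => 0 + ∫ t in (0 : ℝ)..x, line.dom.indicator w t
  have hv : LocallyIntegrable v volume :=
    MemLp.locallyIntegrable (μ := volume) (Lp.memLp v) one_le_two
  have hortho : ∀ φ : ℝ → ℝ, ContDiff ℝ ∞ φ → HasCompactSupport φ → tsupport φ ⊆ univ →
      ∫ x, deriv φ x • (v x - V x) = 0 := fun φ hφ hφc hφU => by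
    have hΦ := isTest_ofReal_comp (S := line) (by simp) hφ hφc hφU
    have hint : ∀ {f ψ : ℝ → ℂ}, LocallyIntegrable f → line.IsTest ψ →
        Integrable fun x => f x * ψ x := fun hf hψ =>
      hf.integrable_smul_right_of_hasCompactSupport hψ.1.continuous hψ.2
    have hV := hprim.continuous.locallyIntegrable (μ := volume)
    have hparts := (hprim.mul (.of_hasDerivAt hΦ.hasDerivAt hΦ.deriv.1.continuous)).integral_eq_zero
      (hint hV hΦ) ((hint hprim.locallyIntegrable hΦ).add (hint hV hΦ.deriv))
    rw [integral_add (hint hprim.locallyIntegrable hΦ) (hint hV hΦ.deriv)] at hparts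
    calc ∫ x, deriv φ x • (v x - V x)
        = ∫ x, (v x * deriv (fun x => (φ x : ℂ)) x - V x * deriv (fun x => (φ x : ℂ)) x) := by
          simp only [deriv_ofReal_comp (contDiff_infty_iff_deriv.1 hφ).1, Complex.real_smul,
            mul_sub, mul_comm]
      _ = (∫ x, v x * deriv (fun x => (φ x : ℂ)) x) - ∫ x, V x * deriv (fun x => (φ x : ℂ)) x :=
          integral_sub (hint hv hΦ.deriv) (hint hV hΦ.deriv)
      _ = 0 := by
          rw [eq_neg_of_add_eq_zero_right hparts, sub_neg_eq_add]
          have := h _ hΦ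
          simp only [dom, indicator_univ, vol] at this ⊢
          rw [this, neg_add_cancel]
  obtain ⟨c, hc⟩ := exists_ae_eq_const_of_integral_deriv_smul_eq_zero isOpen_univ ordConnected_univ
    (hv.sub hprim.continuous.locallyIntegrable) hortho
  refine ⟨fun x => c + V x, ⟨hprim.locallyIntegrable, fun x y => ?_⟩, ?_, trivial⟩
  · rw [add_sub_add_left_eq_sub, hprim.sub_eq]
  · exact hc.mono fun x hx => sub_eq_iff_eq_add.1 (hx (mem_univ x))

section Graph

variable {S : Domain1D}

theorem hasACRep_zero (S : Domain1D) : S.HasACRep 0 0 := by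
  have hzero : ((0 : S.L2) : ℝ → ℂ) =ᵐ[S.vol] fun _ => 0 := Lp.coeFn_zero ..
  exact .of_hasDerivAt (fun x => hasDerivAt_const x 0) continuous_const hzero hzero
    (by cases S <;> simp [BdryCond])

theorem HasACRep.add {v w v' w' : S.L2} (h : S.HasACRep v w) (h' : S.HasACRep v' w') :
    S.HasACRep (v + v') (w + w') := by
  obtain ⟨V, hV, hvV, hb⟩ := h
  obtain ⟨V', hV', hvV', hb'⟩ := h'
  refine ⟨fun x => V x + V' x, ?_, ?_, ?_⟩
  · refine ⟨locallyIntegrable_indicator _, fun x y => ?_⟩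
    rw [add_sub_add_comm, hV.sub_eq, hV'.sub_eq, ← intervalIntegral.integral_add
      (hV.intervalIntegrable _ _) (hV'.intervalIntegrable _ _)]
    refine intervalIntegral.integral_congr_ae ?_
    filter_upwards [S.ae_vol_iff.1 (Lp.coeFn_add w w')] with t ht _
    by_cases htS : t ∈ S.dom
    · simp only [indicator_of_mem htS, ht htS, Pi.add_apply]
    · simp only [indicator_of_notMem htS, add_zero]
  · filter_upwards [Lp.coeFn_add v v', hvV, hvV'] with x h₁ h₂ h₃
    rw [h₁, Pi.add_apply, h₂, h₃]
  · cases S with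
    | line => trivial
    | dirichlet a b hab => simp [BdryCond, hb.1, hb.2, hb'.1, hb'.2]
    | periodic a b hab => exact congrArg₂ (· + ·) hb hb'

theorem HasACRep.smul {v w : S.L2} (c : ℂ) (h : S.HasACRep v w) : S.HasACRep (c • v) (c • w) := by
  obtain ⟨V, hV, hvV, hb⟩ := h
  refine ⟨fun x => c • V x, ?_, ?_, hb.comp (F := (c • ·)) (smul_zero c)⟩
  · refine (hV.clm_comp (c • ContinuousLinearMap.id ℝ ℂ)).congr_ae ?_
    filter_upwards [S.ae_vol_iff.1 (Lp.coeFn_smul c w)] with t ht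
    by_cases htS : t ∈ S.dom
    · simp [htS, ht htS]
    · simp [htS]
  · filter_upwards [Lp.coeFn_smul c v, hvV] with x h₁ h₂
    rw [h₁, Pi.smul_apply, h₂]

/-- The graph of the derivative, as a subspace of `L² × L²`. -/
def derivGraph (S : Domain1D) : Submodule ℂ (S.L2 × S.L2) where
  carrier := {x | S.HasACRep x.1 x.2}
  zero_mem' := S.hasACRep_zero
  add_mem' := HasACRep.add
  smul_mem' c _ := HasACRep.smul c

theorem HasACRep.sub {v w v' w' : S.L2} (h : S.HasACRep v w) (h' : S.HasACRep v' w') :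
    S.HasACRep (v - v') (w - w') :=
  S.derivGraph.sub_mem (x := (v, w)) (y := (v', w')) h h'

theorem HasACRep.sum_smul {ι : Type*} {e d : ι → S.L2} (h : ∀ k, S.HasACRep (e k) (d k))
    (s : Finset ι) (c : ι → ℂ) : S.HasACRep (∑ k ∈ s, c k • e k) (∑ k ∈ s, c k • d k) := by
  have hmem := S.derivGraph.sum_mem (t := s) (f := fun k => (c k • e k, c k • d k))
    fun k _ => (h k).smul (c k)
  change S.HasACRep _ _ at hmem
  rwa [Prod.fst_sum, Prod.snd_sum] at hmem

end Graph

section Dirichlet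

variable {a b : ℝ} {hab : a < b}

theorem norm_le_sqrt_mul_of_isPrimitive {w : (dirichlet a b hab).L2} {V : ℝ → ℂ}
    (hV : IsPrimitive V ((dirichlet a b hab).dom.indicator w)) (hVa : V a = 0) {x : ℝ}
    (hx : x ∈ Icc a b) : ‖V x‖ ≤ √(b - a) * ‖w‖ := by
  have hle := hV.norm_le_add_setIntegral hx (left_mem_Icc.2 hab.le)
  rw [hVa, norm_zero, zero_add] at hle
  exact hle.trans (setIntegral_norm_le w hab.le subset_rfl (indicator_ae_eq w).symm)

theorem HasACRep.poincare {v w : (dirichlet a b hab).L2} (h : (dirichlet a b hab).HasACRep v w) :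
    ‖v‖ ≤ (b - a) * ‖w‖ := by
  obtain ⟨V, hV, hvV, hb⟩ := h
  have hba : (0 : ℝ) ≤ b - a := (sub_pos.2 hab).le
  have hfin : IsFiniteMeasure (dirichlet a b hab).vol :=
    inferInstanceAs (IsFiniteMeasure (volume.restrict (Ioo a b)))
  have hmeas : (measureUnivNNReal (dirichlet a b hab).vol : ℝ) = b - a := by
    simp only [measureUnivNNReal, vol, Measure.restrict_apply_univ, Real.volume_Ioo]
    exact ENNReal.toReal_ofReal hba
  have hbound : ∀ᵐ x ∂(dirichlet a b hab).vol, ‖v x‖ ≤ √(b - a) * ‖w‖ := by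
    filter_upwards [hvV, ae_restrict_mem measurableSet_Ioo] with x hx hxS
    exact hx ▸ norm_le_sqrt_mul_of_isPrimitive hV hb.1 (Ioo_subset_Icc_self hxS)
  calc ‖v‖ ≤ (b - a) ^ (1 / 2 : ℝ) * (√(b - a) * ‖w‖) := by
        simpa [hmeas] using Lp.norm_le_of_ae_bound (by positivity) hbound
    _ = (b - a) * ‖w‖ := by rw [← Real.sqrt_eq_rpow, ← mul_assoc, Real.mul_self_sqrt hba]

/-- The derivatives of test functions, as a subspace of `L²(a, b)`. -/
def testDerivs (a b : ℝ) (hab : a < b) : Submodule ℂ (dirichlet a b hab).L2 where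
  carrier := {q | ∃ φ, (dirichlet a b hab).IsTest φ ∧ q =ᵐ[(dirichlet a b hab).vol] deriv φ}
  zero_mem' := ⟨0, ⟨contDiff_const, .zero, by simp⟩, by
    simpa using! Lp.coeFn_zero ℂ 2 (dirichlet a b hab).vol⟩
  add_mem' := by
    rintro q q' ⟨φ, hφ, hq⟩ ⟨φ', hφ', hq'⟩
    refine ⟨φ + φ', ⟨hφ.1.add hφ'.1, hφ.2.1.add hφ'.2.1,
      (tsupport_add φ φ').trans (union_subset hφ.2.2 hφ'.2.2)⟩, ?_⟩
    filter_upwards [Lp.coeFn_add q q', hq, hq'] with x h₁ h₂ h₃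
    rw [h₁, Pi.add_apply, h₂, h₃, ((hφ.hasDerivAt x).add (hφ'.hasDerivAt x)).deriv]
  smul_mem' := by
    rintro c q ⟨φ, hφ, hq⟩
    refine ⟨c • φ, ⟨contDiff_const.smul hφ.1, hφ.2.1.smul_left (f := fun _ => c),
      (tsupport_smul_subset_right (fun _ => c) φ).trans hφ.2.2⟩, ?_⟩
    filter_upwards [Lp.coeFn_smul c q, hq] with x h₁ h₂
    rw [h₁, Pi.smul_apply, h₂, ((hφ.hasDerivAt x).const_smul c).deriv]

theorem exists_ae_eq_const_of_mem_testDerivs_orthogonal {z : (dirichlet a b hab).L2}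
    (hz : z ∈ (testDerivs a b hab)ᗮ) : ∃ c : ℂ, ∀ᵐ x ∂(dirichlet a b hab).vol, z x = c := by
  have hortho : ∀ φ : ℝ → ℝ, ContDiff ℝ ∞ φ → HasCompactSupport φ → tsupport φ ⊆ Ioo a b →
      ∫ x, deriv φ x • (Ioo a b).indicator z x = 0 := fun φ hφ hφc hφU => by
    have hΦ := isTest_ofReal_comp (S := dirichlet a b hab) (by simp) hφ hφc hφU
    have hinner := hz _ ⟨_, hΦ, hΦ.deriv.memLp.coeFn_toLp⟩
    rw [L2_inner_eq_integral] at hinner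
    simp only [← indicator_smul_apply]
    rw [integral_indicator measurableSet_Ioo, ← hinner]
    refine integral_congr_ae (hΦ.deriv.memLp.coeFn_toLp.mono fun x hx => ?_)
    beta_reduce
    rw [hx, deriv_ofReal_comp (contDiff_infty_iff_deriv.1 hφ).1, Complex.conj_ofReal,
      Complex.real_smul]
  obtain ⟨c, hc⟩ := exists_ae_eq_const_of_integral_deriv_smul_eq_zero isOpen_Ioo ordConnected_Ioo
    (locallyIntegrable_indicator z) hortho
  refine ⟨c, (dirichlet a b hab).ae_vol_iff.2 (hc.mono fun x hx hxS => ?_)⟩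
  rw [← hx hxS]
  exact (indicator_of_mem hxS _).symm

theorem mem_closure_testDerivs_iff {w : (dirichlet a b hab).L2} :
    w ∈ (testDerivs a b hab).topologicalClosure ↔ ∫ x, w x ∂(dirichlet a b hab).vol = 0 := by
  have hone : MemLp (fun _ : ℝ => (1 : ℂ)) 2 (dirichlet a b hab).vol :=
    memLp_Ioo_of_continuous continuous_const
  have hinner : inner ℂ (hone.toLp _) w = ∫ x, w x ∂(dirichlet a b hab).vol := by
    rw [L2_inner_eq_integral]
    exact integral_congr_ae (hone.coeFn_toLp.mono fun x hx => by simp [hx])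
  constructor
  · intro hw
    have hle : testDerivs a b hab ≤ (Submodule.span ℂ {hone.toLp _})ᗮ := by
      rintro q ⟨φ, hφ, hq⟩
      have hrep : (dirichlet a b hab).HasDualACRep (hone.toLp _) 0 :=
        .of_hasDerivAt (fun x => hasDerivAt_const x 1) continuous_const hone.coeFn_toLp
          (Lp.coeFn_zero ..) trivial
      rw [Submodule.mem_orthogonal_singleton_iff_inner_right, Lp.ext (hq.trans
        hφ.deriv.memLp.coeFn_toLp.symm), hφ.hasACRep.inner_eq_neg_inner hrep, inner_zero_left,
        neg_zero]
    have hmem := Submodule.topologicalClosure_minimal _ hle (Submodule.isClosed_orthogonal _) hw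
    rwa [Submodule.mem_orthogonal_singleton_iff_inner_right, hinner] at hmem
  · intro hw
    rw [← Submodule.orthogonal_orthogonal_eq_closure]
    intro z hz
    obtain ⟨c, hc⟩ := exists_ae_eq_const_of_mem_testDerivs_orthogonal hz
    rw [L2_inner_eq_integral, integral_congr_ae (hc.mono fun x hx => by rw [hx]),
      integral_const_mul, hw, mul_zero]

theorem isLimitOfTests_iff {v w : (dirichlet a b hab).L2} :
    (dirichlet a b hab).IsLimitOfTests v w ↔ ∀ δ > 0, ∃ φ, ∃ h : (dirichlet a b hab).IsTest φ,
      ‖v - h.memLp.toLp φ‖ ≤ δ ∧ ‖w - h.deriv.memLp.toLp _‖ ≤ δ := by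
  have hnorm : ∀ {δ : ℝ}, 0 < δ → ∀ (f : (dirichlet a b hab).L2) {g : ℝ → ℂ}
      (hg : MemLp g 2 (dirichlet a b hab).vol),
      eLpNorm (fun x => f x - g x) 2 (dirichlet a b hab).vol ≤ ENNReal.ofReal δ ↔
        ‖f - hg.toLp g‖ ≤ δ := fun hδ f g hg => by
    rw [← ENNReal.ofReal_le_ofReal_iff hδ.le, ofReal_norm, Lp.enorm_def]
    refine iff_of_eq (congrArg (· ≤ _) (eLpNorm_congr_ae ?_))
    filter_upwards [Lp.coeFn_sub f (hg.toLp g), hg.coeFn_toLp] with x h₁ h₂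
    rw [h₁, Pi.sub_apply, h₂]
  refine forall₂_congr fun δ hδ => exists_congr fun φ => ?_
  exact ⟨fun ⟨h, hv, hw⟩ => ⟨h, (hnorm hδ v _).1 hv, (hnorm hδ w _).1 hw⟩,
    fun ⟨h, hv, hw⟩ => ⟨h, (hnorm hδ v _).2 hv, (hnorm hδ w _).2 hw⟩⟩

theorem HasACRep.isLimitOfTests {v w : (dirichlet a b hab).L2}
    (h : (dirichlet a b hab).HasACRep v w) : (dirichlet a b hab).IsLimitOfTests v w := by
  have : 0 < b - a := sub_pos.2 hab
  have hw : w ∈ (testDerivs a b hab).topologicalClosure := by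
    rw [mem_closure_testDerivs_iff]
    obtain ⟨V, hV, -, hVa, hVb⟩ := h
    have hsub := hV.sub_eq a b
    rw [hVa, hVb, sub_zero, intervalIntegral.integral_of_le hab.le,
      integral_Ioc_eq_integral_Ioo] at hsub
    exact (integral_congr_ae (indicator_ae_eq w).symm).trans hsub.symm
  refine isLimitOfTests_iff.2 fun δ hδ => ?_
  obtain ⟨q, ⟨φ, hφ, hq⟩, hdist⟩ := Metric.mem_closure_iff.1 hw (δ / (1 + (b - a))) (by positivity)
  obtain rfl : q = hφ.deriv.memLp.toLp _ := Lp.ext (hq.trans hφ.deriv.memLp.coeFn_toLp.symm)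
  rw [dist_eq_norm, lt_div_iff₀ (by positivity)] at hdist
  have hpoincare := (h.sub hφ.hasACRep).poincare
  have hnonneg := norm_nonneg (w - hφ.deriv.memLp.toLp _)
  exact ⟨φ, hφ, by nlinarith, by nlinarith⟩

theorem IsLimitOfTests.hasACRep {v w : (dirichlet a b hab).L2}
    (h : (dirichlet a b hab).IsLimitOfTests v w) : (dirichlet a b hab).HasACRep v w := by
  rw [isLimitOfTests_iff] at h
  have hw : ∫ x, w x ∂(dirichlet a b hab).vol = 0 := by
    refine mem_closure_testDerivs_iff.1 (Metric.mem_closure_iff.2 fun δ hδ => ?_)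
    obtain ⟨φ, hφ, -, hle⟩ := h (δ / 2) (half_pos hδ)
    exact ⟨_, ⟨φ, hφ, hφ.deriv.memLp.coeFn_toLp⟩,
      (dist_eq_norm w _).trans_lt (hle.trans_lt (half_lt_self hδ))⟩
  have hprim := IsPrimitive.integral (locallyIntegrable_indicator w) 0 a
  have hmem : MemLp _ 2 (dirichlet a b hab).vol := memLp_Ioo_of_continuous hprim.continuous
  have hrep : (dirichlet a b hab).HasACRep (hmem.toLp _) w := by
    refine ⟨_, hprim, hmem.coeFn_toLp, by simp, ?_⟩
    beta_reduce
    rw [zero_add, intervalIntegral.integral_of_le hab.le, integral_Ioc_eq_integral_Ioo]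
    exact (integral_congr_ae (indicator_ae_eq w)).trans hw
  suffices v = hmem.toLp _ from this ▸ hrep
  refine eq_of_forall_dist_le fun δ hδ => ?_
  have hba : 0 < b - a := sub_pos.2 hab
  obtain ⟨φ, hφ, hv, hw⟩ := h (δ / (1 + (b - a))) (by positivity)
  have hpoincare := (hrep.sub hφ.hasACRep).poincare
  calc dist v (hmem.toLp _)
      ≤ dist v (hφ.memLp.toLp φ) + dist (hmem.toLp _) (hφ.memLp.toLp φ) := dist_triangle_right ..
    _ ≤ δ / (1 + (b - a)) + (b - a) * (δ / (1 + (b - a))) := by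
        rw [dist_eq_norm, dist_eq_norm]
        gcongr
        exact hpoincare.trans (by gcongr)
    _ = δ := by field_simp

end Dirichlet

end Domain1D

theorem inner_toLp {α : Type*} [MeasurableSpace α] {μ : Measure α} {f : α → ℂ} (hf : MemLp f 2 μ)
    (v : Lp ℂ 2 μ) : inner ℂ (hf.toLp f) v = ∫ x, conj (f x) * v x ∂μ := by
  rw [L2_inner_eq_integral]
  exact integral_congr_ae (hf.coeFn_toLp.mono fun x hx => congrArg (conj · * v x) hx)

theorem finite_setOf_intCast_mul_sq_le {c : ℝ} (hc : 0 < c) (N : ℝ) :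
    {k : ℤ | (c * k) ^ 2 ≤ N}.Finite := by
  refine (Int.preimage_Icc (a := -(√N / c)) (b := √N / c) ▸ finite_Icc _ _).subset fun k hk => ?_
  have hle := abs_le.1 (Real.abs_le_sqrt hk)
  constructor
  · rw [← neg_div, div_le_iff₀' hc]
    exact hle.1
  · rw [le_div_iff₀' hc]
    exact hle.2

theorem ae_eq_zero_of_fourierCoeffOn_eq_zero {a b : ℝ} (hab : a < b) {f : ℝ → ℂ}
    (hf : MemLp f 2 (volume.restrict (Ioo a b))) (h : ∀ k, fourierCoeffOn hab f k = 0) :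
    f =ᵐ[volume.restrict (Ioo a b)] 0 := by
  have hf' : MemLp f 2 (volume.restrict (Ioc a b)) := by rwa [← restrict_Ioo_eq_restrict_Ioc]
  have hsum := hasSum_sq_fourierCoeffOn hab hf'
  simp only [h, norm_zero, ne_eq, OfNat.ofNat_ne_zero, not_false_eq_true, zero_pow] at hsum
  have hint : ∫ x in Ioo a b, ‖f x‖ ^ 2 = 0 := by
    rw [← integral_Ioc_eq_integral_Ioo, ← intervalIntegral.integral_of_le hab.le]
    exact (smul_eq_zero.1 (hsum.unique hasSum_zero)).resolve_left
      (inv_ne_zero (sub_ne_zero.2 hab.ne'))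
  refine ((integral_eq_zero_iff_of_nonneg (fun x => sq_nonneg ‖f x‖)
    (hf.integrable_norm_pow two_ne_zero)).1 hint).mono fun x hx => ?_
  exact norm_eq_zero.1 (pow_eq_zero_iff two_ne_zero |>.1 hx)

namespace Domain1D

section Periodic

variable {a b : ℝ}

/-- The frequency of the `k`-th periodic mode on `(a, b)`. -/
def expFreq (a b : ℝ) (k : ℤ) : ℝ := 2 * Real.pi * k / (b - a)

/-- The periodic mode `expMode a b k` as a function on `ℝ`. -/
def expFun (a b : ℝ) (k : ℤ) (x : ℝ) : ℂ :=
  ((√(b - a))⁻¹ : ℂ) * Complex.exp (Complex.I * ((2 * Real.pi * k * (x - a) / (b - a) : ℝ) : ℂ))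

theorem contDiff_expFun (a b : ℝ) (k : ℤ) : ContDiff ℝ ∞ (expFun a b k) := by
  have hphase : ContDiff ℝ ∞ fun x : ℝ => ((2 * Real.pi * k * (x - a) / (b - a) : ℝ) : ℂ) :=
    Complex.ofRealCLM.contDiff.comp
      ((contDiff_const.mul (contDiff_id.sub contDiff_const)).div_const _)
  exact contDiff_const.mul (contDiff_const.mul hphase).cexp

theorem periodic_expFun (hab : a < b) (k : ℤ) : Function.Periodic (expFun a b k) (b - a) := by
  intro x
  have hba : b - a ≠ 0 := sub_ne_zero.2 hab.ne'
  have harg : 2 * Real.pi * k * (x + (b - a) - a) / (b - a) =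
      2 * Real.pi * k * (x - a) / (b - a) + k * (2 * Real.pi) := by field_simp; ring
  have hexp : Complex.exp (Complex.I * ((k * (2 * Real.pi) : ℝ) : ℂ)) = 1 := by
    convert Complex.exp_int_mul_two_pi_mul_I k using 2
    push_cast
    ring
  rw [expFun, expFun, harg, Complex.ofReal_add, mul_add, Complex.exp_add, hexp, mul_one]

theorem hasDerivAt_expFun (a b : ℝ) (k : ℤ) (x : ℝ) :
    HasDerivAt (expFun a b k) (Complex.I * expFreq a b k * expFun a b k x) x := by
  have hphase : HasDerivAt (fun x => 2 * Real.pi * k * (x - a) / (b - a)) (expFreq a b k) x := by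
    simpa [expFreq] using! (((hasDerivAt_id x).sub_const a).const_mul (2 * Real.pi * k)).div_const
      (b - a)
  refine ((hphase.ofReal_comp.const_mul Complex.I).cexp.const_mul
    ((√(b - a))⁻¹ : ℂ)).congr_deriv ?_
  rw [expFun]
  ring

theorem inner_expMode (k : ℤ) (v : Lp ℂ 2 (volume.restrict (Ioo a b))) :
    inner ℂ (expMode a b k) v = ∫ x in Ioo a b, conj (expFun a b k x) * v x :=
  inner_toLp (memLp_expMode a b k) v

theorem conj_expFun_mul_self (hab : a < b) (k : ℤ) (x : ℝ) :
    conj (expFun a b k x) * expFun a b k x = ((b - a)⁻¹ : ℝ) := by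
  rw [Complex.conj_mul', expFun, norm_mul, mul_comm Complex.I, Complex.norm_exp_ofReal_mul_I,
    mul_one, norm_inv, Complex.norm_real, Real.norm_of_nonneg (Real.sqrt_nonneg _)]
  norm_cast
  rw [inv_pow, Real.sq_sqrt (sub_pos.2 hab).le]

theorem norm_expMode (hab : a < b) (k : ℤ) : ‖expMode a b k‖ = 1 := by
  have hinner : inner ℂ (expMode a b k) (expMode a b k) = (1 : ℂ) := by
    have hconst : ∀ᵐ x ∂volume.restrict (Ioo a b),
        conj (expFun a b k x) * expMode a b k x = ((b - a)⁻¹ : ℝ) :=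
      (memLp_expMode a b k).coeFn_toLp.mono fun x hx =>
        (congrArg _ hx).trans (conj_expFun_mul_self hab k x)
    rw [inner_expMode, integral_congr_ae hconst, setIntegral_const,
      Real.volume_real_Ioo_of_le hab.le, Complex.real_smul, ← Complex.ofReal_mul,
      mul_inv_cancel₀ (sub_ne_zero.2 hab.ne'), Complex.ofReal_one]
  rw [inner_self_eq_norm_sq_to_K] at hinner
  exact (pow_eq_one_iff_of_nonneg (norm_nonneg _) two_ne_zero).1
    (Complex.ofReal_injective (by simpa using! hinner))

variable {hab : a < b} {v w : Lp ℂ 2 (volume.restrict (Ioo a b))}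

theorem HasWeakDeriv.inner_expMode (h : (periodic a b hab).HasWeakDeriv v w) (k : ℤ) :
    inner ℂ (expMode a b k) w = Complex.I * expFreq a b k * inner ℂ (expMode a b k) v := by
  have hderiv : ∀ x, HasDerivAt (fun x => conj (expFun a b k x))
      (conj (Complex.I * expFreq a b k * expFun a b k x)) x := fun x =>
    (hasDerivAt_expFun a b k x).star
  have htest := h (fun x => conj (expFun a b k x))
    ⟨Complex.conjCLE.contDiff.comp (contDiff_expFun a b k),
      fun x => congrArg conj (periodic_expFun hab k x)⟩
  simp only [fun x => (hderiv x).deriv] at htest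
  rw [Domain1D.inner_expMode, Domain1D.inner_expMode, ← integral_const_mul]
  simp only [mul_comm (conj _)]
  refine neg_injective (htest.symm.trans ?_)
  rw [← integral_neg]
  refine integral_congr_ae (.of_forall fun x => ?_)
  change v x * conj (Complex.I * expFreq a b k * expFun a b k x) =
    -(Complex.I * expFreq a b k * (v x * conj (expFun a b k x)))
  simp only [map_mul, Complex.conj_I, Complex.conj_ofReal]
  ring

theorem hasACRep_expMode (hab : a < b) (k : ℤ) : (periodic a b hab).HasACRep (expMode a b k)
    ((Complex.I * expFreq a b k) • expMode a b k : Lp ℂ 2 (volume.restrict (Ioo a b))) := by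
  refine .of_hasDerivAt (hasDerivAt_expFun a b k)
    (continuous_const.mul (contDiff_expFun a b k).continuous) (memLp_expMode a b k).coeFn_toLp ?_ ?_
  · filter_upwards [Lp.coeFn_smul (Complex.I * expFreq a b k) (expMode a b k),
      (memLp_expMode a b k).coeFn_toLp] with x h₁ h₂
    exact h₁.trans (congrArg (Complex.I * expFreq a b k * ·) h₂)
  · simpa using! (periodic_expFun hab k a).symm

theorem expFreq_injective (hab : a < b) : Function.Injective (expFreq a b) := fun j k h => by
  have hba : b - a ≠ 0 := sub_ne_zero.2 hab.ne'
  have hpi := Real.pi_ne_zero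
  simp only [expFreq] at h
  field_simp at h
  exact_mod_cast h

theorem orthonormal_expMode (hab : a < b) : Orthonormal ℂ (expMode a b) := by
  refine ⟨norm_expMode hab, fun j k hjk => ?_⟩
  have hinner := (hasACRep_expMode hab k).hasWeakDeriv.inner_expMode j
  have hfreq : (expFreq a b k : ℂ) ≠ expFreq a b j :=
    Complex.ofReal_injective.ne ((expFreq_injective hab).ne hjk.symm)
  rw [inner_smul_right] at hinner
  exact (mul_eq_mul_right_iff.1 hinner).resolve_left
    (mt (mul_left_cancel₀ Complex.I_ne_zero) hfreq)

theorem eq_zero_of_inner_expMode (hab : a < b)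
    (h : ∀ k, inner ℂ (expMode a b k) v = 0) : v = 0 := by
  refine (Lp.eq_zero_iff_ae_eq_zero).2
    (ae_eq_zero_of_fourierCoeffOn_eq_zero hab (Lp.memLp v) fun k => ?_)
  have hfourier : ∀ x : ℝ, fourier (-k) (x : AddCircle (b - a)) =
      √(b - a) * Complex.exp (-(Complex.I * (expFreq a b k * a : ℝ))) * conj (expFun a b k x) :=
    fun x => by
      have hsqrt : (√(b - a) : ℂ) ≠ 0 :=
        Complex.ofReal_ne_zero.2 (Real.sqrt_pos.2 (sub_pos.2 hab)).ne'
      rw [fourier_coe_apply, expFun, map_mul, ← Complex.exp_conj, map_inv₀, Complex.conj_ofReal,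
        mul_mul_mul_comm, mul_inv_cancel₀ hsqrt, one_mul, ← Complex.exp_add, map_mul,
        Complex.conj_I, Complex.conj_ofReal, expFreq]
      congr 1
      push_cast
      ring
  have hk := h k
  rw [inner_expMode] at hk
  rw [fourierCoeffOn_eq_integral, intervalIntegral.integral_of_le hab.le,
    integral_Ioc_eq_integral_Ioo]
  simp only [hfourier, smul_eq_mul, mul_assoc, integral_const_mul, hk, mul_zero, smul_zero]

/-- The Fourier basis of `L²(a, b)`. -/
def expBasis (hab : a < b) : HilbertBasis ℤ ℂ (periodic a b hab).L2 :=
  .mkOfOrthogonalEqBot (orthonormal_expMode hab) <| (Submodule.eq_bot_iff _).2 fun _ hv =>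
    eq_zero_of_inner_expMode hab fun _ =>
      Submodule.inner_right_of_mem_orthogonal (Submodule.subset_span (mem_range_self _)) hv

theorem coe_expBasis (hab : a < b) : ⇑(expBasis hab) = expMode a b :=
  HilbertBasis.coe_mkOfOrthogonalEqBot ..

theorem periodic_hasACRep_of_hasWeakDeriv (h : (periodic a b hab).HasWeakDeriv v w) :
    (periodic a b hab).HasACRep v w := by
  have hw : ∫ x in Ioo a b, w x = 0 := by
    have hone := h (fun _ => 1) ⟨contDiff_const, fun _ => rfl⟩
    simp only [deriv_const, mul_zero, integral_zero, mul_one] at hone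
    exact neg_eq_zero.1 hone.symm
  obtain ⟨p, hrep⟩ : ∃ p : Lp ℂ 2 (volume.restrict (Ioo a b)), (periodic a b hab).HasACRep p w := by
    have hprim := IsPrimitive.integral (locallyIntegrable_indicator (S := periodic a b hab) w) 0 a
    have hmem : MemLp _ 2 (periodic a b hab).vol := memLp_Ioo_of_continuous hprim.continuous
    refine ⟨hmem.toLp _, _, hprim, hmem.coeFn_toLp, ?_⟩
    change 0 + _ = 0 + _
    rw [intervalIntegral.integral_same, intervalIntegral.integral_of_le hab.le,
      integral_Ioc_eq_integral_Ioo]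
    exact congrArg (0 + ·) (hw.symm.trans (integral_congr_ae
      (indicator_ae_eq (S := periodic a b hab) w).symm))
  have hconst : v - p = inner ℂ (expMode a b 0) (v - p) • expMode a b 0 := by
    refine sub_eq_zero.1 (eq_zero_of_inner_expMode hab fun k => ?_)
    rw [inner_sub_right, inner_smul_right, orthonormal_iff_ite.1 (orthonormal_expMode hab)]
    split_ifs with hk
    · rw [hk, mul_one, sub_self]
    · have hfreq : Complex.I * expFreq a b k ≠ 0 := mul_ne_zero Complex.I_ne_zero
        (Complex.ofReal_ne_zero.2 fun hfreq =>
          hk (expFreq_injective hab (hfreq.trans (by simp [expFreq]))))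
      rw [mul_zero, sub_zero, inner_sub_right, sub_eq_zero]
      exact mul_left_cancel₀ hfreq
        ((h.inner_expMode k).symm.trans (hrep.hasWeakDeriv.inner_expMode k))
  have hzero : (Complex.I * expFreq a b 0) • expMode a b 0 = 0 := by simp [expFreq]
  exact (congrArg₂ (periodic a b hab).HasACRep (sub_eq_iff_eq_add'.1 hconst)
    (add_eq_left.2 ((congrArg (_ • ·) hzero).trans (smul_zero _))).symm).mpr
      (hrep.add ((hasACRep_expMode hab 0).smul (inner ℂ (expMode a b 0) (v - p))))

end Periodic

end Domain1D

/-- The odd reflection about `a` of `f`, restricted to `(a, b)`. -/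
def oddReflection (a b : ℝ) (f : ℝ → ℂ) (x : ℝ) : ℂ :=
  (Ioo a b).indicator f x - (Ioo a b).indicator f (2 * a - x)

theorem exp_sub_exp_eq_mul_sin (x y : ℂ) :
    Complex.exp (-(Complex.I * (x + y))) - Complex.exp (-(Complex.I * (x - y))) =
      -(2 * Complex.I * Complex.exp (-(Complex.I * x))) * Complex.sin y := by
  have hadd : -(Complex.I * (x + y)) = -(Complex.I * x) + -y * Complex.I := by ring
  have hsub : -(Complex.I * (x - y)) = -(Complex.I * x) + y * Complex.I := by ring
  rw [Complex.sin, hadd, hsub, Complex.exp_add, Complex.exp_add]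
  linear_combination Complex.exp (-(Complex.I * x)) *
    (Complex.exp (-y * Complex.I) - Complex.exp (y * Complex.I)) * Complex.I_sq

section OddReflection

variable {a b : ℝ} {f : ℝ → ℂ}

theorem eqOn_oddReflection (a b : ℝ) (f : ℝ → ℂ) : EqOn (oddReflection a b f) f (Ioo a b) :=
  fun x hx => by
    rw [oddReflection, indicator_of_mem hx, indicator_of_notMem fun h => ?_, sub_zero]
    linarith [h.1, hx.1]

theorem memLp_oddReflection (hf : MemLp f 2 (volume.restrict (Ioo a b))) :
    MemLp (oddReflection a b f) 2 volume :=
  have hg := (memLp_indicator_iff_restrict measurableSet_Ioo).2 hf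
  hg.sub (hg.comp_measurePreserving (Measure.measurePreserving_sub_left volume (2 * a)))

theorem integral_mul_oddReflection (hab : a < b) (hf : MemLp f 2 (volume.restrict (Ioo a b)))
    {e : ℝ → ℂ} (he : Continuous e) : ∫ x in (2 * a - b)..b, e x * oddReflection a b f x =
      ∫ x in Ioo a b, (e x - e (2 * a - x)) * f x := by
  have hg := (memLp_indicator_iff_restrict measurableSet_Ioo).2 hf
  have hint : ∀ {e g : ℝ → ℂ}, Continuous e → MemLp g 2 volume →
      IntervalIntegrable (fun x => e x * g x) volume (2 * a - b) b := fun he hg =>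
    ((hg.locallyIntegrable one_le_two).integrableOn_isCompact
      isCompact_uIcc).intervalIntegrable.continuousOn_mul he.continuousOn
  have hsub : Continuous fun x => e (2 * a - x) := he.comp (continuous_const.sub continuous_id)
  have hg' : MemLp (fun x => (Ioo a b).indicator f (2 * a - x)) 2 volume :=
    hg.comp_measurePreserving (Measure.measurePreserving_sub_left volume (2 * a))
  have hrefl := intervalIntegral.integral_comp_sub_left (a := 2 * a - b) (b := b)
    (fun x => e (2 * a - x) * (Ioo a b).indicator f x) (2 * a)
  simp only [sub_sub_cancel] at hrefl
  simp only [oddReflection, mul_sub]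
  rw [intervalIntegral.integral_sub (hint he hg) (hint he hg'), hrefl,
    ← intervalIntegral.integral_sub (hint he hg) (hint hsub hg),
    intervalIntegral.integral_of_le (by linarith), integral_Ioc_eq_integral_Ioo]
  simp only [← sub_mul, ← indicator_mul_right _ (fun x => e x - e (2 * a - x))]
  rw [setIntegral_indicator measurableSet_Ioo,
    inter_eq_right.2 (Ioo_subset_Ioo_left (by linarith))]

theorem fourier_sub_fourier_reflection (hab : a < b) (n : ℤ) (x : ℝ) :
    fourier (-n) (x : AddCircle (b - (2 * a - b))) -
        fourier (-n) ((2 * a - x : ℝ) : AddCircle (b - (2 * a - b))) =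
      -(2 * Complex.I * Complex.exp (-(Complex.I * (n * Real.pi * a / (b - a) : ℝ)))) *
        (Real.sin (n * Real.pi * (x - a) / (b - a)) : ℂ) := by
  have hba : (b : ℂ) - a ≠ 0 := sub_ne_zero.2 (Complex.ofReal_injective.ne hab.ne')
  have hperiod : ((b - (2 * a - b) : ℝ) : ℂ) = 2 * (b - a) := by push_cast; ring
  rw [fourier_coe_apply, fourier_coe_apply, Complex.ofReal_sin, ← exp_sub_exp_eq_mul_sin, hperiod]
  congr 2 <;>
  · push_cast
    field_simp
    ring

/-- The `2 (b - a)`-periodic Fourier coefficients of the odd reflection of `f` about `a` are the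
sine coefficients of `f`. -/
theorem ae_eq_zero_of_integral_sin_mul_eq_zero (hab : a < b)
    (hf : MemLp f 2 (volume.restrict (Ioo a b)))
    (h : ∀ k : ℕ,
      ∫ x in Ioo a b, (Real.sin ((k + 1) * Real.pi * (x - a) / (b - a)) : ℂ) * f x = 0) :
    f =ᵐ[volume.restrict (Ioo a b)] 0 := by
  have hcb : 2 * a - b < b := by linarith
  have hsin_nat : ∀ k : ℕ,
      ∫ x in Ioo a b, (Real.sin ((k : ℤ) * Real.pi * (x - a) / (b - a)) : ℂ) * f x = 0 := by
    rintro (_ | k)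
    · simp
    · exact_mod_cast h k
  have hsin : ∀ n : ℤ,
      ∫ x in Ioo a b, (Real.sin (n * Real.pi * (x - a) / (b - a)) : ℂ) * f x = 0 := by
    intro n
    obtain ⟨k, rfl | rfl⟩ := n.eq_nat_or_neg
    · exact hsin_nat k
    · simp only [Int.cast_neg, neg_mul, neg_div, Real.sin_neg, Complex.ofReal_neg, integral_neg]
      exact neg_eq_zero.2 (hsin_nat k)
  suffices hzero : oddReflection a b f =ᵐ[volume.restrict (Ioo (2 * a - b) b)] 0 by
    filter_upwards [ae_restrict_of_ae_restrict_of_subset (Ioo_subset_Ioo_left (by linarith)) hzero,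
      ae_restrict_mem measurableSet_Ioo] with x hx hxab
    rw [← eqOn_oddReflection a b f hxab, hx]
  refine ae_eq_zero_of_fourierCoeffOn_eq_zero hcb ((memLp_oddReflection hf).restrict _) fun n => ?_
  rw [fourierCoeffOn_eq_integral]
  simp only [smul_eq_mul]
  have hcont : Continuous fun x : ℝ => fourier (-n) (x : AddCircle (b - (2 * a - b))) := by
    simp only [fourier_coe_apply]
    fun_prop
  rw [integral_mul_oddReflection hab hf hcont]
  simp only [fourier_sub_fourier_reflection hab, mul_assoc (-(2 * Complex.I * _)),
    integral_const_mul, hsin, mul_zero, smul_zero]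

end OddReflection

namespace Domain1D

section Dirichlet

variable {a b : ℝ}

/-- The frequency of the `k`-th Dirichlet mode on `(a, b)`. -/
def sinFreq (a b : ℝ) (k : ℕ) : ℝ := (k + 1) * Real.pi / (b - a)

/-- The Dirichlet mode `sineMode a b k` as a function on `ℝ`. -/
def sinFun (a b : ℝ) (k : ℕ) (x : ℝ) : ℂ :=
  ((√(2 / (b - a)) * Real.sin ((k + 1) * Real.pi * (x - a) / (b - a)) : ℝ) : ℂ)

/-- The derivative of `sinFun a b k`, divided by its frequency. -/
def cosFun (a b : ℝ) (k : ℕ) (x : ℝ) : ℂ :=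
  ((√(2 / (b - a)) * Real.cos ((k + 1) * Real.pi * (x - a) / (b - a)) : ℝ) : ℂ)

theorem continuous_sinFun (a b : ℝ) (k : ℕ) : Continuous (sinFun a b k) := by
  unfold sinFun
  fun_prop

theorem continuous_cosFun (a b : ℝ) (k : ℕ) : Continuous (cosFun a b k) := by
  unfold cosFun
  fun_prop

theorem hasDerivAt_sineMode_phase (a b : ℝ) (k : ℕ) (x : ℝ) :
    HasDerivAt (fun x => (k + 1) * Real.pi * (x - a) / (b - a)) (sinFreq a b k) x := by
  simpa [sinFreq] using! (((hasDerivAt_id x).sub_const a).const_mul ((k + 1) * Real.pi)).div_const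
    (b - a)

theorem hasDerivAt_sinFun (a b : ℝ) (k : ℕ) (x : ℝ) :
    HasDerivAt (sinFun a b k) (sinFreq a b k * cosFun a b k x) x := by
  refine ((hasDerivAt_sineMode_phase a b k x).sin.const_mul
    √(2 / (b - a))).ofReal_comp.congr_deriv ?_
  rw [cosFun]
  push_cast
  ring

theorem hasDerivAt_cosFun (a b : ℝ) (k : ℕ) (x : ℝ) :
    HasDerivAt (cosFun a b k) (-sinFreq a b k * sinFun a b k x) x := by
  refine ((hasDerivAt_sineMode_phase a b k x).cos.const_mul
    √(2 / (b - a))).ofReal_comp.congr_deriv ?_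
  rw [sinFun]
  push_cast
  ring

/-- `cosFun a b k` in `L²(a, b)`. -/
def cosMode (a b : ℝ) (k : ℕ) : Lp ℂ 2 (volume.restrict (Ioo a b)) :=
  (memLp_Ioo_of_continuous (continuous_cosFun a b k)).toLp _

theorem hasACRep_sineMode (hab : a < b) (k : ℕ) : (dirichlet a b hab).HasACRep (sineMode a b k)
    ((sinFreq a b k : ℂ) • cosMode a b k : Lp ℂ 2 (volume.restrict (Ioo a b))) := by
  refine .of_hasDerivAt (hasDerivAt_sinFun a b k)
    (continuous_const.mul (continuous_cosFun a b k)) (memLp_sine a b k).coeFn_toLp ?_ ⟨?_, ?_⟩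
  · filter_upwards [Lp.coeFn_smul (sinFreq a b k : ℂ) (cosMode a b k),
      (memLp_Ioo_of_continuous (r := 2) (continuous_cosFun a b k)).coeFn_toLp] with x h₁ h₂
    exact h₁.trans (congrArg ((sinFreq a b k : ℂ) * ·) h₂)
  · simp [sinFun]
  · have hsin : Real.sin ((k + 1) * Real.pi) = 0 := by exact_mod_cast Real.sin_nat_mul_pi (k + 1)
    rw [sinFun, mul_div_cancel_right₀ _ (sub_ne_zero.2 hab.ne'), hsin, mul_zero,
      Complex.ofReal_zero]

variable {hab : a < b} {v w : Lp ℂ 2 (volume.restrict (Ioo a b))}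

theorem HasACRep.inner_cosMode (h : (dirichlet a b hab).HasACRep v w) (k : ℕ) :
    inner ℂ (cosMode a b k) w = sinFreq a b k * inner ℂ (sineMode a b k) v := by
  have hdual : (dirichlet a b hab).HasDualACRep (cosMode a b k)
      ((-sinFreq a b k : ℂ) • sineMode a b k : Lp ℂ 2 (volume.restrict (Ioo a b))) := by
    refine .of_hasDerivAt (hasDerivAt_cosFun a b k)
      (continuous_const.mul (continuous_sinFun a b k)) (MemLp.coeFn_toLp _) ?_ trivial
    filter_upwards [Lp.coeFn_smul (-sinFreq a b k : ℂ) (sineMode a b k),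
      (memLp_sine a b k).coeFn_toLp] with x h₁ h₂
    exact h₁.trans (congrArg ((-sinFreq a b k : ℂ) * ·) h₂)
  refine (h.inner_eq_neg_inner hdual).trans ?_
  change -inner ℂ ((-sinFreq a b k : ℂ) • sineMode a b k) v = _
  rw [inner_smul_left, map_neg, Complex.conj_ofReal, neg_mul, neg_neg]

theorem inner_sineMode (k : ℕ) (v : Lp ℂ 2 (volume.restrict (Ioo a b))) :
    inner ℂ (sineMode a b k) v = ∫ x in Ioo a b, conj (sinFun a b k x) * v x :=
  inner_toLp (memLp_sine a b k) v

theorem sinFreq_pos (hab : a < b) (k : ℕ) : 0 < sinFreq a b k :=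
  div_pos (by positivity) (sub_pos.2 hab)

theorem sinFreq_injective (hab : a < b) : Function.Injective (sinFreq a b) := fun j k h => by
  have hba : b - a ≠ 0 := sub_ne_zero.2 hab.ne'
  have hpi := Real.pi_ne_zero
  simp only [sinFreq] at h
  field_simp at h
  exact_mod_cast add_right_cancel h

theorem integral_sin_sq_sineMode_phase (hab : a < b) (k : ℕ) :
    ∫ x in Ioo a b, Real.sin ((k + 1) * Real.pi * (x - a) / (b - a)) ^ 2 = (b - a) / 2 := by
  have hsin : Real.sin ((k + 1) * Real.pi) = 0 := by exact_mod_cast Real.sin_nat_mul_pi (k + 1)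
  have hphase : ∀ x, (k + 1) * Real.pi * (x - a) / (b - a) =
      sinFreq a b k * x - sinFreq a b k * a := fun x => by rw [sinFreq]; ring
  have hend : sinFreq a b k * b - sinFreq a b k * a = (k + 1) * Real.pi := by
    rw [sinFreq, ← mul_sub, div_mul_cancel₀ _ (sub_ne_zero.2 hab.ne')]
  have hfreq := (sinFreq_pos hab k).ne'
  simp only [hphase]
  rw [← integral_Ioc_eq_integral_Ioo, ← intervalIntegral.integral_of_le hab.le,
    intervalIntegral.integral_comp_mul_sub (fun y => Real.sin y ^ 2) hfreq, hend, sub_self,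
    integral_sin_sq, hsin, Real.sin_zero, smul_eq_mul, inv_mul_eq_div, div_eq_iff hfreq, sinFreq]
  field_simp [sub_ne_zero.2 hab.ne']
  ring

theorem norm_sineMode (hab : a < b) (k : ℕ) : ‖sineMode a b k‖ = 1 := by
  have hinner : inner ℂ (sineMode a b k) (sineMode a b k) = (1 : ℂ) := by
    have hsq : ∀ᵐ x ∂volume.restrict (Ioo a b), conj (sinFun a b k x) * sineMode a b k x =
        ((2 / (b - a) * Real.sin ((k + 1) * Real.pi * (x - a) / (b - a)) ^ 2 : ℝ) : ℂ) :=
      (memLp_sine a b k).coeFn_toLp.mono fun x hx => (congrArg _ hx).trans <| by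
        rw [sinFun, Complex.conj_ofReal, ← Complex.ofReal_mul, ← sq, mul_pow,
          Real.sq_sqrt (div_pos two_pos (sub_pos.2 hab)).le]
    rw [inner_sineMode, integral_congr_ae hsq, integral_complex_ofReal, integral_const_mul,
      integral_sin_sq_sineMode_phase hab, div_mul_div_cancel₀ (sub_ne_zero.2 hab.ne'),
      div_self two_ne_zero, Complex.ofReal_one]
  rw [inner_self_eq_norm_sq_to_K] at hinner
  exact (pow_eq_one_iff_of_nonneg (norm_nonneg _) two_ne_zero).1
    (Complex.ofReal_injective (by simpa using! hinner))

theorem orthonormal_sineMode (hab : a < b) : Orthonormal ℂ (sineMode a b) := by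
  refine ⟨norm_sineMode hab, fun j k hjk => ?_⟩
  have hjk' := (hasACRep_sineMode hab k).inner_cosMode j
  have hkj := congrArg conj ((hasACRep_sineMode hab j).inner_cosMode k)
  rw [inner_smul_right] at hjk' hkj
  rw [map_mul, map_mul, Complex.conj_ofReal, Complex.conj_ofReal, inner_conj_symm,
    inner_conj_symm] at hkj
  have hfreq : (sinFreq a b j : ℂ) ^ 2 - sinFreq a b k ^ 2 ≠ 0 := by
    rw [sq_sub_sq, ← Complex.ofReal_add, ← Complex.ofReal_sub]
    exact mul_ne_zero
      (Complex.ofReal_ne_zero.2 (add_pos (sinFreq_pos hab j) (sinFreq_pos hab k)).ne')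
      (Complex.ofReal_ne_zero.2 (sub_ne_zero.2 ((sinFreq_injective hab).ne hjk)))
  refine (mul_eq_zero.1 (?_ : _ * inner ℂ (sineMode a b j) (sineMode a b k) = 0)).resolve_left hfreq
  linear_combination (sinFreq a b k : ℂ) * hkj - sinFreq a b j * hjk'

theorem eq_zero_of_inner_sineMode (hab : a < b) (h : ∀ k, inner ℂ (sineMode a b k) v = 0) :
    v = 0 := by
  refine Lp.eq_zero_iff_ae_eq_zero.2
    (ae_eq_zero_of_integral_sin_mul_eq_zero hab (Lp.memLp v) fun k => ?_)
  have hsqrt : (√(2 / (b - a)) : ℂ) ≠ 0 :=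
    Complex.ofReal_ne_zero.2 (Real.sqrt_pos.2 (div_pos two_pos (sub_pos.2 hab))).ne'
  have hk := h k
  simp only [inner_sineMode, sinFun, Complex.conj_ofReal] at hk
  simp only [Complex.ofReal_mul, mul_assoc (√(2 / (b - a)) : ℂ), integral_const_mul] at hk
  exact (mul_eq_zero.1 hk).resolve_left hsqrt

/-- The sine basis of `L²(a, b)`. -/
def sineBasis (hab : a < b) : HilbertBasis ℕ ℂ (dirichlet a b hab).L2 :=
  .mkOfOrthogonalEqBot (orthonormal_sineMode hab) <| (Submodule.eq_bot_iff _).2 fun _ hv =>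
    eq_zero_of_inner_sineMode hab fun _ =>
      Submodule.inner_right_of_mem_orthogonal (Submodule.subset_span (mem_range_self _)) hv

theorem coe_sineBasis (hab : a < b) : ⇑(sineBasis hab) = sineMode a b :=
  HilbertBasis.coe_mkOfOrthogonalEqBot ..

end Dirichlet

variable {S : Domain1D} {v w : S.L2}

theorem isH1_iff_hasACRep : S.IsH1 v w ↔ S.HasACRep v w := by
  cases S with
  | line => exact ⟨fun h => line_hasACRep_of_hasWeakDeriv h.1, fun h => ⟨h.hasWeakDeriv, trivial⟩⟩
  | dirichlet a b hab => exact ⟨fun h => h.2.hasACRep, fun h => ⟨h.hasWeakDeriv, h.isLimitOfTests⟩⟩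
  | periodic a b hab =>
    exact ⟨fun h => periodic_hasACRep_of_hasWeakDeriv h.1, fun h => ⟨h.hasWeakDeriv, trivial⟩⟩

theorem HasACRep.memH1 (h : S.HasACRep v w) : S.MemH1 v := ⟨w, isH1_iff_hasACRep.2 h⟩

theorem MemH1.hasACRep (h : S.MemH1 v) : S.HasACRep v (S.weakDeriv v) := by
  rw [weakDeriv, dif_pos h]
  exact isH1_iff_hasACRep.1 h.choose_spec

theorem HasACRep.weakDeriv_eq (h : S.HasACRep v w) : S.weakDeriv v = w :=
  h.memH1.hasACRep.unique h

end Domain1D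

section SpectralRepresentation

theorem enorm_sq_eq_lintegral {α E : Type*} [MeasurableSpace α] {μ : Measure α}
    [NormedAddCommGroup E] (v : Lp E 2 μ) : ‖v‖ₑ ^ 2 = ∫⁻ x, ‖v x‖ₑ ^ 2 ∂μ := by
  simpa [Lp.enorm_def] using eLpNorm_nnreal_pow_eq_lintegral (f := v) (μ := μ) two_ne_zero

/-- A spectral representation of a nonnegative self-adjoint operator on `H`: the unitary map `U`
turns the operator into multiplication by `symbol`. -/
structure SpectralRep (H : Type*) [NormedAddCommGroup H] [InnerProductSpace ℂ H] where
  X : Type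
  [measurableSpace : MeasurableSpace X]
  ν : Measure X
  U : H ≃ₗᵢ[ℂ] Lp ℂ 2 ν
  symbol : X → ℝ
  measurable_symbol : Measurable symbol
  symbol_nonneg : ∀ x, 0 ≤ symbol x

attribute [instance] SpectralRep.measurableSpace

namespace SpectralRep

variable {H : Type*} [NormedAddCommGroup H] [InnerProductSpace ℂ H] (L : SpectralRep H)

theorem ext_ae {v w : H} (h : ∀ᵐ x ∂L.ν, L.U v x = L.U w x) : v = w :=
  L.U.injective (Lp.ext h)

theorem norm_le_of_ae_le {v w : H} {c : ℝ} (h : ∀ᵐ x ∂L.ν, ‖L.U v x‖ ≤ c * ‖L.U w x‖) :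
    ‖v‖ ≤ c * ‖w‖ := by
  rw [← L.U.norm_map v, ← L.U.norm_map w]
  exact Lp.norm_le_mul_norm_of_ae_le_mul h

/-- The bounded operator on `H` represented by multiplication by `m`. -/
def multiplier (m : L.X → ℂ) (hm : MemLp m ∞ L.ν) : H →L[ℂ] H :=
  (L.U.symm : Lp ℂ 2 L.ν →L[ℂ] H) ∘L
    (ContinuousLinearMap.lsmul ℂ ℂ).holderL L.ν ∞ 2 2 (hm.toLp m) ∘L (L.U : H →L[ℂ] Lp ℂ 2 L.ν)

theorem U_multiplier {m : L.X → ℂ} (hm : MemLp m ∞ L.ν) (v : H) :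
    ∀ᵐ x ∂L.ν, L.U (L.multiplier m hm v) x = m x * L.U v x := by
  have hU : L.U (L.multiplier m hm v) =
      (ContinuousLinearMap.lsmul ℂ ℂ).holder 2 (hm.toLp m) (L.U v) := L.U.apply_symm_apply _
  rw [hU]
  filter_upwards [ContinuousLinearMap.coeFn_holder (r := 2) (ContinuousLinearMap.lsmul ℂ ℂ)
    (hm.toLp m) (L.U v), hm.coeFn_toLp] with x hx hmx
  rw [hx, hmx, ContinuousLinearMap.lsmul_apply, smul_eq_mul]

theorem inner_multiplier {m : L.X → ℂ} (hm : MemLp m ∞ L.ν) (hreal : ∀ x, conj (m x) = m x)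
    (v w : H) : inner ℂ (L.multiplier m hm v) w = inner ℂ v (L.multiplier m hm w) := by
  rw [← L.U.inner_map_map, ← L.U.inner_map_map, L2_inner_eq_integral, L2_inner_eq_integral]
  refine integral_congr_ae ?_
  filter_upwards [L.U_multiplier hm v, L.U_multiplier hm w] with x hv hw
  rw [hv, hw, map_mul, hreal]
  ring

/-- The quadratic form of the represented operator. -/
def energy (v : H) : ℝ≥0∞ := ∫⁻ x, ENNReal.ofReal (L.symbol x) * ‖L.U v x‖ₑ ^ 2 ∂L.ν

theorem norm_le_sqrt_mul_of_energy_le {v z : H} {c M : ℝ} (hc : 0 ≤ c) (hM : 0 ≤ M)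
    (hz : ∀ᵐ x ∂L.ν, ‖L.U z x‖ ^ 2 ≤ c * (L.symbol x * ‖L.U v x‖ ^ 2))
    (hv : L.energy v ≤ ENNReal.ofReal M ^ 2) : ‖z‖ ≤ √c * M := by
  have hpoint : ∀ᵐ x ∂L.ν,
      ‖L.U z x‖ₑ ^ 2 ≤ ENNReal.ofReal c * (ENNReal.ofReal (L.symbol x) * ‖L.U v x‖ₑ ^ 2) := by
    filter_upwards [hz] with x hx
    simp only [← ofReal_norm, ← ENNReal.ofReal_pow (norm_nonneg _),
      ← ENNReal.ofReal_mul (L.symbol_nonneg x), ← ENNReal.ofReal_mul hc]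
    exact ENNReal.ofReal_le_ofReal hx
  have hsq : ‖z‖ₑ ^ 2 ≤ ENNReal.ofReal c * ENNReal.ofReal M ^ 2 := by
    calc ‖z‖ₑ ^ 2 = ∫⁻ x, ‖L.U z x‖ₑ ^ 2 ∂L.ν := by
          rw [← L.U.enorm_map z, enorm_sq_eq_lintegral]
      _ ≤ ENNReal.ofReal c * L.energy v :=
          (lintegral_mono_ae hpoint).trans_eq (lintegral_const_mul' _ _ ENNReal.ofReal_ne_top)
      _ ≤ ENNReal.ofReal c * ENNReal.ofReal M ^ 2 := by gcongr
  rw [← ofReal_norm, ← ENNReal.ofReal_pow (norm_nonneg _), ← ENNReal.ofReal_pow hM,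
    ← ENNReal.ofReal_mul hc, ENNReal.ofReal_le_ofReal_iff (by positivity)] at hsq
  refine le_of_sq_le_sq ?_ (by positivity)
  rwa [mul_pow, Real.sq_sqrt hc]

section Flow

theorem memLp_flow (t : ℝ) :
    MemLp (fun x => Complex.exp (Complex.I * ((-t * L.symbol x : ℝ) : ℂ))) ∞ L.ν := by
  have hsymbol := L.measurable_symbol
  refine memLp_top_of_bound (Measurable.aestronglyMeasurable (by fun_prop)) 1
    (ae_of_all _ fun x => ?_)
  rw [Complex.norm_exp_I_mul_ofReal]

/-- The unitary group `exp(-itL)` generated by the represented operator `L`. -/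
def flow (t : ℝ) : H →L[ℂ] H := L.multiplier _ (L.memLp_flow t)

theorem U_flow (t : ℝ) (v : H) : ∀ᵐ x ∂L.ν,
    L.U (L.flow t v) x = Complex.exp (Complex.I * ((-t * L.symbol x : ℝ) : ℂ)) * L.U v x :=
  L.U_multiplier _ v

theorem flow_zero (v : H) : L.flow 0 v = v :=
  L.ext_ae <| (L.U_flow 0 v).mono fun x hx => by simpa using hx

theorem flow_flow (s t : ℝ) (v : H) : L.flow s (L.flow t v) = L.flow (s + t) v := by
  refine L.ext_ae ?_
  filter_upwards [L.U_flow s (L.flow t v), L.U_flow t v, L.U_flow (s + t) v] with x hs ht hst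
  rw [hs, ht, hst, ← mul_assoc, ← Complex.exp_add]
  congr 2
  push_cast
  ring

theorem flow_flow_neg (t : ℝ) (v : H) : L.flow t (L.flow (-t) v) = v := by
  rw [flow_flow, add_neg_cancel, flow_zero]

theorem norm_flow (t : ℝ) (v : H) : ‖L.flow t v‖ = ‖v‖ := by
  have hle : ∀ s w, ‖L.flow s w‖ ≤ ‖w‖ := fun s w => by
    rw [← one_mul ‖w‖]
    refine L.norm_le_of_ae_le ((L.U_flow s w).mono fun x hx => ?_)
    rw [hx, norm_mul, Complex.norm_exp_I_mul_ofReal]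
  refine (hle t v).antisymm ?_
  conv_lhs => rw [← L.flow_zero v, ← neg_add_cancel t, ← flow_flow]
  exact hle _ _

theorem norm_flow_sub_le {v : H} {M : ℝ} (hM : 0 ≤ M) (hv : L.energy v ≤ ENNReal.ofReal M ^ 2)
    (t : ℝ) : ‖L.flow t v - v‖ ≤ √(2 * |t|) * M := by
  refine L.norm_le_sqrt_mul_of_energy_le (by positivity) hM ?_ hv
  filter_upwards [L.U_flow t v, Lp.coeFn_sub (L.U (L.flow t v)) (L.U v)] with x hx hsub
  set y := -t * L.symbol x with hy
  have habs : |y| = |t| * L.symbol x := by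
    rw [hy, abs_mul, abs_neg, abs_of_nonneg (L.symbol_nonneg x)]
  have htwo : ‖Complex.exp (Complex.I * y) - 1‖ ≤ 2 := by
    refine (norm_sub_le _ _).trans_eq ?_
    rw [Complex.norm_exp_I_mul_ofReal, norm_one]
    norm_num
  have hphase : ‖Complex.exp (Complex.I * y) - 1‖ ^ 2 ≤ 2 * (|t| * L.symbol x) := by
    rw [← habs, sq]
    exact mul_le_mul htwo (Real.norm_exp_I_mul_ofReal_sub_one_le) (norm_nonneg _) zero_le_two
  calc ‖L.U (L.flow t v - v) x‖ ^ 2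
      = ‖Complex.exp (Complex.I * y) - 1‖ ^ 2 * ‖L.U v x‖ ^ 2 := by
        rw [map_sub, hsub, Pi.sub_apply, hx, ← mul_pow, ← norm_mul, sub_mul, one_mul]
    _ ≤ 2 * (|t| * L.symbol x) * ‖L.U v x‖ ^ 2 := by gcongr
    _ = 2 * |t| * (L.symbol x * ‖L.U v x‖ ^ 2) := by ring

end Flow

section Band

theorem memLp_band (N : ℕ) :
    MemLp ({x | L.symbol x ≤ N}.indicator (1 : L.X → ℂ)) ∞ L.ν := by
  refine memLp_top_of_bound (((measurable_const (a := (1 : ℂ))).indicator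
    (measurableSet_le L.measurable_symbol measurable_const)).aestronglyMeasurable) 1
    (ae_of_all _ fun x => ?_)
  exact (norm_indicator_le_norm_self _ _).trans_eq norm_one

theorem memLp_bandLap (N : ℕ) :
    MemLp ({x | L.symbol x ≤ N}.indicator fun x => (L.symbol x : ℂ)) ∞ L.ν := by
  refine memLp_top_of_bound (((Complex.measurable_ofReal.comp L.measurable_symbol).indicator
    (measurableSet_le L.measurable_symbol measurable_const)).aestronglyMeasurable) N
    (ae_of_all _ fun x => ?_)
  by_cases hx : L.symbol x ≤ N
  · rwa [indicator_of_mem (by exact hx), Complex.norm_real, Real.norm_of_nonneg (L.symbol_nonneg x)]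
  · rw [indicator_of_notMem (by exact hx), norm_zero]
    positivity

/-- The spectral projection to the part of the spectrum below `N`. -/
def band (N : ℕ) : H →L[ℂ] H := L.multiplier _ (L.memLp_band N)

/-- The represented operator, truncated to the part of the spectrum below `N`. -/
def bandLap (N : ℕ) : H →L[ℂ] H := L.multiplier _ (L.memLp_bandLap N)

theorem U_band (N : ℕ) (v : H) : ∀ᵐ x ∂L.ν,
    L.U (L.band N v) x = {x | L.symbol x ≤ N}.indicator (1 : L.X → ℂ) x * L.U v x :=
  L.U_multiplier _ v

theorem U_bandLap (N : ℕ) (v : H) : ∀ᵐ x ∂L.ν,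
    L.U (L.bandLap N v) x =
      {x | L.symbol x ≤ N}.indicator (fun x => (L.symbol x : ℂ)) x * L.U v x :=
  L.U_multiplier _ v

theorem inner_band (N : ℕ) (v w : H) : inner ℂ (L.band N v) w = inner ℂ v (L.band N w) :=
  L.inner_multiplier _ (fun x => by by_cases hx : L.symbol x ≤ N <;> simp [hx]) v w

theorem inner_bandLap (N : ℕ) (v w : H) : inner ℂ (L.bandLap N v) w = inner ℂ v (L.bandLap N w) :=
  L.inner_multiplier _ (fun x => by by_cases hx : L.symbol x ≤ N <;> simp [hx]) v w

theorem norm_band_le (N : ℕ) (v : H) : ‖L.band N v‖ ≤ ‖v‖ := by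
  rw [← one_mul ‖v‖]
  refine L.norm_le_of_ae_le ((L.U_band N v).mono fun x hx => ?_)
  rw [hx, norm_mul]
  gcongr
  exact (norm_indicator_le_norm_self _ _).trans_eq norm_one

theorem U_sub_band (N : ℕ) (v : H) : ∀ᵐ x ∂L.ν,
    L.U (v - L.band N v) x = {x | (N : ℝ) < L.symbol x}.indicator (L.U v) x := by
  filter_upwards [L.U_band N v, Lp.coeFn_sub (L.U v) (L.U (L.band N v))] with x hx hsub
  rw [map_sub, hsub, Pi.sub_apply, hx]
  by_cases hxN : L.symbol x ≤ N
  · simp [hxN]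
  · simp [hxN, not_le.1 hxN]

theorem band_band (N : ℕ) (v : H) : L.band N (L.band N v) = L.band N v := by
  refine L.ext_ae ?_
  filter_upwards [L.U_band N (L.band N v), L.U_band N v] with x hx hv
  rw [hx, hv]
  by_cases hxN : L.symbol x ≤ N <;> simp [hxN]

theorem band_comm (N N' : ℕ) (v : H) : L.band N (L.band N' v) = L.band N' (L.band N v) := by
  refine L.ext_ae ?_
  filter_upwards [L.U_band N (L.band N' v), L.U_band N' v, L.U_band N' (L.band N v),
    L.U_band N v] with x h₁ h₂ h₃ h₄
  rw [h₁, h₂, h₃, h₄, mul_left_comm]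

theorem bandLap_band (N : ℕ) (v : H) : L.bandLap N (L.band N v) = L.bandLap N v := by
  refine L.ext_ae ?_
  filter_upwards [L.U_bandLap N (L.band N v), L.U_band N v, L.U_bandLap N v] with x hx hv hw
  rw [hx, hv, hw]
  by_cases hxN : L.symbol x ≤ N <;> simp [hxN]

theorem band_bandLap (N : ℕ) (v : H) : L.band N (L.bandLap N v) = L.bandLap N v := by
  refine L.ext_ae ?_
  filter_upwards [L.U_band N (L.bandLap N v), L.U_bandLap N v] with x hx hv
  rw [hx, hv]
  by_cases hxN : L.symbol x ≤ N <;> simp [hxN]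

theorem band_flow (N : ℕ) (t : ℝ) (v : H) : L.band N (L.flow t v) = L.flow t (L.band N v) := by
  refine L.ext_ae ?_
  filter_upwards [L.U_band N (L.flow t v), L.U_flow t (L.band N v), L.U_band N v, L.U_flow t v]
    with x h₁ h₂ h₃ h₄
  rw [h₁, h₂, h₃, h₄]
  ring

theorem norm_sub_band_le {v : H} {M : ℝ} (hM : 0 ≤ M) (hv : L.energy v ≤ ENNReal.ofReal M ^ 2)
    (N : ℕ) : ‖v - L.band (N + 1) v‖ ≤ √(1 / ((N : ℝ) + 1)) * M := by
  refine L.norm_le_sqrt_mul_of_energy_le (by positivity) hM ?_ hv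
  filter_upwards [L.U_sub_band (N + 1) v] with x hx
  have hsymbol := L.symbol_nonneg x
  rw [hx]
  by_cases hxN : ((N + 1 : ℕ) : ℝ) < L.symbol x
  · rw [indicator_of_mem (by exact hxN), ← mul_assoc]
    refine le_mul_of_one_le_left (sq_nonneg _) ?_
    rw [one_div_mul_eq_div, one_le_div (by positivity)]
    exact_mod_cast hxN.le
  · rw [indicator_of_notMem (by exact hxN), norm_zero, zero_pow two_ne_zero]
    positivity

theorem tendsto_band (v : H) : Tendsto (fun N => L.band N v) atTop (𝓝 v) := by
  have hlim : Tendsto (fun N => ‖v - L.band N v‖ₑ ^ 2) atTop (𝓝 0) := by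
    simp_rw [← L.U.enorm_map, enorm_sq_eq_lintegral]
    rw [← lintegral_zero (μ := L.ν)]
    refine tendsto_lintegral_of_dominated_convergence' (fun x => ‖L.U v x‖ₑ ^ 2)
      (fun N => (Lp.aestronglyMeasurable _).enorm.pow_const 2) (fun N => ?_) ?_ ?_
    · filter_upwards [L.U_sub_band N v] with x hx
      rw [hx]
      gcongr
      exact enorm_indicator_le_enorm_self _ _
    · rw [← enorm_sq_eq_lintegral]
      finiteness
    · filter_upwards [ae_all_iff.2 fun N => L.U_sub_band N v] with x hx
      obtain ⟨N₀, hN₀⟩ := exists_nat_ge (L.symbol x)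
      refine tendsto_const_nhds.congr' (eventually_atTop.2 ⟨N₀, fun N hN => ?_⟩)
      have hxN : L.symbol x ≤ N := hN₀.trans (mod_cast hN)
      dsimp only
      rw [hx, indicator_of_notMem (by exact hxN.not_gt), enorm_zero, zero_pow two_ne_zero]
  have hnorm : Tendsto (fun N => √((‖v - L.band N v‖ₑ ^ 2).toReal)) atTop (𝓝 √0) :=
    (Real.continuous_sqrt.tendsto 0).comp
      ((ENNReal.tendsto_toReal ENNReal.zero_ne_top).comp hlim)
  rw [tendsto_iff_norm_sub_tendsto_zero]
  simpa [norm_sub_rev] using hnorm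

end Band

theorem U_flow_sub_flow_add (N : ℕ) (s t : ℝ) (v : H) : ∀ᵐ x ∂L.ν,
    L.U (L.flow s (L.band N v) - L.flow t (L.band N v) +
        ((s - t : ℝ) * Complex.I) • L.flow t (L.bandLap N v)) x =
      {x | L.symbol x ≤ N}.indicator
        (fun x => Complex.exp (Complex.I * ((-t * L.symbol x : ℝ) : ℂ)) *
          (Complex.exp (Complex.I * ((-(s - t) * L.symbol x : ℝ) : ℂ)) - 1
            - Complex.I * ((-(s - t) * L.symbol x : ℝ) : ℂ))) x * L.U v x := by
  simp only [map_add, map_sub, map_smul]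
  filter_upwards [L.U_flow s (L.band N v), L.U_flow t (L.band N v), L.U_flow t (L.bandLap N v),
    L.U_band N v, L.U_bandLap N v,
    Lp.coeFn_add (L.U (L.flow s (L.band N v)) - L.U (L.flow t (L.band N v)))
      (((s - t : ℝ) * Complex.I) • L.U (L.flow t (L.bandLap N v))),
    Lp.coeFn_sub (L.U (L.flow s (L.band N v))) (L.U (L.flow t (L.band N v))),
    Lp.coeFn_smul ((s - t : ℝ) * Complex.I) (L.U (L.flow t (L.bandLap N v)))]
    with x hs ht htlap hband hlap hadd hsub hsmul
  rw [hadd, Pi.add_apply, hsub, Pi.sub_apply, hsmul, Pi.smul_apply, hs, ht, htlap, hband, hlap]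
  have hexp : Complex.exp (Complex.I * ((-s * L.symbol x : ℝ) : ℂ)) =
      Complex.exp (Complex.I * ((-t * L.symbol x : ℝ) : ℂ)) *
        Complex.exp (Complex.I * ((-(s - t) * L.symbol x : ℝ) : ℂ)) := by
    rw [← Complex.exp_add]
    congr 1
    push_cast
    ring
  by_cases hxN : L.symbol x ≤ N
  · rw [indicator_of_mem (by exact hxN), indicator_of_mem (by exact hxN),
      indicator_of_mem (by exact hxN), hexp, Pi.one_apply, smul_eq_mul]
    push_cast
    ring
  · simp [hxN]

theorem norm_flow_sub_flow_add_le (N : ℕ) (s t : ℝ) (v : H) :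
    ‖L.flow s (L.band N v) - L.flow t (L.band N v) +
      ((s - t : ℝ) * Complex.I) • L.flow t (L.bandLap N v)‖ ≤ 2 * (N * (s - t)) ^ 2 * ‖v‖ := by
  refine L.norm_le_of_ae_le ((L.U_flow_sub_flow_add N s t v).mono fun x hx => ?_)
  rw [hx, norm_mul]
  gcongr
  by_cases hxN : L.symbol x ≤ N
  · rw [indicator_of_mem (by exact hxN), norm_mul, Complex.norm_exp_I_mul_ofReal, one_mul]
    refine (norm_exp_I_mul_sub_one_sub_le _).trans ?_
    rw [neg_mul, neg_sq, mul_pow, mul_pow, mul_comm ((N : ℝ) ^ 2)]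
    have := L.symbol_nonneg x
    gcongr
  · rw [indicator_of_notMem (by exact hxN), norm_zero]
    positivity

theorem hasDerivAt_flow_comp_band (N : ℕ) (t : ℝ) :
    HasDerivAt (fun s => L.flow s ∘L L.band N) (-Complex.I • L.flow t ∘L L.bandLap N) t := by
  rw [hasDerivAt_iff_isLittleO]
  refine Asymptotics.IsBigO.trans_isLittleO (g := fun s => (s - t) ^ 2) ?_ ?_
  · refine Asymptotics.IsBigO.of_bound (2 * (N : ℝ) ^ 2) (Eventually.of_forall fun s => ?_)
    refine ContinuousLinearMap.opNorm_le_bound _ (by positivity) fun v => ?_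
    rw [Real.norm_of_nonneg (sq_nonneg _), mul_assoc 2, ← mul_pow]
    refine (congrArg norm ?_).trans_le (L.norm_flow_sub_flow_add_le N s t v)
    simp only [neg_smul, smul_neg, sub_neg_eq_add, mul_smul, Complex.coe_smul]
    rfl
  · have hsq := (Asymptotics.isLittleO_pow_pow (𝕜 := ℝ) one_lt_two).comp_tendsto
      (tendsto_sub_nhds_zero_iff.2 (tendsto_id (x := 𝓝 t)))
    simpa [Function.comp_def] using hsq

end SpectralRep

end SpectralRepresentation

section HilbertBasis

variable {ι : Type} [Countable ι] [MeasurableSpace ι] [DiscreteMeasurableSpace ι]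

theorem inner_indicatorConstLp_singleton (k : ι) (f : Lp ℂ 2 (Measure.count : Measure ι)) :
    inner ℂ (indicatorConstLp 2 (measurableSet_singleton k) (by simp) (1 : ℂ)) f = f k := by
  rw [L2.inner_indicatorConstLp_one, integral_singleton]
  simp

theorem indicatorConstLp_singleton_apply (j k : ι) :
    indicatorConstLp 2 (μ := Measure.count) (measurableSet_singleton k) (by simp) (1 : ℂ) j =
      ({k} : Set ι).indicator 1 j :=
  Measure.ae_count_iff.1 indicatorConstLp_coeFn j

/-- The indicators of the points form a basis of `L²` of the counting measure, which identifies
this space with `ℓ²`. -/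
def countBasis (ι : Type) [Countable ι] [MeasurableSpace ι] [DiscreteMeasurableSpace ι] :
    HilbertBasis ι ℂ (Lp ℂ 2 (Measure.count : Measure ι)) :=
  .mkOfOrthogonalEqBot
    (v := fun k => indicatorConstLp 2 (measurableSet_singleton k) (by simp) (1 : ℂ))
    (by
      classical
      refine orthonormal_iff_ite.2 fun j k => ?_
      rw [inner_indicatorConstLp_singleton, indicatorConstLp_singleton_apply, indicator_apply]
      rfl)
    ((Submodule.eq_bot_iff _).2 fun f hf => Lp.ext <| .of_forall fun k => by
      rw [← inner_indicatorConstLp_singleton, Submodule.inner_right_of_mem_orthogonal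
        (Submodule.subset_span (mem_range_self k)) hf, Measure.ae_count_iff.1 (Lp.coeFn_zero ..) k,
        Pi.zero_apply])

variable {H : Type*} [NormedAddCommGroup H] [InnerProductSpace ℂ H] (e : HilbertBasis ι ℂ H)
  {lam : ι → ℝ} (hlam : ∀ k, 0 ≤ lam k)

namespace SpectralRep

/-- The operator with eigenvalues `lam` on the basis `e`. -/
def ofHilbertBasis : SpectralRep H where
  X := ι
  ν := Measure.count
  U := e.repr.trans (countBasis ι).repr.symm
  symbol := lam
  measurable_symbol := .of_discrete
  symbol_nonneg := hlam

theorem U_ofHilbertBasis (v : H) (k : ι) : (ofHilbertBasis e hlam).U v k = inner ℂ (e k) v := by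
  rw [← e.repr_apply_apply, ← (countBasis ι).repr.apply_symm_apply (e.repr v),
    (countBasis ι).repr_apply_apply, countBasis, HilbertBasis.coe_mkOfOrthogonalEqBot,
    inner_indicatorConstLp_singleton]
  rfl

theorem inner_flow_ofHilbertBasis (t : ℝ) (v : H) (k : ι) :
    inner ℂ (e k) ((ofHilbertBasis e hlam).flow t v) =
      Complex.exp (Complex.I * ((-t * lam k : ℝ) : ℂ)) * inner ℂ (e k) v := by
  rw [← U_ofHilbertBasis e hlam, ← U_ofHilbertBasis e hlam]
  exact Measure.ae_count_iff.1 ((ofHilbertBasis e hlam).U_flow t v) k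

theorem inner_band_ofHilbertBasis (N : ℕ) (v : H) (k : ι) :
    inner ℂ (e k) ((ofHilbertBasis e hlam).band N v) =
      {k | lam k ≤ N}.indicator 1 k * inner ℂ (e k) v := by
  rw [← U_ofHilbertBasis e hlam, ← U_ofHilbertBasis e hlam]
  exact Measure.ae_count_iff.1 ((ofHilbertBasis e hlam).U_band N v) k

theorem inner_bandLap_ofHilbertBasis (N : ℕ) (v : H) (k : ι) :
    inner ℂ (e k) ((ofHilbertBasis e hlam).bandLap N v) =
      {k | lam k ≤ N}.indicator (fun k => (lam k : ℂ)) k * inner ℂ (e k) v := by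
  rw [← U_ofHilbertBasis e hlam, ← U_ofHilbertBasis e hlam]
  exact Measure.ae_count_iff.1 ((ofHilbertBasis e hlam).U_bandLap N v) k

theorem flow_ofHilbertBasis (t : ℝ) (v : H) : (ofHilbertBasis e hlam).flow t v =
    ∑' k, Complex.exp (Complex.I * ((-t * lam k : ℝ) : ℂ)) • (inner ℂ (e k) v • e k) := by
  rw [← (e.hasSum_repr ((ofHilbertBasis e hlam).flow t v)).tsum_eq]
  simp only [e.repr_apply_apply, inner_flow_ofHilbertBasis, mul_smul]

theorem energy_ofHilbertBasis (v : H) : (ofHilbertBasis e hlam).energy v =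
    ∑' k, ENNReal.ofReal (lam k) * ‖inner ℂ (e k) v‖ₑ ^ 2 := by
  refine (lintegral_count (α := ι) _).trans (tsum_congr fun k => ?_)
  rw [U_ofHilbertBasis]
  rfl

end SpectralRep

theorem eq_sum_smul_of_inner_eq_indicator {ι : Type*} (e : HilbertBasis ι ℂ H) {v : H} {c : ι → ℂ}
    (s : Finset ι) (h : ∀ k, inner ℂ (e k) v = (s : Set ι).indicator c k) :
    v = ∑ k ∈ s, c k • e k := by
  rw [← (e.hasSum_repr v).tsum_eq]
  simp only [e.repr_apply_apply, h]
  rw [tsum_eq_sum (s := s) fun k hk => by rw [indicator_of_notMem (by simpa using hk), zero_smul]]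
  exact Finset.sum_congr rfl fun k hk => by rw [indicator_of_mem (by simpa using hk)]

end HilbertBasis

namespace Domain1D

/-- `L` diagonalizes `-Δ` with the boundary condition of `S`. -/
structure IsLaplacianRep (S : Domain1D) (L : SpectralRep S.L2) : Prop where
  flowA_eq : ∀ t v, flowA S t v = L.flow t v
  energy_le : ∀ {v w}, S.HasACRep v w → L.energy v ≤ ‖w‖ₑ ^ 2
  exists_hasACRep_band : ∀ N φ, ∃ d, S.HasACRep (L.band N φ) d ∧
    ∀ {v w}, S.HasACRep v w → inner ℂ d w = inner ℂ (L.bandLap N φ) v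

/-- `e` is an eigenbasis of `-Δ` with the boundary condition of `S`, `d` being the derivatives of
the eigenfunctions and `lam` the eigenvalues. -/
structure IsEigenbasis (S : Domain1D) {ι : Type*} (e : HilbertBasis ι ℂ S.L2) (d : ι → S.L2)
    (lam : ι → ℝ) : Prop where
  eigenvalue_nonneg : ∀ k, 0 ≤ lam k
  finite_setOf_eigenvalue_le : ∀ N : ℕ, {k | lam k ≤ N}.Finite
  hasACRep : ∀ k, S.HasACRep (e k) (d k)
  inner_deriv : ∀ {v w}, S.HasACRep v w → ∀ k, inner ℂ (d k) w = lam k * inner ℂ (e k) v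
  flowA_eq : ∀ t v, flowA S t v =
    ∑' k, Complex.exp (Complex.I * ((-t * lam k : ℝ) : ℂ)) • (inner ℂ (e k) v • e k)

namespace IsEigenbasis

variable {S : Domain1D} {ι : Type*} {e : HilbertBasis ι ℂ S.L2} {d : ι → S.L2} {lam : ι → ℝ}

theorem inner_sum_smul_deriv (h : S.IsEigenbasis e d lam) {v w : S.L2} (hv : S.HasACRep v w)
    (s : Finset ι) (c : ι → ℂ) :
    inner ℂ (∑ k ∈ s, c k • d k) w = ∑ k ∈ s, conj (c k) * (lam k * inner ℂ (e k) v) := by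
  simp only [sum_inner, inner_smul_left, h.inner_deriv hv]

theorem sum_eigenvalue_mul_norm_sq_le (h : S.IsEigenbasis e d lam) {v w : S.L2}
    (hv : S.HasACRep v w) (s : Finset ι) : ∑ k ∈ s, lam k * ‖inner ℂ (e k) v‖ ^ 2 ≤ ‖w‖ ^ 2 := by
  set c : ι → ℂ := fun k => inner ℂ (e k) v
  set P := ∑ k ∈ s, c k • d k
  have hsum : ∑ k ∈ s, conj (c k) * (lam k * c k) = ((∑ k ∈ s, lam k * ‖c k‖ ^ 2 : ℝ) : ℂ) := by
    push_cast
    refine Finset.sum_congr rfl fun k _ => ?_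
    rw [mul_left_comm, ← Complex.conj_mul']
  have hPw : inner ℂ P w = ((∑ k ∈ s, lam k * ‖c k‖ ^ 2 : ℝ) : ℂ) :=
    (h.inner_sum_smul_deriv hv s c).trans hsum
  have hPP : inner ℂ P P = ((∑ k ∈ s, lam k * ‖c k‖ ^ 2 : ℝ) : ℂ) := by
    rw [h.inner_sum_smul_deriv (HasACRep.sum_smul h.hasACRep s c), ← hsum]
    exact Finset.sum_congr rfl fun k hk => by rw [e.orthonormal.inner_right_sum c hk]
  have hnorm : ‖P‖ ^ 2 = ∑ k ∈ s, lam k * ‖c k‖ ^ 2 := by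
    rw [inner_self_eq_norm_sq_to_K] at hPP
    exact Complex.ofReal_injective ((Complex.ofReal_pow _ _).trans hPP)
  have hle : ‖P‖ ^ 2 ≤ ‖P‖ * ‖w‖ := by
    have := norm_inner_le_norm (𝕜 := ℂ) P w
    rwa [hPw, ← hnorm, Complex.norm_real, Real.norm_of_nonneg (sq_nonneg _)] at this
  rw [← hnorm]
  exact pow_le_pow_left₀ (norm_nonneg _) (by nlinarith [norm_nonneg P, norm_nonneg w]) 2

variable {ι : Type} [Countable ι] [MeasurableSpace ι] [DiscreteMeasurableSpace ι]
  {e : HilbertBasis ι ℂ S.L2} {d : ι → S.L2} {lam : ι → ℝ}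

theorem isLaplacianRep (h : S.IsEigenbasis e d lam) :
    S.IsLaplacianRep (.ofHilbertBasis e h.eigenvalue_nonneg) where
  flowA_eq t v := by rw [h.flowA_eq, SpectralRep.flow_ofHilbertBasis]
  energy_le {v w} hv := by
    rw [SpectralRep.energy_ofHilbertBasis, ENNReal.tsum_eq_iSup_sum]
    refine iSup_le fun s => ?_
    have hle := ENNReal.ofReal_le_ofReal (h.sum_eigenvalue_mul_norm_sq_le hv s)
    have hnonneg := h.eigenvalue_nonneg
    rw [ENNReal.ofReal_sum_of_nonneg fun k _ => by have := hnonneg k; positivity] at hle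
    simpa only [ENNReal.ofReal_mul (hnonneg _), ENNReal.ofReal_pow (norm_nonneg _), ofReal_norm]
      using hle
  exists_hasACRep_band N φ := by
    set L := SpectralRep.ofHilbertBasis e h.eigenvalue_nonneg
    set s := (h.finite_setOf_eigenvalue_le N).toFinset
    set c : ι → ℂ := fun k => inner ℂ (e k) φ
    have hs : ∀ k, k ∈ (s : Set ι) ↔ lam k ≤ N := fun k => by simp [s]
    have hband : L.band N φ = ∑ k ∈ s, c k • e k := by
      refine eq_sum_smul_of_inner_eq_indicator e s fun k => ?_
      rw [SpectralRep.inner_band_ofHilbertBasis]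
      by_cases hk : lam k ≤ N <;> simp [hs, hk, c]
    have hbandLap : L.bandLap N φ = ∑ k ∈ s, (lam k * c k) • e k := by
      refine eq_sum_smul_of_inner_eq_indicator e s fun k => ?_
      rw [SpectralRep.inner_bandLap_ofHilbertBasis]
      by_cases hk : lam k ≤ N <;> simp [hs, hk, c]
    refine ⟨∑ k ∈ s, c k • d k, hband ▸ HasACRep.sum_smul h.hasACRep s c, fun {v w} hv => ?_⟩
    rw [h.inner_sum_smul_deriv hv, hbandLap, sum_inner]
    refine Finset.sum_congr rfl fun k _ => ?_
    rw [inner_smul_left, map_mul, Complex.conj_ofReal]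
    ring

end IsEigenbasis

variable {a b : ℝ}

theorem isEigenbasis_expBasis (hab : a < b) : (periodic a b hab).IsEigenbasis (expBasis hab)
    (fun k => (Complex.I * expFreq a b k) • expBasis hab k) fun k => expFreq a b k ^ 2 where
  eigenvalue_nonneg k := sq_nonneg _
  finite_setOf_eigenvalue_le N := by
    have hfin := finite_setOf_intCast_mul_sq_le
      (div_pos Real.two_pi_pos (sub_pos.2 hab)) N
    simpa only [expFreq, mul_div_right_comm] using hfin
  hasACRep k := by
    rw [coe_expBasis]
    exact hasACRep_expMode hab k
  inner_deriv {v w} h k := by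
    rw [coe_expBasis]
    refine (inner_smul_left (expMode a b k) w _).trans ?_
    rw [h.hasWeakDeriv.inner_expMode k, ← mul_assoc, Complex.conj_mul', norm_mul, Complex.norm_I,
      one_mul, Complex.norm_real, ← Complex.ofReal_pow, Real.norm_eq_abs, sq_abs]
    rfl
  flowA_eq t v := by
    rw [coe_expBasis]
    rfl

theorem isEigenbasis_sineBasis (hab : a < b) : (dirichlet a b hab).IsEigenbasis (sineBasis hab)
    (fun k => ((sinFreq a b k : ℂ) • cosMode a b k : Lp ℂ 2 (volume.restrict (Ioo a b))))
    fun k => sinFreq a b k ^ 2 where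
  eigenvalue_nonneg k := sq_nonneg _
  finite_setOf_eigenvalue_le N := by
    have hfin := (finite_setOf_intCast_mul_sq_le (div_pos Real.pi_pos (sub_pos.2 hab)) N).preimage
      (f := fun k : ℕ => (k : ℤ) + 1) (fun _ _ _ _ h => by simpa using h)
    refine hfin.subset fun k hk => ?_
    change sinFreq a b k ^ 2 ≤ N at hk
    rw [sinFreq, mul_comm, mul_div_right_comm] at hk
    simpa using hk
  hasACRep k := by
    rw [coe_sineBasis]
    exact hasACRep_sineMode hab k
  inner_deriv {v w} h k := by
    rw [coe_sineBasis]
    refine (inner_smul_left (cosMode a b k) w _).trans ?_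
    rw [h.inner_cosMode k, Complex.conj_ofReal, Complex.ofReal_pow, sq, mul_assoc]
    rfl
  flowA_eq t v := by
    rw [coe_sineBasis]
    rfl

section Line

/-- `L²(ℝ)`, on which Mathlib's Fourier transform is defined. -/
abbrev LineL2 : Type := Lp ℂ 2 (volume : Measure ℝ)

variable {v w : LineL2}

theorem fourier_derivCLM (ψ : SchwartzMap ℝ ℂ) (ξ : ℝ) :
    𝓕 (SchwartzMap.derivCLM ℂ ℂ ψ) ξ = 2 * Real.pi * Complex.I * ξ * 𝓕 ψ ξ :=
  congrFun (Real.fourier_deriv ψ.integrable ψ.differentiable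
    (SchwartzMap.derivCLM ℂ ℂ ψ).integrable) ξ

theorem inner_schwartz_eq_integral_fourier (ψ : SchwartzMap ℝ ℂ) (v : LineL2) :
    inner ℂ (ψ.toLp 2) v = ∫ ξ, conj (𝓕 ψ ξ) * (𝓕 v : LineL2) ξ := by
  rw [← Lp.inner_fourier_eq, SchwartzMap.toLp_fourier_eq]
  exact inner_toLp ((𝓕 ψ).memLp 2 volume) _

theorem HasACRep.inner_schwartz (h : line.HasACRep v w) (ψ : SchwartzMap ℝ ℂ) :
    inner ℂ (ψ.toLp 2) w = -inner ℂ ((SchwartzMap.derivCLM ℂ ℂ ψ).toLp 2) v :=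
  h.inner_eq_neg_inner (.of_hasDerivAt (fun _ => ψ.differentiableAt.hasDerivAt)
    (SchwartzMap.derivCLM ℂ ℂ ψ).continuous (ψ.coeFn_toLp 2 volume)
    ((SchwartzMap.derivCLM ℂ ℂ ψ).coeFn_toLp 2 volume) trivial)

theorem HasACRep.fourier_ae_eq (h : line.HasACRep v w) :
    ∀ᵐ ξ, (𝓕 w : LineL2) ξ =
      2 * Real.pi * Complex.I * ξ * (𝓕 v : LineL2) ξ := by
  have hloc : ∀ z : LineL2, LocallyIntegrable z volume := fun z =>
    (Lp.memLp z).locallyIntegrable one_le_two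
  set f : LineL2 := 𝓕 v with hfv
  set g : LineL2 := 𝓕 w with hgw
  have hf : LocallyIntegrable (fun ξ : ℝ => (2 * Real.pi * Complex.I * ξ) * f ξ) volume :=
    (hloc f).continuous_smul (g := fun ξ : ℝ => (2 * Real.pi * Complex.I * ξ : ℂ)) (by fun_prop)
  refine (ae_eq_zero_of_integral_contDiff_smul_eq_zero ((hloc g).sub hf) fun η hη hηc => ?_).mono
    fun ξ hξ => sub_eq_zero.1 hξ
  have hηC : HasCompactSupport fun ξ => (η ξ : ℂ) := hηc.comp_left Complex.ofReal_zero
  set ψ : SchwartzMap ℝ ℂ := 𝓕⁻ (hηC.toSchwartzMap (Complex.ofRealCLM.contDiff.comp hη))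
  have hψ : ∀ ξ, 𝓕 ψ ξ = (η ξ : ℂ) := fun ξ => by
    simp only [ψ, FourierTransform.fourier_fourierInv_eq]
    rfl
  have hparts := h.inner_schwartz ψ
  rw [inner_schwartz_eq_integral_fourier, inner_schwartz_eq_integral_fourier, ← integral_neg]
    at hparts
  simp only [fourier_derivCLM, hψ] at hparts
  calc ∫ ξ, η ξ • (g ξ - 2 * Real.pi * Complex.I * ξ * f ξ)
      = (∫ ξ, η ξ • g ξ) - ∫ ξ, η ξ • (2 * Real.pi * Complex.I * ξ * f ξ) := by
        simp only [smul_sub]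
        exact integral_sub ((hloc g).integrable_smul_left_of_hasCompactSupport hη.continuous hηc)
          (hf.integrable_smul_left_of_hasCompactSupport hη.continuous hηc)
    _ = 0 := by
        refine sub_eq_zero.2 (Eq.trans ?_ (hparts.trans ?_))
        · simp only [Complex.conj_ofReal, Complex.real_smul, hgw]
        · refine integral_congr_ae (.of_forall fun ξ => ?_)
          simp only [map_mul, Complex.conj_ofReal, Complex.conj_I, map_ofNat,
            Complex.real_smul, hfv]
          ring

theorem hasACRep_of_fourier_ae_eq (h : ∀ᵐ ξ, (𝓕 w : LineL2) ξ =
    2 * Real.pi * Complex.I * ξ * (𝓕 v : LineL2) ξ) : line.HasACRep v w := by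
  refine line_hasACRep_of_hasWeakDeriv fun φ ⟨hφ, hφc⟩ => ?_
  set ψ : SchwartzMap ℝ ℂ := (hφc.comp_left (map_zero conj)).toSchwartzMap
    (Complex.conjCLE.contDiff.comp hφ)
  have hψ : ∀ x, conj (ψ x) = φ x := fun x => Complex.conj_conj _
  have hψ' : ∀ x, conj (SchwartzMap.derivCLM ℂ ℂ ψ x) = deriv φ x := fun x => by
    have hd : HasDerivAt ψ (conj (deriv φ x)) x :=
      (hφ.differentiable (by simp) x).hasDerivAt.star
    rw [SchwartzMap.derivCLM_apply, hd.deriv, Complex.conj_conj]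
  have hinner : ∀ (f : SchwartzMap ℝ ℂ) (u : LineL2),
      ∫ x, u x * conj (f x) = ∫ ξ, conj (𝓕 f ξ) * (𝓕 u : LineL2) ξ :=
    fun f u => by
      simp only [mul_comm (u _)]
      rw [← inner_schwartz_eq_integral_fourier]
      exact (inner_toLp (f.memLp 2 volume) u).symm
  change ∫ x, v x * deriv φ x = -∫ x, w x * φ x
  simp only [← hψ', ← hψ]
  rw [hinner, hinner, ← integral_neg]
  refine integral_congr_ae (h.mono fun ξ hξ => ?_)
  simp only [hξ, fourier_derivCLM, map_mul, Complex.conj_ofReal, Complex.conj_I, map_ofNat]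
  ring

/-- The Fourier transform diagonalizes `-Δ` on the line. -/
def lineRep : SpectralRep LineL2 where
  X := ℝ
  ν := volume
  U := Lp.fourierTransformₗᵢ ℝ ℂ
  symbol ξ := (2 * Real.pi * ξ) ^ 2
  measurable_symbol := by fun_prop
  symbol_nonneg ξ := sq_nonneg _

theorem lineFlow_eq_flow (t : ℝ) (v : LineL2) : lineFlow t v = lineRep.flow t v := by
  have hU : lineRep.U (lineFlow t v) = phaseMul (fun ξ => -t * (2 * Real.pi * ξ) ^ 2)
      (Continuous.aestronglyMeasurable (by fun_prop)) (𝓕 v : LineL2) :=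
    (Lp.fourierTransformₗᵢ ℝ ℂ).apply_symm_apply _
  refine lineRep.ext_ae ?_
  rw [hU]
  exact (coeFn_phaseMul _ _ _).trans (EventuallyEq.symm (lineRep.U_flow t v))

theorem HasACRep.energy_lineRep (h : line.HasACRep v w) : lineRep.energy v = ‖w‖ₑ ^ 2 := by
  rw [← lineRep.U.enorm_map, enorm_sq_eq_lintegral]
  refine lintegral_congr_ae (h.fourier_ae_eq.mono fun ξ hξ => ?_)
  have hsymbol : ‖(2 * Real.pi * Complex.I * ξ : ℂ)‖ ^ 2 = (2 * Real.pi * ξ) ^ 2 := by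
    simp [mul_pow, abs_of_pos Real.pi_pos]
  change ENNReal.ofReal ((2 * Real.pi * ξ) ^ 2) * ‖(𝓕 v : LineL2) ξ‖ₑ ^ 2 =
    ‖(𝓕 w : LineL2) ξ‖ₑ ^ 2
  rw [hξ, enorm_mul, mul_pow ‖_‖ₑ, ← hsymbol, ENNReal.ofReal_pow (norm_nonneg _), ofReal_norm]

theorem fourier_band (N : ℕ) (v : LineL2) : ∀ᵐ ξ : ℝ, (𝓕 (lineRep.band N v) : LineL2) ξ =
    if (2 * Real.pi * ξ) ^ 2 ≤ N then (𝓕 v : LineL2) ξ else 0 := by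
  refine (lineRep.U_band N v).mono fun (ξ : ℝ) hξ => hξ.trans ?_
  change {ξ : ℝ | (2 * Real.pi * ξ) ^ 2 ≤ N}.indicator (1 : ℝ → ℂ) ξ * (𝓕 v : LineL2) ξ = _
  rw [indicator_apply, ite_mul, Pi.one_apply, one_mul, zero_mul]
  rfl

theorem fourier_bandLap (N : ℕ) (v : LineL2) : ∀ᵐ ξ : ℝ, (𝓕 (lineRep.bandLap N v) : LineL2) ξ =
    if (2 * Real.pi * ξ) ^ 2 ≤ N then ((2 * Real.pi * ξ) ^ 2 : ℝ) * (𝓕 v : LineL2) ξ else 0 := by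
  refine (lineRep.U_bandLap N v).mono fun (ξ : ℝ) hξ => hξ.trans ?_
  change {ξ : ℝ | (2 * Real.pi * ξ) ^ 2 ≤ N}.indicator
    (fun ξ : ℝ => (((2 * Real.pi * ξ) ^ 2 : ℝ) : ℂ)) ξ * (𝓕 v : LineL2) ξ = _
  rw [indicator_apply, ite_mul, zero_mul]
  rfl

theorem exists_fourier_eq_deriv_band (N : ℕ) (v : LineL2) : ∃ d : LineL2,
    ∀ᵐ ξ : ℝ, (𝓕 d : LineL2) ξ =
      if (2 * Real.pi * ξ) ^ 2 ≤ N then 2 * Real.pi * Complex.I * ξ * (𝓕 v : LineL2) ξ else 0 := by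
  set m : ℝ → ℂ :=
    {ξ : ℝ | (2 * Real.pi * ξ) ^ 2 ≤ N}.indicator fun ξ => 2 * Real.pi * Complex.I * ξ
  have hm : MemLp m ∞ (volume : Measure ℝ) := by
    refine memLp_top_of_bound (Measurable.aestronglyMeasurable
      (Measurable.indicator (by fun_prop) (measurableSet_le (by fun_prop) measurable_const))) √N
      (ae_of_all _ fun ξ : ℝ => ?_)
    by_cases hξ : (2 * Real.pi * ξ) ^ 2 ≤ N
    · refine (congrArg norm (indicator_of_mem (by exact hξ) _)).trans_le ?_
      refine Real.le_sqrt_of_sq_le (hξ.trans_eq' ?_)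
      simp [mul_pow]
    · refine (congrArg norm (indicator_of_notMem (by exact hξ) _)).trans_le ?_
      rw [norm_zero]
      positivity
  refine ⟨lineRep.multiplier m hm v,
    (lineRep.U_multiplier hm v).mono fun (ξ : ℝ) hξ => hξ.trans ?_⟩
  change m ξ * (𝓕 v : LineL2) ξ = _
  simp only [m, indicator_apply, ite_mul, zero_mul]
  rfl

theorem lineRep_exists_hasACRep_band (N : ℕ) (φ : LineL2) :
    ∃ d : LineL2, line.HasACRep (lineRep.band N φ) d ∧
      ∀ {v w : LineL2}, line.HasACRep v w → inner ℂ d w = inner ℂ (lineRep.bandLap N φ) v := by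
  obtain ⟨d, hd⟩ := exists_fourier_eq_deriv_band N φ
  refine ⟨d, hasACRep_of_fourier_ae_eq ?_, fun {v w} h => ?_⟩
  · filter_upwards [hd, fourier_band N φ] with ξ hd hband
    rw [hd, hband, mul_ite, mul_zero]
  · rw [← Lp.inner_fourier_eq, ← Lp.inner_fourier_eq (lineRep.bandLap N φ), L2_inner_eq_integral,
      L2_inner_eq_integral]
    refine integral_congr_ae ?_
    filter_upwards [hd, fourier_bandLap N φ, h.fourier_ae_eq] with ξ hd hlap hξ
    rw [hd, hlap, hξ]
    split_ifs
    · simp only [map_mul, Complex.conj_ofReal, Complex.conj_I, map_ofNat]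
      push_cast
      linear_combination (-4 * Real.pi ^ 2 * ξ ^ 2 * conj ((𝓕 φ : LineL2) ξ) *
        (𝓕 v : LineL2) ξ) * Complex.I_sq
    · simp only [map_zero, zero_mul]

theorem isLaplacianRep_lineRep : line.IsLaplacianRep lineRep where
  flowA_eq := lineFlow_eq_flow
  energy_le h := h.energy_lineRep.le
  exists_hasACRep_band := lineRep_exists_hasACRep_band

end Line

theorem exists_isLaplacianRep (S : Domain1D) : ∃ L : SpectralRep S.L2, S.IsLaplacianRep L := by
  cases S with
  | line => exact ⟨lineRep, isLaplacianRep_lineRep⟩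
  | dirichlet a b hab => exact ⟨_, (isEigenbasis_sineBasis hab).isLaplacianRep⟩
  | periodic a b hab => exact ⟨_, (isEigenbasis_expBasis hab).isLaplacianRep⟩

end Domain1D

section ErrorAnalysis

theorem forall_mem_Icc_of_ae {E : Type*} [TopologicalSpace E] {T : ℝ} (hT : 0 < T) {u : ℝ → E}
    (hu : ContinuousOn u (Icc 0 T)) {s : Set E} (hs : IsClosed s)
    (h : ∀ᵐ t ∂volume.restrict (Icc 0 T), u t ∈ s) : ∀ t ∈ Icc 0 T, u t ∈ s := by
  have hclosed : IsClosed (Icc 0 T ∩ u ⁻¹' s) := hu.preimage_isClosed_of_isClosed isClosed_Icc hs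
  have hdense : Ioo 0 T ⊆ closure (Icc 0 T ∩ u ⁻¹' s) :=
    ((Measure.dense_of_ae ((ae_restrict_iff' measurableSet_Icc).1 h)).open_subset_closure_inter
      isOpen_Ioo).trans <| closure_mono fun t ht =>
        ⟨Ioo_subset_Icc_self ht.1, ht.2 (Ioo_subset_Icc_self ht.1)⟩
  intro t ht
  rw [← closure_Ioo hT.ne] at ht
  exact (closure_minimal hdense isClosed_closure ht |> hclosed.closure_subset).2

theorem dist_iterate_le {α : Type*} [PseudoMetricSpace α] {Φ : α → α} {K : ℝ≥0}
    (hΦ : LipschitzWith K Φ) (hK : 1 ≤ K) {v : ℕ → α} {δ : ℝ} {k : ℕ}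
    (hv : ∀ j < k, dist (Φ (v j)) (v (j + 1)) ≤ δ) :
    dist (Φ^[k] (v 0)) (v k) ≤ k * K ^ k * δ := by
  have hδ : 0 < k → 0 ≤ δ := fun hk => dist_nonneg.trans (hv 0 hk)
  induction k with
  | zero => simp
  | succ k ih =>
    rw [Function.iterate_succ_apply']
    have hδ0 := hδ k.succ_pos
    have hK1 : (1 : ℝ) ≤ (K : ℝ) ^ (k + 1) := one_le_pow₀ (mod_cast hK)
    calc dist (Φ (Φ^[k] (v 0))) (v (k + 1))
        ≤ dist (Φ (Φ^[k] (v 0))) (Φ (v k)) + dist (Φ (v k)) (v (k + 1)) := dist_triangle _ _ _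
      _ ≤ K * (k * K ^ k * δ) + (K : ℝ) ^ (k + 1) * δ := by
          refine add_le_add (hΦ.dist_le_mul_of_le ?_) ?_
          · exact ih (fun j hj => hv j (hj.trans k.lt_succ_self)) fun _ => hδ0
          · exact (hv k k.lt_succ_self).trans (le_mul_of_one_le_left hδ0 hK1)
      _ = (k + 1 : ℕ) * (K : ℝ) ^ (k + 1) * δ := by
          push_cast
          ring

theorem one_add_mul_pow_le_exp {c τ T : ℝ} (hc : 0 ≤ c) (hτ : 0 ≤ τ) {k : ℕ} (hk : k * τ ≤ T) :
    (1 + c * τ) ^ k ≤ Real.exp (c * T) :=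
  calc (1 + c * τ) ^ k ≤ Real.exp (c * τ) ^ k := by
        gcongr
        rw [add_comm]
        exact Real.add_one_le_exp _
    _ = Real.exp (c * (k * τ)) := by rw [← Real.exp_nat_mul, mul_left_comm]
    _ ≤ Real.exp (c * T) := by gcongr

namespace SpectralRep

variable {H : Type*} [NormedAddCommGroup H] [InnerProductSpace ℂ H]

theorem intervalIntegrable_bandLap_add_band (L : SpectralRep H) {F : H → H} {K : ℝ≥0} {M T : ℝ}
    {u : ℝ → H} (hF : LipschitzWith K F) (hF0 : F 0 = 0) (hT : 0 ≤ T)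
    (hmeas : AEStronglyMeasurable u (volume.restrict (Icc 0 T)))
    (hM : ∀ᵐ t ∂volume.restrict (Icc 0 T), ‖u t‖ ≤ M) (N : ℕ) :
    IntervalIntegrable (fun s => L.bandLap N (u s) + L.band N (F (u s))) volume 0 T := by
  rw [intervalIntegrable_iff_integrableOn_Icc_of_le hT]
  refine Integrable.of_bound (C := ‖L.bandLap N‖ * M + K * M) ?_ ?_
  · exact ((L.bandLap N).continuous.comp_aestronglyMeasurable hmeas).add
      ((L.band N).continuous.comp_aestronglyMeasurable
        (hF.continuous.comp_aestronglyMeasurable hmeas))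
  · filter_upwards [hM] with s hs
    refine norm_add_le_of_le ((L.bandLap N).le_opNorm_of_le hs) ((L.norm_band_le N _).trans ?_)
    exact (hF.norm_le_mul hF0 _).trans (by gcongr)

/-- `u` solves `i u' = L u + F u` on `[0, T]` in the sense that every spectral truncation of the
equation holds, integrated in time, and `u` and `F u` are bounded in the energy norm by `M` and
`K M`. -/
structure IsEnergySolution (L : SpectralRep H) (F : H → H) (K : ℝ≥0) (M T : ℝ) (u : ℝ → H) :
    Prop where
  nonneg : 0 ≤ M
  aestronglyMeasurable : AEStronglyMeasurable u (volume.restrict (Icc 0 T))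
  ae_norm_le : ∀ᵐ t ∂volume.restrict (Icc 0 T), ‖u t‖ ≤ M
  ae_energy_le : ∀ᵐ t ∂volume.restrict (Icc 0 T), L.energy (u t) ≤ ENNReal.ofReal M ^ 2
  ae_energy_comp_le : ∀ᵐ t ∂volume.restrict (Icc 0 T),
    L.energy (F (u t)) ≤ ENNReal.ofReal (K * M) ^ 2
  band_eq : ∀ N, ∀ t ∈ Icc 0 T,
    L.band N (u t) = L.band N (u 0)
      - Complex.I • ∫ s in (0 : ℝ)..t, (L.bandLap N (u s) + L.band N (F (u s)))

namespace IsEnergySolution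

variable {L : SpectralRep H} {F : H → H} {K : ℝ≥0} {M T : ℝ} {u : ℝ → H}
  (hu : L.IsEnergySolution F K M T u)

include hu

theorem intervalIntegrable (hF : LipschitzWith K F) (hF0 : F 0 = 0) (hT : 0 < T) (N : ℕ) :
    IntervalIntegrable (fun s => L.bandLap N (u s) + L.band N (F (u s))) volume 0 T :=
  L.intervalIntegrable_bandLap_add_band hF hF0 hT.le hu.aestronglyMeasurable hu.ae_norm_le N

theorem continuousOn_band_comp (hF : LipschitzWith K F) (hF0 : F 0 = 0) (hT : 0 < T) (N : ℕ) :
    ContinuousOn (fun t => L.band N (u t)) (Icc 0 T) := by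
  refine ContinuousOn.congr ?_ (hu.band_eq N)
  have hint := intervalIntegral.continuousOn_primitive_interval'
    (hu.intervalIntegrable hF hF0 hT N) left_mem_uIcc
  rw [uIcc_of_le hT.le] at hint
  fun_prop

theorem norm_sub_band_le (hF : LipschitzWith K F) (hF0 : F 0 = 0) (hT : 0 < T) (N : ℕ) {t : ℝ}
    (ht : t ∈ Icc 0 T) :
    ‖u t - L.band (N + 1) (u t)‖ ≤ √(1 / ((N : ℝ) + 1)) * M := by
  have htrunc : ∀ N', ‖L.band N' (u t) - L.band (N + 1) (L.band N' (u t))‖ ≤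
      √(1 / ((N : ℝ) + 1)) * M := fun N' => by
    refine forall_mem_Icc_of_ae (s := {v | ‖v - L.band (N + 1) v‖ ≤ √(1 / ((N : ℝ) + 1)) * M}) hT
      (hu.continuousOn_band_comp hF hF0 hT N') (isClosed_le (by fun_prop) continuous_const) ?_ t ht
    filter_upwards [hu.ae_energy_le] with s hs
    rw [L.band_comm, ← map_sub]
    exact (L.norm_band_le N' _).trans (L.norm_sub_band_le hu.nonneg hs N)
  have hlim := L.tendsto_band (u t)
  refine le_of_tendsto (hlim.sub (((L.band (N + 1)).continuous.tendsto _).comp hlim)).norm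
    (Eventually.of_forall htrunc)

theorem continuousOn (hF : LipschitzWith K F) (hF0 : F 0 = 0) (hT : 0 < T) :
    ContinuousOn u (Icc 0 T) := by
  refine TendstoUniformlyOn.continuousOn (F := fun N t => L.band (N + 1) (u t)) (p := atTop) ?_
    (Frequently.of_forall fun N => hu.continuousOn_band_comp hF hF0 hT (N + 1))
  have hrate : Tendsto (fun N : ℕ => √(1 / ((N : ℝ) + 1)) * M) atTop (𝓝 0) := by
    simpa using (tendsto_one_div_add_atTop_nhds_zero_nat.sqrt).mul_const M
  rw [Metric.tendstoUniformlyOn_iff]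
  intro δ hδ
  filter_upwards [hrate.eventually_lt_const hδ] with N hN t ht
  rw [dist_eq_norm]
  exact (hu.norm_sub_band_le hF hF0 hT N ht).trans_lt hN

theorem norm_le (hF : LipschitzWith K F) (hF0 : F 0 = 0) (hT : 0 < T) {t : ℝ}
    (ht : t ∈ Icc 0 T) : ‖u t‖ ≤ M :=
  forall_mem_Icc_of_ae (s := {v | ‖v‖ ≤ M}) hT (hu.continuousOn hF hF0 hT)
    (isClosed_le continuous_norm continuous_const) hu.ae_norm_le t ht

theorem norm_flow_sub_le (hF : LipschitzWith K F) (hF0 : F 0 = 0) (hT : 0 < T) {t : ℝ}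
    (ht : t ∈ Icc 0 T) (s : ℝ) :
    ‖L.flow s (u t) - u t‖ ≤ √(2 * |s|) * M :=
  forall_mem_Icc_of_ae (s := {v | ‖L.flow s v - v‖ ≤ √(2 * |s|) * M}) hT (hu.continuousOn hF hF0 hT)
    (isClosed_le (by fun_prop) continuous_const)
    (hu.ae_energy_le.mono fun _ h => L.norm_flow_sub_le hu.nonneg h s) t ht

theorem norm_flow_comp_sub_le (hF : LipschitzWith K F) (hF0 : F 0 = 0) (hT : 0 < T) {t : ℝ}
    (ht : t ∈ Icc 0 T) (s : ℝ) : ‖L.flow s (F (u t)) - F (u t)‖ ≤ √(2 * |s|) * (K * M) :=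
  forall_mem_Icc_of_ae (s := {v | ‖L.flow s v - v‖ ≤ √(2 * |s|) * (K * M)}) hT
    (hF.continuous.comp_continuousOn (hu.continuousOn hF hF0 hT))
    (isClosed_le (by fun_prop) continuous_const)
    (hu.ae_energy_comp_le.mono fun _ h =>
      L.norm_flow_sub_le (mul_nonneg K.2 hu.nonneg) h s) t ht

theorem hasDerivWithinAt_flow_band [CompleteSpace H] (hF : LipschitzWith K F) (hF0 : F 0 = 0)
    (hT : 0 < T) (N : ℕ) {t : ℝ} (ht : t ∈ Icc 0 T) :
    HasDerivWithinAt (fun s => L.flow (-s) (L.band N (u s)))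
      (-Complex.I • L.flow (-t) (L.band N (F (u t)))) (Icc 0 T) t := by
  have : Fact (t ∈ Icc 0 T) := ⟨ht⟩
  have hcont := hu.continuousOn hF hF0 hT
  have hcontF := hF.continuous.comp_continuousOn hcont
  have hrhs : ContinuousOn (fun s => L.bandLap N (u s) + L.band N (F (u s))) (Icc 0 T) :=
    ((L.bandLap N).continuous.comp_continuousOn hcont).add
      ((L.band N).continuous.comp_continuousOn hcontF)
  have hint : IntervalIntegrable (fun s => L.bandLap N (u s) + L.band N (F (u s))) volume 0 t :=
    (hu.intervalIntegrable hF hF0 hT N).mono_set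
      (by simpa [uIcc_of_le hT.le, uIcc_of_le ht.1] using Icc_subset_Icc_right ht.2)
  have hband : HasDerivWithinAt (fun s => L.band N (u s))
      (-(Complex.I • (L.bandLap N (u t) + L.band N (F (u t))))) (Icc 0 T) t := by
    refine HasDerivWithinAt.congr ?_ (hu.band_eq N) (hu.band_eq N t ht)
    exact ((intervalIntegral.integral_hasDerivWithinAt_right hint
      (hrhs.stronglyMeasurableAtFilter_nhdsWithin measurableSet_Icc t)
      (hrhs t ht)).const_smul Complex.I).const_sub _
  have hflow : HasDerivAt (fun s => (L.flow (-s) ∘L L.band N).restrictScalars ℝ)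
      ((Complex.I • L.flow (-t) ∘L L.bandLap N).restrictScalars ℝ) t := by
    have hneg := (L.hasDerivAt_flow_comp_band N (-t)).scomp t (hasDerivAt_neg t)
    rw [neg_one_smul, neg_smul, neg_neg] at hneg
    exact (ContinuousLinearMap.restrictScalarsL ℂ H H ℝ ℝ).hasFDerivAt.comp_hasDerivAt t hneg
  refine ((hflow.hasDerivWithinAt.clm_apply hband).congr_deriv ?_).congr
    (fun s _ => congrArg _ (L.band_band N (u s)).symm) (congrArg _ (L.band_band N (u t)).symm)
  change Complex.I • L.flow (-t) (L.bandLap N (L.band N (u t))) + L.flow (-t) (L.band N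
    (-(Complex.I • (L.bandLap N (u t) + L.band N (F (u t)))))) = _
  rw [bandLap_band, map_neg, map_smul, map_add, band_bandLap, band_band, map_neg, map_smul,
    map_add, smul_add, neg_smul]
  abel

theorem norm_flow_sub_add_le [CompleteSpace H] (hF : LipschitzWith K F) (hF0 : F 0 = 0)
    (hT : 0 < T) {s t c : ℝ} {z : H} (hs : 0 ≤ s) (hst : s ≤ t) (ht : t ≤ T)
    (hz : ∀ r ∈ Icc s t, ‖L.flow (s - r) (F (u r)) - z‖ ≤ c) :
    ‖L.flow (s - t) (u t) - u s + ((t - s : ℝ) * Complex.I) • z‖ ≤ c * (t - s) := by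
  have hshift : ∀ N r v, L.flow (-r) (L.band N v) = L.flow (-s) (L.band N (L.flow (s - r) v)) :=
    fun N r v => by rw [L.band_flow, L.flow_flow, neg_add_eq_sub, sub_sub_cancel_left]
  have htrunc : ∀ N, ‖L.band N (L.flow (s - t) (u t) - u s + ((t - s : ℝ) * Complex.I) • z)‖ ≤
      c * (t - s) := fun N => by
    have hderiv : ∀ r ∈ Icc s t, HasDerivWithinAt
        (fun r : ℝ => L.flow (-r) (L.band N (u r)) + r • Complex.I • L.flow (-s) (L.band N z))
        (-Complex.I • L.flow (-r) (L.band N (F (u r)))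
          + (1 : ℝ) • Complex.I • L.flow (-s) (L.band N z)) (Icc s t) r := fun r hr =>
      ((hu.hasDerivWithinAt_flow_band hF hF0 hT N ⟨hs.trans hr.1, hr.2.trans ht⟩).mono
        (Icc_subset_Icc hs ht)).add ((hasDerivWithinAt_id r _).smul_const _)
    have hbound := norm_image_sub_le_of_norm_deriv_le_segment' (C := c) hderiv
      (fun r hr => ?_) t (right_mem_Icc.2 hst)
    · rw [← L.norm_flow (-s)]
      refine (congrArg norm ?_).trans_le hbound
      simp only [map_add, map_sub, map_smul]
      rw [← hshift, mul_smul, Complex.coe_smul, sub_smul]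
      abel
    · rw [one_smul, neg_smul, neg_add_eq_sub, ← smul_sub, norm_smul, Complex.norm_I, one_mul,
        hshift N r, ← map_sub, ← map_sub, norm_flow]
      refine (L.norm_band_le N _).trans ?_
      rw [norm_sub_rev]
      exact hz r (Ico_subset_Icc_self hr)
  exact le_of_tendsto (L.tendsto_band _).norm (Eventually.of_forall htrunc)

theorem norm_sub_le [CompleteSpace H] (hF : LipschitzWith K F) (hF0 : F 0 = 0) (hT : 0 < T)
    {s t : ℝ} (hs : 0 ≤ s) (hst : s ≤ t) (ht : t ≤ T) :
    ‖u t - u s‖ ≤ √(2 * (t - s)) * M + K * M * (t - s) := by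
  have := hu.nonneg
  have hbound : ‖L.flow (s - t) (u t) - u s‖ ≤ K * M * (t - s) := by
    have h := hu.norm_flow_sub_add_le hF hF0 hT (z := 0) (c := K * M) hs hst ht fun r hr => by
      rw [sub_zero, norm_flow]
      exact (hF.norm_le_mul hF0 _).trans
        (by gcongr; exact hu.norm_le hF hF0 hT ⟨hs.trans hr.1, hr.2.trans ht⟩)
    rwa [smul_zero, add_zero] at h
  have hflow := hu.norm_flow_sub_le hF hF0 hT ⟨hs.trans hst, ht⟩ (s - t)
  rw [abs_sub_comm, abs_of_nonneg (sub_nonneg.2 hst)] at hflow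
  calc ‖u t - u s‖ = ‖(u t - L.flow (s - t) (u t)) + (L.flow (s - t) (u t) - u s)‖ := by
        rw [sub_add_sub_cancel]
    _ ≤ _ := norm_add_le_of_le (by rwa [norm_sub_rev]) hbound

theorem norm_flow_comp_sub_comp_le [CompleteSpace H] (hF : LipschitzWith K F) (hF0 : F 0 = 0)
    (hT : 0 < T) {s r τ : ℝ} (hs : 0 ≤ s) (hsr : s ≤ r) (hrτ : r ≤ s + τ) (hr : r ≤ T) :
    ‖L.flow (s - r) (F (u r)) - F (u s)‖ ≤ 2 * √(2 * τ) * (K * M) + K ^ 2 * M * τ := by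
  have hM := hu.nonneg
  have hincr : ‖F (u r) - F (u s)‖ ≤ K * (√(2 * τ) * M + K * M * τ) := by
    refine (hF.norm_sub_le _ _).trans ?_
    gcongr
    refine (hu.norm_sub_le hF hF0 hT hs hsr hr).trans ?_
    have : r - s ≤ τ := by linarith
    gcongr
  have hflow : ‖L.flow (s - r) (F (u s)) - F (u s)‖ ≤ √(2 * τ) * (K * M) := by
    refine (hu.norm_flow_comp_sub_le hF hF0 hT ⟨hs, hsr.trans hr⟩ _).trans ?_
    rw [abs_sub_comm, abs_of_nonneg (sub_nonneg.2 hsr)]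
    have : r - s ≤ τ := by linarith
    gcongr
  calc ‖L.flow (s - r) (F (u r)) - F (u s)‖
      = ‖L.flow (s - r) (F (u r) - F (u s)) + (L.flow (s - r) (F (u s)) - F (u s))‖ := by
        rw [map_sub, sub_add_sub_cancel]
    _ ≤ K * (√(2 * τ) * M + K * M * τ) + √(2 * τ) * (K * M) :=
        norm_add_le_of_le (by rwa [norm_flow]) hflow
    _ = 2 * √(2 * τ) * (K * M) + K ^ 2 * M * τ := by ring

theorem norm_flow_step_sub_le [CompleteSpace H] (hF : LipschitzWith K F) (hF0 : F 0 = 0)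
    (hT : 0 < T) {Ψ : H → H} {s τ : ℝ} (hs : 0 ≤ s) (hτ : 0 ≤ τ) (hsτ : s + τ ≤ T)
    (hΨ : ‖Ψ (u s) - u s + (Complex.I * τ) • F (u s)‖ ≤ 2 * (τ * K) ^ 2 * ‖u s‖) :
    ‖L.flow τ (Ψ (u s)) - u (s + τ)‖ ≤ (3 * τ * K ^ 2 + 2 * √(2 * τ) * K) * M * τ := by
  have := hu.nonneg
  have hDuhamel := hu.norm_flow_sub_add_le hF hF0 hT (z := F (u s)) hs
    (le_add_of_nonneg_right hτ) hsτ fun r hr =>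
      hu.norm_flow_comp_sub_comp_le hF hF0 hT hs hr.1 hr.2 (hr.2.trans hsτ)
  rw [sub_add_cancel_left, add_sub_cancel_left, mul_comm (τ : ℂ)] at hDuhamel
  calc ‖L.flow τ (Ψ (u s)) - u (s + τ)‖
      = ‖Ψ (u s) - L.flow (-τ) (u (s + τ))‖ := by
        rw [← L.norm_flow τ (Ψ (u s) - _), map_sub, L.flow_flow_neg]
    _ = ‖(Ψ (u s) - u s + (Complex.I * τ) • F (u s))
          - (L.flow (-τ) (u (s + τ)) - u s + (Complex.I * τ) • F (u s))‖ := by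
        congr 1
        abel
    _ ≤ 2 * (τ * K) ^ 2 * M + (2 * √(2 * τ) * (K * M) + K ^ 2 * M * τ) * τ := by
        refine norm_sub_le_of_le (hΨ.trans ?_) hDuhamel
        gcongr
        exact hu.norm_le hF hF0 hT ⟨hs, (le_add_of_nonneg_right hτ).trans hsτ⟩
    _ = (3 * τ * K ^ 2 + 2 * √(2 * τ) * K) * M * τ := by ring

theorem norm_iterate_sub_le [CompleteSpace H] (hF : LipschitzWith K F) (hF0 : F 0 = 0)
    (hT : 0 < T) {Ψ : H → H} {τ : ℝ} {Λ : ℝ≥0} (hτ : 0 < τ) (hΨ : LipschitzWith Λ Ψ) (hΛ : 1 ≤ Λ)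
    (hΨF : ∀ t ∈ Icc 0 T, ‖Ψ (u t) - u t + (Complex.I * τ) • F (u t)‖ ≤ 2 * (τ * K) ^ 2 * ‖u t‖)
    {k : ℕ} (hk : k * τ ≤ T) :
    ‖(fun v => L.flow τ (Ψ v))^[k] (u 0) - u (k * τ)‖ ≤
      T * Λ ^ k * ((3 * τ * K ^ 2 + 2 * √(2 * τ) * K) * M) := by
  have hM := hu.nonneg
  have hlip : LipschitzWith Λ fun v => L.flow τ (Ψ v) := LipschitzWith.of_dist_le_mul fun v w => by
    rw [dist_eq_norm, ← map_sub, norm_flow, ← dist_eq_norm]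
    exact hΨ.dist_le_mul v w
  have hlocal : ∀ j < k, dist (L.flow τ (Ψ (u (j * τ)))) (u ((j + 1 : ℕ) * τ)) ≤
      (3 * τ * K ^ 2 + 2 * √(2 * τ) * K) * M * τ := fun j hj => by
    have hjk : ((j + 1 : ℕ) : ℝ) * τ ≤ T := le_trans (by gcongr; exact hj) hk
    rw [dist_eq_norm]
    push_cast [add_one_mul] at hjk ⊢
    have hj0 : 0 ≤ j * τ := by positivity
    exact hu.norm_flow_step_sub_le hF hF0 hT hj0 hτ.le hjk (hΨF _ ⟨hj0, by linarith⟩)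
  have hfan := dist_iterate_le hlip hΛ (v := fun j : ℕ => u (j * τ)) hlocal
  simp only [Nat.cast_zero, zero_mul] at hfan
  rw [← dist_eq_norm]
  calc _ ≤ k * Λ ^ k * ((3 * τ * K ^ 2 + 2 * √(2 * τ) * K) * M * τ) := hfan
    _ = k * τ * Λ ^ k * ((3 * τ * K ^ 2 + 2 * √(2 * τ) * K) * M) := by ring
    _ ≤ T * Λ ^ k * ((3 * τ * K ^ 2 + 2 * √(2 * τ) * K) * M) := by gcongr

theorem norm_iterate_sub_le_mul_sqrt [CompleteSpace H] (hF : LipschitzWith K F) (hF0 : F 0 = 0)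
    (hT : 0 < T) {Ψ : H → H} {τ : ℝ} {c : ℝ≥0} (hτ : 0 < τ) (hΨ : LipschitzWith (1 + c * ‖τ‖₊) Ψ)
    (hnorm : ∀ v, ‖Ψ v‖ = ‖v‖)
    (hΨF : ∀ t ∈ Icc 0 T, ‖Ψ (u t) - u t + (Complex.I * τ) • F (u t)‖ ≤ 2 * (τ * K) ^ 2 * ‖u t‖)
    {k : ℕ} (hk : k * τ ≤ T) :
    ‖(fun v => L.flow τ (Ψ v))^[k] (u 0) - u (k * τ)‖ ≤
      (6 * T * Real.exp (c * T) + 2) * M * K * √τ := by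
  have hM := hu.nonneg
  have hkτ : 0 ≤ k * τ := by positivity
  rcases le_total (K * √τ) 1 with hsmall | hlarge
  · have hΛ : ((1 + c * ‖τ‖₊ : ℝ≥0) : ℝ) ^ k ≤ Real.exp (c * T) := by
      push_cast [coe_nnnorm]
      rw [Real.norm_of_nonneg hτ.le]
      exact one_add_mul_pow_le_exp c.2 hτ.le hk
    have hstep : 3 * τ * K ^ 2 + 2 * √(2 * τ) * K ≤ 6 * (K * √τ) := by
      have hsqrt2 : √2 ≤ 3 / 2 := Real.sqrt_le_iff.2 (by norm_num)
      calc 3 * τ * K ^ 2 + 2 * √(2 * τ) * K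
          = 3 * ((K * √τ) * (K * √τ)) + 2 * √2 * (K * √τ) := by
            rw [Real.sqrt_mul zero_le_two, mul_mul_mul_comm, Real.mul_self_sqrt hτ.le]
            ring
        _ ≤ 3 * (1 * (K * √τ)) + 2 * (3 / 2) * (K * √τ) := by gcongr
        _ = 6 * (K * √τ) := by ring
    calc _ ≤ T * _ * _ := hu.norm_iterate_sub_le hF hF0 hT hτ hΨ le_self_add hΨF hk
      _ ≤ T * Real.exp (c * T) * (6 * (K * √τ) * M) := by gcongr
      _ ≤ (6 * T * Real.exp (c * T) + 2) * M * K * √τ := by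
          have : 0 ≤ M * K * √τ := by positivity
          linarith
  · have hiter : ‖(fun v => L.flow τ (Ψ v))^[k] (u 0)‖ = ‖u 0‖ := by
      clear hk hkτ
      induction k with
      | zero => rfl
      | succ k ih => rw [Function.iterate_succ_apply', norm_flow, hnorm, ih]
    calc _ ≤ M + M := norm_sub_le_of_le
          (hiter.trans_le (hu.norm_le hF hF0 hT (left_mem_Icc.2 hT.le)))
          (hu.norm_le hF hF0 hT ⟨hkτ, hk⟩)
      _ = 2 * M * 1 := by ring
      _ ≤ 2 * M * (K * √τ) := by gcongr
      _ ≤ (6 * T * Real.exp (c * T) + 2) * M * K * √τ := by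
          have : 0 ≤ T * Real.exp (c * T) * (M * (K * √τ)) := by positivity
          linarith

end IsEnergySolution

end SpectralRep

end ErrorAnalysis

section Convergence

theorem isClosed_setOf_ae_norm_le {α E : Type*} [MeasurableSpace α] {μ : Measure α}
    [NormedAddCommGroup E] {p : ℝ≥0∞} [Fact (1 ≤ p)] (B : ℝ) :
    IsClosed {v : Lp E p μ | ∀ᵐ x ∂μ, ‖v x‖ ≤ B} := by
  refine IsSeqClosed.isClosed fun f v hf hlim => ?_
  obtain ⟨φ, -, hφ⟩ := (tendstoInMeasure_of_tendsto_Lp hlim).exists_seq_tendsto_ae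
  filter_upwards [hφ, ae_all_iff.2 hf] with x hx hfx
  exact le_of_tendsto' hx.norm fun i => hfx (φ i)

variable {S : Domain1D} {n : ℕ} {ε M T : ℝ} {u₀ : S.L2} {u : ℝ → S.L2}

namespace IsWeakSolution

variable (hu : IsWeakSolution S n ε T u₀ u)

include hu

theorem ae_hasACRep (hM : 0 ≤ M) (huM : S.linftyH1Norm T u ≤ ENNReal.ofReal M) :
    ∀ᵐ t ∂volume.restrict (Icc 0 T), S.HasACRep (u t) (S.weakDeriv (u t)) ∧
      ‖u t‖ ≤ M ∧ ‖S.weakDeriv (u t)‖ ≤ M := by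
  rw [Domain1D.linftyH1Norm, eLpNorm_exponent_top] at huM
  filter_upwards [hu.memLinftyH1.2.1, ae_le_eLpNormEssSup (f := fun t => S.h1Norm (u t))
    (μ := volume.restrict (Icc 0 T))] with t hmem hle
  have hH1 : S.h1Norm (u t) ≤ M := by
    rw [← ENNReal.ofReal_le_ofReal_iff hM,
      ← Real.enorm_eq_ofReal (r := S.h1Norm (u t)) (Real.sqrt_nonneg _)]
    exact hle.trans huM
  refine ⟨hmem.hasACRep, (Real.le_sqrt_of_sq_le ?_).trans hH1,
    (Real.le_sqrt_of_sq_le ?_).trans hH1⟩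
  · exact le_add_of_nonneg_right (sq_nonneg _)
  · exact le_add_of_nonneg_left (sq_nonneg _)

variable {L : SpectralRep S.L2} {g : ℂ → ℂ} {K : ℝ≥0}

theorem band_eq (hL : S.IsLaplacianRep L) (hg : LipschitzWith K g) (hg0 : g 0 = 0) (hM : 0 ≤ M)
    (huM : S.linftyH1Norm T u ≤ ENNReal.ofReal M)
    (hgu : ∀ᵐ t ∂volume.restrict (Icc 0 T), ∀ᵐ x ∂S.vol,
      g (u t x) = u t x * (regLog n ε (‖u t x‖ ^ 2) : ℂ)) (N : ℕ) {t : ℝ} (ht : t ∈ Icc 0 T) :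
    L.band N (u t) = L.band N (u 0) -
      Complex.I • ∫ s in (0 : ℝ)..t, (L.bandLap N (u s) + L.band N (hg.compLp hg0 (u s))) := by
  have hae := hu.ae_hasACRep hM huM
  have hint := (L.intervalIntegrable_bandLap_add_band (hg.lipschitzWith_compLp hg0)
    (hg.compLp_zero hg0) (ht.1.trans ht.2) hu.memLinftyH1.1 (hae.mono fun _ h => h.2.1) N).mono_set
      (uIcc_subset_uIcc_left (Icc_subset_uIcc ht))
  refine ext_inner_left ℂ fun ψ => ?_
  obtain ⟨d, hd, hd_inner⟩ := hL.exists_hasACRep_band N ψ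
  have hintegrand : ∀ᵐ s ∂volume.restrict (Icc 0 T),
      inner ℂ (S.weakDeriv (L.band N ψ)) (S.weakDeriv (u s)) +
        ∫ x, conj (L.band N ψ x) * (u s x * (regLog n ε (‖u s x‖ ^ 2) : ℂ)) ∂S.vol =
      inner ℂ ψ (L.bandLap N (u s) + L.band N (hg.compLp hg0 (u s))) := by
    filter_upwards [hae, hgu] with s hs hgs
    rw [hd.weakDeriv_eq, hd_inner hs.1, inner_add_right, L.inner_bandLap, ← L.inner_band,
      L2_inner_eq_integral (L.band N ψ)]
    congr 1
    refine integral_congr_ae ?_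
    filter_upwards [hg.coeFn_compLp hg0 (u s), hgs] with x hx hgx
    rw [hx, Function.comp_apply, hgx]
  have hcomm := (innerSL ℂ ψ).intervalIntegral_comp_comm hint
  simp only [innerSL_apply_apply] at hcomm
  have hweak := hu.weak_eq (L.band N ψ) hd.memH1 t ht
  rw [intervalIntegral.integral_congr_ae (g := fun s =>
      inner ℂ ψ (L.bandLap N (u s) + L.band N (hg.compLp hg0 (u s)))) ?_,
    hcomm, ← hu.init, L.inner_band, L.inner_band] at hweak
  · rw [inner_sub_right, inner_smul_right, ← hweak, ← mul_assoc, Complex.I_mul_I]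
    ring
  · filter_upwards [(ae_restrict_iff' measurableSet_Icc).1 hintegrand] with s hs hst
    rw [uIoc_of_le ht.1] at hst
    exact hs ⟨hst.1.le, hst.2.trans ht.2⟩

theorem isEnergySolution (hL : S.IsLaplacianRep L) (hg : LipschitzWith K g) (hg0 : g 0 = 0)
    (hM : 0 ≤ M) (huM : S.linftyH1Norm T u ≤ ENNReal.ofReal M)
    (hgu : ∀ᵐ t ∂volume.restrict (Icc 0 T), ∀ᵐ x ∂S.vol,
      g (u t x) = u t x * (regLog n ε (‖u t x‖ ^ 2) : ℂ)) :
    L.IsEnergySolution (hg.compLp hg0) K M T u where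
  nonneg := hM
  aestronglyMeasurable := hu.memLinftyH1.1
  ae_norm_le := (hu.ae_hasACRep hM huM).mono fun _ h => h.2.1
  ae_energy_le := (hu.ae_hasACRep hM huM).mono fun t h => by
    refine (hL.energy_le h.1).trans ?_
    rw [← ofReal_norm]
    gcongr
    exact h.2.2
  ae_energy_comp_le := (hu.ae_hasACRep hM huM).mono fun t h => by
    obtain ⟨w, hw, hwle⟩ := h.1.comp_lipschitz hg hg0
    refine (hL.energy_le hw).trans ?_
    rw [← ofReal_norm]
    gcongr
    exact hwle.trans (by gcongr; exact h.2.2)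
  band_eq N t ht := hu.band_eq hL hg hg0 hM huM hgu N ht

end IsWeakSolution

theorem lieTrotter_eq_iterate {L : SpectralRep S.L2} (hL : S.IsLaplacianRep L) (n : ℕ) (ε τ : ℝ)
    (u₀ : S.L2) (k : ℕ) :
    lieTrotter S n ε τ u₀ k = (fun v => L.flow τ (flowB S n ε τ v))^[k] u₀ := by
  induction k with
  | zero => rfl
  | succ k ih => rw [Function.iterate_succ_apply', ← ih, lieTrotter, hL.flowA_eq]

theorem IsWeakSolution.norm_lieTrotter_sub_le (hu : IsWeakSolution S n ε T u₀ u) (hn : 1 ≤ n)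
    (hε : 0 < ε) (hε1 : ε ≤ 1) {B : ℝ} (hB : 1 ≤ B) (hM : 0 ≤ M) (hT : 0 < T)
    (huM : S.linftyH1Norm T u ≤ ENNReal.ofReal M)
    (huB : ∀ᵐ t ∂volume.restrict (Icc 0 T), ∀ᵐ x ∂S.vol, ‖u t x‖ ≤ B) {τ : ℝ} (hτ : 0 < τ) {k : ℕ}
    (hk : k * τ ≤ T) :
    ‖lieTrotter S n ε τ u₀ k - u (k * τ)‖ ≤
      (6 * T * Real.exp (4 * n * T) + 2) * M * nonlinLip n ε B * √τ := by
  obtain ⟨L, hL⟩ := S.exists_isLaplacianRep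
  have hg := lipschitzWith_cutNonlin hn hε hε1 hB
  have hg0 := cutNonlin_zero n ε B
  have hF := hg.lipschitzWith_compLp (p := 2) (μ := S.vol) hg0
  have hF0 := hg.compLp_zero (p := 2) (μ := S.vol) hg0
  have hsol := hu.isEnergySolution hL hg hg0 hM huM
    (huB.mono fun t ht => ht.mono fun x hx => cutNonlin_of_norm_le hx)
  have hall : ∀ t ∈ Icc 0 T, ∀ᵐ x ∂S.vol, ‖u t x‖ ≤ B :=
    forall_mem_Icc_of_ae hT (hsol.continuousOn hF hF0 hT) (isClosed_setOf_ae_norm_le B) huB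
  have herr := hsol.norm_iterate_sub_le_mul_sqrt hF hF0 hT hτ (lipschitzWith_flowB S hn hε τ)
    (norm_flowB S n ε τ) (fun t ht => norm_flowB_sub_add_le S hn hε hε1 hB τ (hall t ht)) hk
  rw [lieTrotter_eq_iterate hL, ← hu.init]
  simpa using herr

theorem nonlinLip_le_mul_log (n : ℕ) {ε ε₀ B : ℝ} (hε : 0 < ε) (hε₀ : ε ≤ ε₀) (hε₀1 : ε₀ < 1)
    (hB : 1 ≤ B) :
    nonlinLip n ε B ≤ (2 + (6 * n + 2 * Real.log B) / Real.log ε₀⁻¹) * Real.log ε⁻¹ := by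
  have hε₀0 := hε.trans_le hε₀
  have hlog : 0 < Real.log ε₀⁻¹ := Real.log_pos ((one_lt_inv₀ hε₀0).2 hε₀1)
  have hmono : Real.log ε₀⁻¹ ≤ Real.log ε⁻¹ := Real.log_le_log (by positivity) (by gcongr)
  have hlogB := Real.log_nonneg hB
  have hlogε := hlog.trans_le hmono
  calc (nonlinLip n ε B : ℝ) = 2 * Real.log ε⁻¹ + (6 * n + 2 * Real.log B) * 1 := by
        rw [nonlinLip, NNReal.coe_add, Real.coe_toNNReal _ (by positivity)]
        push_cast
        ring
    _ ≤ 2 * Real.log ε⁻¹ + (6 * n + 2 * Real.log B) * (Real.log ε⁻¹ / Real.log ε₀⁻¹) := by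
        gcongr
        exact (one_le_div hlog).2 hmono
    _ = _ := by ring

theorem IsWeakSolution.exists_forall_ae_norm_le (S : Domain1D) {M : ℝ} (hM : 0 ≤ M) :
    ∃ B : ℝ, 1 ≤ B ∧ ∀ {n : ℕ} {ε T : ℝ} {u₀ : S.L2} {u : ℝ → S.L2}, IsWeakSolution S n ε T u₀ u →
      S.linftyH1Norm T u ≤ ENNReal.ofReal M →
        ∀ᵐ t ∂volume.restrict (Icc 0 T), ∀ᵐ x ∂S.vol, ‖u t x‖ ≤ B := by
  obtain ⟨C, hC⟩ := S.exists_forall_ae_norm_le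
  refine ⟨max 1 (|C| * (M + M)), le_max_left _ _, fun hu huM => ?_⟩
  filter_upwards [hu.ae_hasACRep hM huM] with t ⟨hrep, hut, hdut⟩
  filter_upwards [hC _ _ hrep] with x hx
  refine (hx.trans ?_).trans (le_max_right _ _)
  gcongr
  exact le_abs_self C

end Convergence

end ERLogSE

end

theorem theorem4p2_general (S : ERLogSE.Domain1D) (n : ℕ) (hn : 1 ≤ n) (ε₀ : ℝ) (hε₀ : ε₀ < 1)
    (M T : ℝ) (hT : 0 < T) :
    ∃ C : ℝ, 0 < C ∧ ∀ ε : ℝ, 0 < ε → ε ≤ ε₀ → ∀ (u₀ : S.L2) (u : ℝ → S.L2),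
      ERLogSE.IsWeakSolution S n ε T u₀ u → S.linftyH1Norm T u ≤ ENNReal.ofReal M →
        ∀ τ : ℝ, 0 < τ → ∀ k : ℕ, (k : ℝ) * τ ≤ T →
          ‖ERLogSE.lieTrotter S n ε τ u₀ k - u ((k : ℝ) * τ)‖ ≤
            C * Real.log ε⁻¹ * τ ^ (1 / 2 : ℝ) := by
  obtain ⟨B, hB, hbound⟩ := ERLogSE.IsWeakSolution.exists_forall_ae_norm_le S (le_max_right M 0)
  set A : ℝ := (6 * T * Real.exp (4 * n * T) + 2) * max M 0
  set D : ℝ := 2 + (6 * n + 2 * Real.log B) / Real.log ε₀⁻¹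
  refine ⟨|A * D| + 1, by positivity, fun ε hε hεε₀ u₀ u hu huM τ hτ k hk => ?_⟩
  have hε1 := hεε₀.trans hε₀.le
  have hlog : 0 ≤ Real.log ε⁻¹ := Real.log_nonneg ((one_le_inv₀ hε).2 hε1)
  replace huM := huM.trans (ENNReal.ofReal_le_ofReal (le_max_left M 0))
  calc ‖ERLogSE.lieTrotter S n ε τ u₀ k - u (k * τ)‖
      ≤ A * ERLogSE.nonlinLip n ε B * √τ :=
        hu.norm_lieTrotter_sub_le hn hε hε1 hB (le_max_right M 0) hT huM (hbound hu huM) hτ hk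
    _ ≤ A * (D * Real.log ε⁻¹) * √τ := by
        gcongr
        exact ERLogSE.nonlinLip_le_mul_log n hε hεε₀ hε₀ hB
    _ = A * D * Real.log ε⁻¹ * τ ^ (1 / 2 : ℝ) := by rw [Real.sqrt_eq_rpow]; ring
    _ ≤ (|A * D| + 1) * Real.log ε⁻¹ * τ ^ (1 / 2 : ℝ) := by
        gcongr
        exact (le_abs_self _).trans (le_add_of_nonneg_right zero_le_one)

theorem theorem4p2 (S : ERLogSE.Domain1D) (n : ℕ) (hn : 2 ≤ n) (τ₀ : ℝ) (hτ₀ : 0 < τ₀) (M : ℝ) :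
    ∃ ε₀ : ℝ, 0 < ε₀ ∧ ε₀ < 1 ∧
      ∀ T : ℝ, 0 < T → ∃ C : ℝ, 0 < C ∧
        ∀ ε : ℝ, 0 < ε → ε ≤ ε₀ →
          ∀ (u₀ : S.L2) (u : ℝ → S.L2),
            ERLogSE.IsWeakSolution S n ε T u₀ u →
            S.linftyH1Norm T u ≤ ENNReal.ofReal M →
            ∀ τ : ℝ, 0 < τ → τ ≤ τ₀ → ∀ k : ℕ, (k : ℝ) * τ ≤ T →
              ‖ERLogSE.lieTrotter S n ε τ u₀ k - u ((k : ℝ) * τ)‖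
                ≤ C * Real.log ε⁻¹ * τ ^ (1 / 2 : ℝ) := by
  refine ⟨1 / 2, by norm_num, by norm_num, fun T hT => ?_⟩
  obtain ⟨C, hC, hle⟩ := theorem4p2_general S n (by omega) (1 / 2) (by norm_num) M T hT
  exact ⟨C, hC, fun ε hε hε₀ u₀ u hu huM τ hτ _ => hle ε hε hε₀ u₀ u hu huM τ hτ⟩
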